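/- A \emph{$d$-dimensional structured game} between a Learner with $n\ge 1$ actions and an Adversary with $m\ge 1$ actions ($d\ge 1$) is given by vectors $v_i,w_j,v'_i,w'_j\in\mathbb R^d$ ($i\in[n]$, $j\in[m]$) of Euclidean norm at most $1$; the payoffs are $u_L(i,j)=\langle v_i,w_j\rangle$ for the Learner and $u_A(i,j)=\langle v'_i,w'_j\rangle$ for the Adversary. A distribution $\mu$ on $[n]\times[m]$ is an \emph{$\varepsilon$-correlated equilibrium} if $\mathbb E_{(i,j)\sim\mu}[u_L(\phi(i),j)-u_L(i,j)]\le\varepsilon$ for all $\phi:[n]\to[n]$ and $\mathbb E_{(i,j)\sim\mu}[u_A(i,\psi(j))-u_A(i,j)]\le\varepsilon$ for all $\psi:[m]\to[m]$. A \emph{learning algorithm} maps the opponent's past mixed actions to the player's next mixed action. A \emph{convex decomposition oracle} for vectors $a_1,\dots,a_n$ is a fixed map which, given $x\in\mathrm{conv}\{a_1,\dots,a_n\}$, returns a sparse list of actions and weights, i.e. a mixed action $p$ with $\sum_i p_i a_i=x$; its running time $\tau$ also bounds the length of the list. Running times are numbers of unit-cost steps (arithmetic and comparisons of exact reals, index operations)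 of a real random access machine. The Learner's program may call an oracle for $(v_i)$ and is shown, after each round, the embedding $\sum_j q_jw_j$ of the Adversary's mixed action $q$; the Adversary's program may call an oracle for $(w'_j)$ and is shown the embedding $\sum_i p_iv'_i$ of the Learner's mixed action $p$. Each program receives as input, besides $d$ and $T$, a finite discretization of the convex hull of its player's own vectors $(v_i)$ or $(w'_j)$: a list of points of this hull that depends only on these vectors and on $T$, of length at most $(d+T)^C$; finding it is not counted in the running time. There are an absolute constant $C$ and a single program such that for every $d$-dimensional structured game $G$, every $T\ge 1$ and all convex decomposition oracles for the two players, with running times $\tau_L,\tau_A$, there is a pair of learning algorithms with the following properties. (1) For every $\varepsilon\in(0,1]$ with $$T\ \ge\ \Big(\frac{C}{\varepsilon}\Big)^{(d+3)/2}\Big(1+\log\frac1\varepsilon\Big)^{C},$$ if both players follow their algorithms for $T$ rounds, with mixed actions $p_t,q_t$, then the average distribution of play $\frac1T\sum_{t=1}^T p_t\otimes q_t$ is an $\varepsilon$-correlated equilibrium of $G$. (2) Against arbitrary behaviour of the opponent, each player's algorithm is computed by the program over the $T$ rounds in at most $(d+T+\tau)^{C}$ steps per round, where $\tau$ is the running time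 of that player's oracle. (3) Moreover there is a program that computes $\varepsilon$-correlated equilibria in time $(1/\varepsilon)^{O(d)}$: for every $k$ there is $K$ such that for every $d$-dimensional structured game $G$, all convex decomposition oracles for $(v_i)$ and $(w'_j)$ with running time at most $(d+1)^k$, and every $\varepsilon\in(0,1/2]$, the program, given $d$, $\varepsilon$, these oracles, look-up access to the vectors $v_i,w_j,v'_i,w'_j$, and finite discretizations of $\mathrm{conv}\{v_i\}$ and $\mathrm{conv}\{w'_j\}$ with at most $(1/\varepsilon)^{Cd}$ points each (each depending only on $\varepsilon$ and the respective vectors), outputs an $\varepsilon$-correlated equilibrium of $G$ as a sparse list after at most $(1/\varepsilon)^{Kd}$ steps. -/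

import Mathlib

open Finset

noncomputable section

/-! ### Structured games and correlated equilibria -/

/-- A `d`-dimensional structured game with `n` actions for the Learner and `m` actions for the
Adversary. The Learner's payoff is `⟪v i, w j⟫`, the Adversary's payoff is `⟪v' i, w' j⟫`, and
all embeddings lie in the Euclidean unit ball. -/
structure StructuredGame (d n m : ℕ) where
  v : Fin n → EuclideanSpace ℝ (Fin d)
  w : Fin m → EuclideanSpace ℝ (Fin d)
  v' : Fin n → EuclideanSpace ℝ (Fin d)
  w' : Fin m → EuclideanSpace ℝ (Fin d)
  norm_v : ∀ i, ‖v i‖ ≤ 1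
  norm_w : ∀ j, ‖w j‖ ≤ 1
  norm_v' : ∀ i, ‖v' i‖ ≤ 1
  norm_w' : ∀ j, ‖w' j‖ ≤ 1

/-- The Learner's payoff. -/
def StructuredGame.uL {d n m : ℕ} (G : StructuredGame d n m) (i : Fin n) (j : Fin m) : ℝ :=
  inner ℝ (G.v i) (G.w j)

/-- The Adversary's payoff. -/
def StructuredGame.uA {d n m : ℕ} (G : StructuredGame d n m) (i : Fin n) (j : Fin m) : ℝ :=
  inner ℝ (G.v' i) (G.w' j)

/-- `μ` is an `ε`-correlated equilibrium of `G`: a probability distribution on action pairs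
such that neither player gains more than `ε` in expectation by applying a swap function to the
recommended actions. -/
def IsCorrelatedEq {d n m : ℕ} (G : StructuredGame d n m) (ε : ℝ)
    (μ : Fin n × Fin m → ℝ) : Prop :=
  μ ∈ stdSimplex ℝ (Fin n × Fin m) ∧
  (∀ φ : Fin n → Fin n,
    ∑ a : Fin n × Fin m, μ a * (G.uL (φ a.1) a.2 - G.uL a.1 a.2) ≤ ε) ∧
  (∀ φ : Fin m → Fin m,
    ∑ a : Fin n × Fin m, μ a * (G.uA a.1 (φ a.2) - G.uA a.1 a.2) ≤ ε)

/-! ### Repeated play -/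

/-- Mixed actions over `n` pure actions. -/
abbrev MixedAction (n : ℕ) : Type := stdSimplex ℝ (Fin n)

/-- The embedding `∑ i, p i • a i` of a mixed action. -/
def embed {d n : ℕ} (a : Fin n → EuclideanSpace ℝ (Fin d)) (p : MixedAction n) :
    EuclideanSpace ℝ (Fin d) :=
  ∑ i, (p : Fin n → ℝ) i • a i

/-- A learning algorithm for a player with `n` actions against an opponent with `m` actions: it
maps the list of the opponent's past mixed actions (oldest first) to the next mixed action. -/
abbrev LearningAlgorithm (n m : ℕ) : Type := List (MixedAction m) → MixedAction n

/-- The histories (Learner's, Adversary's) after `t` rounds of simultaneous play. -/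
def playHistory {n m : ℕ} (L : LearningAlgorithm n m) (A : LearningAlgorithm m n) :
    ℕ → List (MixedAction n) × List (MixedAction m)
  | 0 => ([], [])
  | t + 1 =>
    let h := playHistory L A t
    (h.1 ++ [L h.2], h.2 ++ [A h.1])

/-- The average distribution of play over the first `T` rounds,
`(1/T) ∑ t, p_t ⊗ q_t`. -/
def averagePlay {n m : ℕ} (L : LearningAlgorithm n m) (A : LearningAlgorithm m n) (T : ℕ) :
    Fin n × Fin m → ℝ := fun a =>
  (1 / (T : ℝ)) * ∑ t ∈ range T,
    (L (playHistory L A t).2 : Fin n → ℝ) a.1 * (A (playHistory L A t).1 : Fin m → ℝ) a.2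

/-! ### A real random access machine with oracle calls

Memory consists of two-dimensional arrays of natural numbers (used for indices) and of
two-dimensional arrays of exact real numbers; a program names finitely many arrays. Every
elementary statement and every test costs one step. Natural numbers can only be added and
subtracted, reals can be added, subtracted, multiplied, divided and compared, and a natural number
can be cast to a real. -/

structure RamState where
  /-- `N a i j` is entry `(i, j)` of the `a`-th array of natural numbers. -/
  N : ℕ → ℕ → ℕ → ℕ
  /-- `R a i j` is entry `(i, j)` of the `a`-th array of real numbers. -/
  R : ℕ → ℕ → ℕ → ℝ

/-- Index expressions. -/
inductive NExpr where
  | const (c : ℕ)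
  | get (a : ℕ) (i j : NExpr)
  | add (e f : NExpr)
  | sub (e f : NExpr)

def NExpr.eval (s : RamState) : NExpr → ℕ
  | .const c => c
  | .get a i j => s.N a (i.eval s) (j.eval s)
  | .add e f => e.eval s + f.eval s
  | .sub e f => e.eval s - f.eval s

/-- Real expressions. -/
inductive RExpr where
  | cast (e : NExpr)
  | get (a : ℕ) (i j : NExpr)
  | add (e f : RExpr)
  | sub (e f : RExpr)
  | mul (e f : RExpr)
  | div (e f : RExpr)

def RExpr.eval (s : RamState) : RExpr → ℝ
  | .cast e => (e.eval s : ℝ)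
  | .get a i j => s.R a (i.eval s) (j.eval s)
  | .add e f => e.eval s + f.eval s
  | .sub e f => e.eval s - f.eval s
  | .mul e f => e.eval s * f.eval s
  | .div e f => e.eval s / f.eval s

/-- Tests. -/
inductive RamTest where
  | natLT (e f : NExpr)
  | realLT (e f : RExpr)

def RamTest.Holds (s : RamState) : RamTest → Prop
  | .natLT e f => e.eval s < f.eval s
  | .realLT e f => e.eval s < f.eval s

/-- Programs. Arrays are named by constants of the program, entries are addressed indirectly. -/
inductive RamProg where
  | skip
  | setN (a : ℕ) (i j e : NExpr)
  | setR (a : ℕ) (i j : NExpr) (e : RExpr)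
  | seq (p q : RamProg)
  | ite (b : RamTest) (p q : RamProg)
  | while (b : RamTest) (p : RamProg)
  | call (o : ℕ)

/-- Overwrite one entry of an array of natural numbers. -/
def RamState.writeN (s : RamState) (a i j x : ℕ) : RamState :=
  { s with N := fun a' i' j' => if a' = a ∧ i' = i ∧ j' = j then x else s.N a' i' j' }

/-- Overwrite one entry of an array of real numbers. -/
def RamState.writeR (s : RamState) (a i j : ℕ) (x : ℝ) : RamState :=
  { s with R := fun a' i' j' => if a' = a ∧ i' = i ∧ j' = j then x else s.R a' i' j' }

/-- The oracles a program may call: the effect of each call on memory and its cost. -/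
structure OracleEnv where
  act : ℕ → RamState → RamState
  cost : ℕ → ℕ

/-- `RamExec O p s s' c`: started in memory `s`, the program `p` halts in memory `s'` after
exactly `c` steps. -/
inductive RamExec (O : OracleEnv) : RamProg → RamState → RamState → ℕ → Prop
  | skip (s : RamState) : RamExec O .skip s s 1
  | setN (a : ℕ) (i j e : NExpr) (s : RamState) :
      RamExec O (.setN a i j e) s (s.writeN a (i.eval s) (j.eval s) (e.eval s)) 1
  | setR (a : ℕ) (i j : NExpr) (e : RExpr) (s : RamState) :
      RamExec O (.setR a i j e) s (s.writeR a (i.eval s) (j.eval s) (e.eval s)) 1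
  | seq (p q : RamProg) (s s₁ s₂ : RamState) (c₁ c₂ : ℕ) :
      RamExec O p s s₁ c₁ → RamExec O q s₁ s₂ c₂ → RamExec O (.seq p q) s s₂ (c₁ + c₂)
  | iteTrue (b : RamTest) (p q : RamProg) (s s' : RamState) (c : ℕ) :
      b.Holds s → RamExec O p s s' c → RamExec O (.ite b p q) s s' (c + 1)
  | iteFalse (b : RamTest) (p q : RamProg) (s s' : RamState) (c : ℕ) :
      ¬ b.Holds s → RamExec O q s s' c → RamExec O (.ite b p q) s s' (c + 1)
  | whileTrue (b : RamTest) (p : RamProg) (s s₁ s₂ : RamState) (c₁ c₂ : ℕ) :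
      b.Holds s → RamExec O p s s₁ c₁ → RamExec O (.while b p) s₁ s₂ c₂ →
      RamExec O (.while b p) s s₂ (c₁ + c₂ + 1)
  | whileFalse (b : RamTest) (p : RamProg) (s : RamState) :
      ¬ b.Holds s → RamExec O (.while b p) s s 1
  | call (o : ℕ) (s : RamState) : RamExec O (.call o) s (O.act o s) (O.cost o)

/-- Write a vector into row `0` of the `a`-th real array. -/
def RamState.writeVec {d : ℕ} (s : RamState) (a : ℕ) (x : EuclideanSpace ℝ (Fin d)) : RamState :=
  { s with R := fun a' i' j' =>
      if h : a' = a ∧ i' = 0 ∧ j' < d then x ⟨j', h.2.2⟩ else s.R a' i' j' }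

/-- Read a vector from row `0` of the `a`-th real array. -/
def RamState.readVec (d : ℕ) (s : RamState) (a : ℕ) : EuclideanSpace ℝ (Fin d) :=
  WithLp.toLp 2 fun j => s.R a 0 j

/-! ### Convex decomposition oracles -/

/-- A convex decomposition oracle for the action embeddings `a`: a fixed inverse of the embedding
map, which for each point of the convex hull of the `a i` returns, as a sparse list of pairs
(action, weight), a mixed action that embeds to this point. `time` bounds the running time of one
call, hence also the length of its answer. Nothing is known about answers at other points. -/
structure DecompOracle {d n : ℕ} (a : Fin n → EuclideanSpace ℝ (Fin d)) where
  dec : EuclideanSpace ℝ (Fin d) → List (Fin n × ℝ)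
  time : ℕ
  nonneg : ∀ x ∈ convexHull ℝ (Set.range a), ∀ e ∈ dec x, 0 ≤ e.2
  sum_one : ∀ x ∈ convexHull ℝ (Set.range a), ((dec x).map fun e => e.2).sum = 1
  embeds : ∀ x ∈ convexHull ℝ (Set.range a), ((dec x).map fun e => e.2 • a e.1).sum = x
  length_le : ∀ x ∈ convexHull ℝ (Set.range a), (dec x).length ≤ time

/-- The effect of a call of a decomposition oracle: the argument is read from row `0` of real array
`3`; the length of the answer is written to entry `(0, 0)` of index array `3`, the actions to row
`0` of index array `4` and the weights to row `0` of real array `4`. -/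
def DecompOracle.act {d n : ℕ} {a : Fin n → EuclideanSpace ℝ (Fin d)} (D : DecompOracle a)
    (s : RamState) : RamState :=
  let l := D.dec (s.readVec d 3)
  { N := fun a' i' j' =>
      if a' = 3 ∧ i' = 0 ∧ j' = 0 then l.length
      else if h : a' = 4 ∧ i' = 0 ∧ j' < l.length then ((l[j']'h.2.2).1 : ℕ)
      else s.N a' i' j'
    R := fun a' i' j' =>
      if h : a' = 4 ∧ i' = 0 ∧ j' < l.length then (l[j']'h.2.2).2
      else s.R a' i' j' }

/-- The cost of one call. -/
def DecompOracle.cost {d n : ℕ} {a : Fin n → EuclideanSpace ℝ (Fin d)} (D : DecompOracle a) : ℕ :=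
  d + D.time + 1

/-! ### Players as programs -/

/-- A player's program may call the decomposition oracle of its own embedding (call `0`). -/
def playerEnv {d n : ℕ} {a : Fin n → EuclideanSpace ℝ (Fin d)} (D : DecompOracle a) :
    OracleEnv where
  act o s := if o = 0 then D.act s else s
  cost o := if o = 0 then D.cost else 1

/-- The initial memory of a player: row `0` of index array `0` holds the dimension `d`, the
horizon `T` and the number of points of the discretization `S`; row `i` of real array `0` holds
the `i`-th point of `S`; everything else is zero. -/
def playerInit {d : ℕ} (T : ℕ) (S : List (EuclideanSpace ℝ (Fin d))) : RamState where
  N a i j :=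
    if a = 0 ∧ i = 0 then
      (if j = 0 then d else if j = 1 then T else if j = 2 then S.length else 0)
    else 0
  R a i j := if h : a = 0 ∧ j < d then (S.getD i 0) ⟨j, h.2⟩ else 0

/-- The memory `s` displays the mixed action `p` as a sparse list: entry `(0, 0)` of index array
`1` is its length, rows `0` of index array `2` and of real array `2` hold the actions and the
weights. -/
def DisplaysAction {n : ℕ} (s : RamState) (p : MixedAction n) : Prop :=
  (∀ r < s.N 1 0 0, s.N 2 0 r < n ∧ 0 ≤ s.R 2 0 r) ∧
  ∀ i : Fin n, (p : Fin n → ℝ) i =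
    ∑ r ∈ range (s.N 1 0 0), if s.N 2 0 r = (i : ℕ) then s.R 2 0 r else 0

/-- What a player is shown at the start of round `t` (counted from `0`): the embedding of the
opponent's previous mixed action (zero in the first round). -/
def observation {d m : ℕ} (b : Fin m → EuclideanSpace ℝ (Fin d)) (q : ℕ → MixedAction m) :
    ℕ → EuclideanSpace ℝ (Fin d)
  | 0 => 0
  | t + 1 => embed b (q t)

/-- Run over `T` rounds from memory `s₀` with oracles `O`, the program `P` computes the learning
algorithm `L` in at most `B` steps per round, whatever the opponent does. Memory is kept between
rounds. At the start of every round the embedding (through `b`) of the opponent's last mixed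
action appears in row `0` of real array `1`; the program is then run once, and when it halts the
memory must display the mixed action of this round. -/
def RunsWithin {d n m : ℕ} (P : RamProg) (O : OracleEnv) (s₀ : RamState)
    (b : Fin m → EuclideanSpace ℝ (Fin d)) (T B : ℕ) (L : LearningAlgorithm n m) : Prop :=
  ∀ q : ℕ → MixedAction m, ∃ σ : ℕ → RamState, σ 0 = s₀ ∧
    ∀ t < T, ∃ c ≤ B,
      RamExec O P ((σ t).writeVec 1 (observation b q t)) (σ (t + 1)) c ∧
      DisplaysAction (σ (t + 1)) (L ((List.range t).map q))

/-! ### Centralized computation of a correlated equilibrium -/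

/-- Look up the embedding of an action: the action is read from entry `(0, 0)` of index array `5`
and its embedding is written to row `0` of real array `5` (nothing happens if there is no such
action). -/
def lookup {d n : ℕ} (a : Fin n → EuclideanSpace ℝ (Fin d)) (s : RamState) : RamState :=
  if h : s.N 5 0 0 < n then s.writeVec 5 (a ⟨s.N 5 0 0, h⟩) else s

/-- A centralized program may call the decomposition oracles of the Learner (call `0`) and of the
Adversary (call `1`), and may look up single action embeddings (calls `2` to `5`). -/
def centralEnv {d n m : ℕ} (G : StructuredGame d n m) (DL : DecompOracle G.v)
    (DA : DecompOracle G.w') : OracleEnv where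
  act o s :=
    if o = 0 then DL.act s
    else if o = 1 then DA.act s
    else if o = 2 then lookup G.v s
    else if o = 3 then lookup G.w s
    else if o = 4 then lookup G.v' s
    else if o = 5 then lookup G.w' s
    else s
  cost o := if o = 0 then DL.cost else if o = 1 then DA.cost else d + 1

/-- The initial memory of a centralized program: row `0` of index array `0` holds the dimension
`d` and the sizes of the discretizations `S` and `S'`; the rows of real arrays `0` and `1` hold
the points of `S` and of `S'`; entry `(0, 0)` of real array `2` holds `ε`; everything else is
zero. -/
def centralInit {d : ℕ} (ε : ℝ) (S S' : List (EuclideanSpace ℝ (Fin d))) : RamState where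
  N a i j :=
    if a = 0 ∧ i = 0 then
      (if j = 0 then d else if j = 1 then S.length else if j = 2 then S'.length else 0)
    else 0
  R a i j :=
    if h : a = 0 ∧ j < d then (S.getD i 0) ⟨j, h.2⟩
    else if h : a = 1 ∧ j < d then (S'.getD i 0) ⟨j, h.2⟩
    else if a = 2 ∧ i = 0 ∧ j = 0 then ε
    else 0

/-- The memory `s` displays the joint distribution `μ` as a sparse list: entry `(0, 0)` of index
array `1` is its length, rows `0` of index arrays `2` and `6` hold the actions of the Learner and
of the Adversary, row `0` of real array `6` holds the weights. -/
def DisplaysJoint {n m : ℕ} (s : RamState) (μ : Fin n × Fin m → ℝ) : Prop :=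
  (∀ r < s.N 1 0 0, s.N 2 0 r < n ∧ s.N 6 0 r < m ∧ 0 ≤ s.R 6 0 r) ∧
  ∀ a : Fin n × Fin m, μ a =
    ∑ r ∈ range (s.N 1 0 0),
      if s.N 2 0 r = (a.1 : ℕ) ∧ s.N 6 0 r = (a.2 : ℕ) then s.R 6 0 r else 0

end

/-! ### Reasoning about programs of the random access machine -/

-- Each player runs a no-swap-regret method, not over its own actions but over `N` points of the
-- convex hull of its vectors, and plays the oracle's decomposition of the random point. Payoffs are
-- bilinear, so the gain of a swap function under the average play is exactly the swap regret per
-- round (`isCorrelatedEq_averagePlay`), and it remains to bound that regret and the running time.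
--
-- Few points: project an `η`-net of the sphere of radius 2 onto the hull. The support function is
-- then reproduced up to `η² / 4` (`exists_isHullNet`), a quadratic error, while the net has about
-- `η^(-(d-1))` points (`card_le_of_separated`). With `η = √ε` this gives accuracy of order `ε` with
-- `N` about `ε^(-(d-1)/2)`.
--
-- From actions to points: the oracle is a fixed map, so a swap `φ` of actions sends each net point
-- `s` to one fixed point of the hull. Its total gain depends only on its inner product with one
-- vector `Y s`, the observations weighted by how often `s` was played. Some net point does as well
-- in this direction up to `δ * ‖Y s‖`, and these norms add up to at most `T`. Hence swap regret
-- over actions is at most swap regret over net points plus `δ * T` (`IsPlayer.swap_regret`).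
--
-- Swap regret over points: as in Blum and Mansour, one multiplicative weights expert per point,
-- expert `i` being charged the fraction `p i` of the utilities, and `p` stationary for the matrix
-- of the experts' recommendations (`mw_expert_regret`, `mwPlay_swap_regret`). An average over `T`
-- steps of the Markov chain replaces the stationary distribution; it needs only arithmetic and
-- costs 2 in total (`cesaro_almost_stationary`). The second-order terms carry the factors `p i`,
-- which sum to 1, so the regret is about `√(T * N) * log N`. Thus `T` of order `N * (log N)² / ε²`
-- suffices, which is `ε^(-(d+3)/2)` up to logarithms (`regretRate_le`, `net_rounds_le`). One
-- algorithm serves all `ε`, because the net is chosen for nearly the best accuracy attainable in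
-- `T` rounds (`exists_best_accuracy`).
--
-- Running time: `Runs` is a total-correctness triple whose cost bound is a power `X ^ e` of one
-- number `X` that dominates all sizes involved. Composition and loops raise `e` by constants, and
-- syntactic frames (`RamExec.frame`) carry facts past code that does not touch the relevant arrays.
-- The centralized program computes its own horizon and simulates both players (`runs_centralProg`).

attribute [simp] NExpr.eval RExpr.eval RamTest.Holds

namespace RamProg

/-- The arrays of natural numbers that a program may change. -/
def modN : RamProg → ℕ → Prop
  | skip, _ => False
  | setN a _ _ _, b => b = a
  | setR _ _ _ _, _ => False
  | seq p q, b => p.modN b ∨ q.modN b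
  | ite _ p q, b => p.modN b ∨ q.modN b
  | .while _ p, b => p.modN b
  | call _, b => b = 3 ∨ b = 4

/-- The arrays of real numbers that a program may change. -/
def modR : RamProg → ℕ → Prop
  | skip, _ => False
  | setN _ _ _ _, _ => False
  | setR a _ _ _, b => b = a
  | seq p q, b => p.modR b ∨ q.modR b
  | ite _ p q, b => p.modR b ∨ q.modR b
  | .while _ p, b => p.modR b
  | call _, b => b = 4 ∨ b = 5

/-- Sequential composition of a list of programs. -/
def block : List RamProg → RamProg
  | [] => skip
  | p :: ps => seq p (block ps)

/-- The scalar stored in a natural array. -/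
abbrev nvar (a : ℕ) : NExpr := .get a (.const 0) (.const 0)

/-- Counting loop. -/
def forN (c : ℕ) (B : NExpr) (p : RamProg) : RamProg :=
  seq (setN c (.const 0) (.const 0) (.const 0))
    (.while (.natLT (nvar c) B)
      (seq p (setN c (.const 0) (.const 0) (.add (nvar c) (.const 1)))))

attribute [simp] modN modR block forN

end RamProg

/-- Memory outside of the arrays that `p` may change is the same in `s` and `s'`. -/
def Frame (p : RamProg) (s s' : RamState) : Prop :=
  (∀ b, ¬ p.modN b → s'.N b = s.N b) ∧ (∀ b, ¬ p.modR b → s'.R b = s.R b)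

/-- Oracle calls change no arrays besides those used for communication. -/
def OracleEnv.Ok (O : OracleEnv) : Prop :=
  ∀ o s, (∀ b, b ≠ 3 → b ≠ 4 → (O.act o s).N b = s.N b) ∧
    (∀ b, b ≠ 4 → b ≠ 5 → (O.act o s).R b = s.R b)

namespace RamState

@[simp] theorem writeN_R (s : RamState) (a i j x : ℕ) : (s.writeN a i j x).R = s.R := rfl

@[simp] theorem writeR_N (s : RamState) (a i j : ℕ) (x : ℝ) : (s.writeR a i j x).N = s.N := rfl

@[simp] theorem writeN_N_self (s : RamState) (a i j x i' j' : ℕ) :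
    (s.writeN a i j x).N a i' j' = if i' = i ∧ j' = j then x else s.N a i' j' := by
  simp [writeN]

theorem writeN_N_ne (s : RamState) {a b : ℕ} (i j x : ℕ) (h : b ≠ a) :
    (s.writeN a i j x).N b = s.N b := by
  funext i' j'; simp [writeN, h]

@[simp] theorem writeR_R_self (s : RamState) (a i j : ℕ) (x : ℝ) (i' j' : ℕ) :
    (s.writeR a i j x).R a i' j' = if i' = i ∧ j' = j then x else s.R a i' j' := by
  simp [writeR]

theorem writeR_R_ne (s : RamState) {a b : ℕ} (i j : ℕ) (x : ℝ) (h : b ≠ a) :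
    (s.writeR a i j x).R b = s.R b := by
  funext i' j'; simp [writeR, h]

end RamState

theorem Frame.refl (p : RamProg) (s : RamState) : Frame p s s :=
  ⟨fun _ _ => rfl, fun _ _ => rfl⟩

theorem Frame.trans {p : RamProg} {s₁ s₂ s₃ : RamState} (h₁ : Frame p s₁ s₂)
    (h₂ : Frame p s₂ s₃) : Frame p s₁ s₃ :=
  ⟨fun b hb => (h₂.1 b hb).trans (h₁.1 b hb), fun b hb => (h₂.2 b hb).trans (h₁.2 b hb)⟩

theorem Frame.mono {p q : RamProg} {s s' : RamState} (h : Frame p s s')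
    (hN : ∀ b, p.modN b → q.modN b) (hR : ∀ b, p.modR b → q.modR b) : Frame q s s' :=
  ⟨fun b hb => h.1 b (fun h' => hb (hN b h')), fun b hb => h.2 b (fun h' => hb (hR b h'))⟩

/-- The arrays that a program can touch are read off its syntax. Facts about sizes, points and
weights therefore pass through subprograms without any analysis of their runs. -/
theorem RamExec.frame {O : OracleEnv} (hO : O.Ok) {p : RamProg} {s s' : RamState} {c : ℕ}
    (h : RamExec O p s s' c) : Frame p s s' := by
  induction h with
  | skip s => exact Frame.refl _ _
  | setN a i j e s =>
    exact ⟨fun b hb => RamState.writeN_N_ne _ _ _ _ hb, fun b _ => rfl⟩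
  | setR a i j e s =>
    exact ⟨fun b _ => rfl, fun b hb => RamState.writeR_R_ne _ _ _ _ hb⟩
  | seq p q s s₁ s₂ c₁ c₂ _ _ ih₁ ih₂ =>
    exact (ih₁.mono (fun _ => Or.inl) (fun _ => Or.inl)).trans
      (ih₂.mono (fun _ => Or.inr) (fun _ => Or.inr))
  | iteTrue b p q s s' c _ _ ih => exact ih.mono (fun _ => Or.inl) (fun _ => Or.inl)
  | iteFalse b p q s s' c _ _ ih => exact ih.mono (fun _ => Or.inr) (fun _ => Or.inr)
  | whileTrue b p s s₁ s₂ c₁ c₂ _ _ _ ih₁ ih₂ =>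
    exact (ih₁.mono (fun _ h => h) (fun _ h => h)).trans ih₂
  | whileFalse b p s _ => exact Frame.refl _ _
  | call o s =>
    refine ⟨fun b hb => ?_, fun b hb => ?_⟩ <;> simp only [RamProg.modN, RamProg.modR, not_or] at hb
    · exact (hO o s).1 b hb.1 hb.2
    · exact (hO o s).2 b hb.1 hb.2

/-- Started in `s`, the program `p` halts after at most `X ^ e` steps in a state satisfying `Q`. -/
def Runs (O : OracleEnv) (X e : ℕ) (p : RamProg) (s : RamState) (Q : RamState → Prop) : Prop :=
  ∃ s' c, RamExec O p s s' c ∧ c ≤ X ^ e ∧ Q s'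

/-! ### Total-correctness rules with polynomial cost bounds -/

namespace Runs

variable {O : OracleEnv} {X e : ℕ} {p q : RamProg} {s : RamState} {Q Q' : RamState → Prop}

theorem conseq (hO : O.Ok) (h : Runs O X e p s Q) (hQ : ∀ σ, Frame p s σ → Q σ → Q' σ) :
    Runs O X e p s Q' := by
  obtain ⟨s', c, h, hc, hq⟩ := h
  exact ⟨s', c, h, hc, hQ _ (h.frame hO) hq⟩

theorem mono {e' : ℕ} (hX : 4 ≤ X) (h : Runs O X e p s Q) (he : e ≤ e') :
    Runs O X e' p s Q := by
  obtain ⟨s', c, h, hc, hq⟩ := h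
  exact ⟨s', c, h, hc.trans (Nat.pow_le_pow_right (by omega) he), hq⟩

theorem skip (hX : 4 ≤ X) (h : Q s) : Runs O X e .skip s Q :=
  ⟨s, 1, .skip s, Nat.one_le_pow _ _ (by omega), h⟩

theorem setN (hX : 4 ≤ X) {a : ℕ} {i j x : NExpr}
    (h : Q (s.writeN a (i.eval s) (j.eval s) (x.eval s))) : Runs O X e (.setN a i j x) s Q :=
  ⟨_, 1, .setN a i j x s, Nat.one_le_pow _ _ (by omega), h⟩

theorem setR (hX : 4 ≤ X) {a : ℕ} {i j : NExpr} {x : RExpr}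
    (h : Q (s.writeR a (i.eval s) (j.eval s) (x.eval s))) : Runs O X e (.setR a i j x) s Q :=
  ⟨_, 1, .setR a i j x s, Nat.one_le_pow _ _ (by omega), h⟩

theorem call {o : ℕ} (hc : O.cost o ≤ X) (h : Q (O.act o s)) :
    Runs O X (e + 1) (.call o) s Q :=
  ⟨_, _, .call o s, hc.trans (Nat.le_self_pow (by omega) X), h⟩

/-- Since `2 * X ^ e ≤ X ^ (e + 1)`, one more exponent pays for a composition; the second program
may also use the frame of the first. -/
theorem seq (hX : 4 ≤ X) (hO : O.Ok) {Q₁ : RamState → Prop} (h₁ : Runs O X e p s Q₁)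
    (h₂ : ∀ σ, Frame p s σ → Q₁ σ → Runs O X e q σ Q) : Runs O X (e + 1) (.seq p q) s Q := by
  obtain ⟨s₁, c₁, hx₁, hc₁, hq₁⟩ := h₁
  obtain ⟨s₂, c₂, hx₂, hc₂, hq₂⟩ := h₂ s₁ (hx₁.frame hO) hq₁
  refine ⟨s₂, c₁ + c₂, .seq _ _ _ _ _ _ _ hx₁ hx₂, ?_, hq₂⟩
  rw [pow_succ]
  nlinarith [Nat.one_le_pow e X (by omega)]

theorem block_cons (hX : 4 ≤ X) (hO : O.Ok) {Q₁ : RamState → Prop} {ps : List RamProg}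
    (h₁ : Runs O X e p s Q₁)
    (h₂ : ∀ σ, Frame p s σ → Q₁ σ → Runs O X e (.block ps) σ Q) :
    Runs O X (e + 1) (.block (p :: ps)) s Q := seq hX hO h₁ h₂

theorem block_nil (hX : 4 ≤ X) (h : Q s) : Runs O X e (.block []) s Q := skip hX h

/-- The invariant is indexed by the number of completed iterations, and a true guard forces this
number below `n`. The total is at most `n * (X ^ e + 1) + 1`, which two more exponents absorb. -/
theorem while_of {b : RamTest} {n : ℕ} (hX : 4 ≤ X) (hn : n ≤ X) (I : ℕ → RamState → Prop)
    (h0 : I 0 s)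
    (hs : ∀ k σ, I k σ → b.Holds σ → k < n ∧ Runs O X e p σ (I (k + 1))) :
    Runs O X (e + 2) (.while b p) s (fun σ => ∃ k, I k σ ∧ ¬ b.Holds σ) := by
  -- Induction on a bound `m` for the number of iterations that remain.
  have key : ∀ m k σ, n - k ≤ m → I k σ → ∃ s' c, RamExec O (.while b p) σ s' c ∧
      c ≤ m * (X ^ e + 1) + 1 ∧ ∃ k, I k s' ∧ ¬ b.Holds s' := by
    intro m
    induction m with
    | zero =>
      intro k σ hk hI
      have hb : ¬ b.Holds σ := fun hb => by have := (hs k σ hI hb).1; omega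
      exact ⟨σ, 1, .whileFalse _ _ _ hb, by omega, k, hI, hb⟩
    | succ m ih =>
      intro k σ hk hI
      by_cases hb : b.Holds σ
      · obtain ⟨hkn, s₁, c₁, hx₁, hc₁, hI₁⟩ := hs k σ hI hb
        obtain ⟨s₂, c₂, hx₂, hc₂, hI₂⟩ := ih (k + 1) s₁ (by omega) hI₁
        refine ⟨s₂, _, .whileTrue _ _ _ _ _ _ _ hb hx₁ hx₂, ?_, hI₂⟩
        rw [add_mul]; omega
      · exact ⟨σ, 1, .whileFalse _ _ _ hb, by omega, k, hI, hb⟩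
  obtain ⟨s', c, hx, hc, hI⟩ := key n 0 s (by omega) h0
  refine ⟨s', c, hx, hc.trans ?_, hI⟩
  have h1 := Nat.one_le_pow e X (by omega)
  have h2 : n * (X ^ e + 1) ≤ X * (X ^ e + 1) := Nat.mul_le_mul_right _ hn
  have h3 : X * (X ^ e + 1) ≤ 2 * (X * X ^ e) := by nlinarith
  have h4 : X ^ (e + 2) = X * (X * X ^ e) := by ring
  have h5 : 4 ≤ X * X ^ e := by nlinarith
  rw [h4]
  nlinarith

/-- The body leaves the counter array alone, so by the frame the counter equals the iteration index.
`hI` is needed because the counter is incremented after the body has restored the invariant. `h0`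
supplies equality of memory outside the counter, which the frame of the whole loop would forget. -/
theorem forN {c : ℕ} {B : NExpr} {n : ℕ} (hX : 4 ≤ X) (hO : O.Ok) (hn : n ≤ X)
    (hc : ¬ p.modN c) (I : ℕ → RamState → Prop)
    (h0 : ∀ σ, Frame (.forN c B p) s σ → σ.R = s.R → (∀ b, b ≠ c → σ.N b = s.N b) → I 0 σ)
    (hB : ∀ k σ, Frame (.forN c B p) s σ → I k σ → B.eval σ = n)
    (hs : ∀ k σ, k < n → Frame (.forN c B p) s σ → σ.N c 0 0 = k → I k σ →
      Runs O X e p σ (I (k + 1)))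
    (hI : ∀ k σ x, I k σ → I k (σ.writeN c 0 0 x))
    (hQ : ∀ σ, Frame (.forN c B p) s σ → I n σ → Q σ) :
    Runs O X (e + 4) (.forN c B p) s Q := by
  have hF : ∀ σ x, Frame (.forN c B p) s σ → Frame (.forN c B p) s (σ.writeN c 0 0 x) := by
    intro σ x h
    refine h.trans ⟨fun b hb => RamState.writeN_N_ne _ _ _ _ ?_, fun b _ => rfl⟩
    simp only [RamProg.forN, RamProg.modN, not_or] at hb
    exact hb.1
  refine Runs.seq (e := e + 3) hX hO
    (Q₁ := fun σ => Frame (.forN c B p) s σ ∧ σ.N c 0 0 = 0 ∧ I 0 σ)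
    (Runs.setN hX ⟨hF _ _ (Frame.refl _ _), by simp, ?_⟩) ?_
  · refine h0 _ (hF _ _ (Frame.refl _ _)) rfl fun b hb => RamState.writeN_N_ne _ _ _ _ hb
  · rintro σ₀ - ⟨hF₀, hc₀, hI₀⟩
    refine Runs.conseq hO (Runs.while_of (e := e + 1) (n := n) hX hn
      (fun k σ => Frame (.forN c B p) s σ ∧ σ.N c 0 0 = k ∧ k ≤ n ∧ I k σ)
      ⟨hF₀, hc₀, Nat.zero_le _, hI₀⟩ ?_) ?_
    · rintro k σ ⟨hFk, hck, hkn, hIk⟩ hb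
      have hBk := hB k σ hFk hIk
      simp only [RamTest.Holds, NExpr.eval, hck, hBk] at hb
      refine ⟨hb, Runs.seq hX hO (hs k σ hb hFk hck hIk) fun σ' hF' hI' => Runs.setN hX ?_⟩
      have hc' : σ'.N c 0 0 = k := by rw [hF'.1 c hc, hck]
      have hFs : Frame (.forN c B p) s σ' := hFk.trans (hF'.mono
        (fun b hb => by simp [hb]) (fun b hb => by simp [hb]))
      simp only [NExpr.eval]
      exact ⟨hF _ _ hFs, by simp [hc'], hb, hI _ _ _ hI'⟩
    · rintro σ - ⟨k, ⟨hFk, hck, hkn, hIk⟩, hb⟩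
      have hBk := hB k σ hFk hIk
      simp only [RamTest.Holds, NExpr.eval, hck, hBk] at hb
      obtain rfl : k = n := by omega
      exact hQ σ hFk hIk

end Runs

/-! ### Multiplicative weights for swap regret -/

/-- Multiplicative update of the weights `1 + V i j` of the expert `i` with step size `1 / k`,
where expert `i` is responsible for the fraction `p i` of the utilities `u`. -/
noncomputable def mwUpdate (k : ℕ) (V : ℕ → ℕ → ℝ) (p u : ℕ → ℝ) : ℕ → ℕ → ℝ := fun i j =>
  (1 + V i j) * (1 + p i * u j / k) - 1

/-- The stochastic matrix with rows proportional to the weights `1 + V i j`. -/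
noncomputable def mwTrans (N : ℕ) (V : ℕ → ℕ → ℝ) : ℕ → ℕ → ℝ := fun i j =>
  (1 + V i j) / ∑ l ∈ range N, (1 + V i l)

/-- The distribution after `t` steps of a Markov chain, starting from the uniform one. -/
noncomputable def powerIter (N : ℕ) (A : ℕ → ℕ → ℝ) : ℕ → ℕ → ℝ
  | 0 => fun _ => 1 / N
  | t + 1 => fun j => ∑ i ∈ range N, powerIter N A t i * A i j

/-- The average of the first `M` distributions of a Markov chain. -/
noncomputable def cesaro (N M : ℕ) (A : ℕ → ℕ → ℝ) : ℕ → ℝ := fun j =>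
  ∑ t ∈ range M, powerIter N A t j / M

/-- One round: update of the weights, followed by the computation of the next distribution. -/
noncomputable def mwStep (N M k : ℕ) (st : (ℕ → ℕ → ℝ) × (ℕ → ℝ)) (u : ℕ → ℝ) :
    (ℕ → ℕ → ℝ) × (ℕ → ℝ) :=
  (mwUpdate k st.1 st.2 u, cesaro N M (mwTrans N (mwUpdate k st.1 st.2 u)))

/-- The state after a list of rounds. -/
noncomputable def mwState (N M k : ℕ) (us : List (ℕ → ℝ)) : (ℕ → ℕ → ℝ) × (ℕ → ℝ) :=
  us.foldl (mwStep N M k) (0, 0)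

/-- Probability vectors with entries indexed by `range N`. -/
def IsProb (N : ℕ) (p : ℕ → ℝ) : Prop := (∀ i < N, 0 ≤ p i) ∧ ∑ i ∈ range N, p i = 1

theorem IsProb.le_one {N : ℕ} {p : ℕ → ℝ} (h : IsProb N p) {i : ℕ} (hi : i < N) : p i ≤ 1 := by
  rw [← h.2]
  exact single_le_sum (f := p) (fun j hj => h.1 j (mem_range.1 hj)) (mem_range.2 hi)

theorem IsProb.abs_sum_mul_le {N : ℕ} {p u : ℕ → ℝ} (h : IsProb N p) (hu : ∀ i < N, |u i| ≤ 1) :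
    |∑ i ∈ range N, p i * u i| ≤ 1 := by
  refine (abs_sum_le_sum_abs _ _).trans ?_
  rw [← h.2]
  refine sum_le_sum fun i hi => ?_
  rw [abs_mul, abs_of_nonneg (h.1 i (mem_range.1 hi))]
  exact mul_le_of_le_one_right (h.1 i (mem_range.1 hi)) (hu i (mem_range.1 hi))

theorem isProb_powerIter {N : ℕ} (hN : 1 ≤ N) {A : ℕ → ℕ → ℝ} (hA : ∀ i < N, IsProb N (A i))
    (t : ℕ) : IsProb N (powerIter N A t) := by
  induction t with
  | zero =>
    refine ⟨fun i _ => by simp [powerIter], ?_⟩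
    have : (N : ℝ) ≠ 0 := by positivity
    simp [powerIter, this]
  | succ t ih =>
    refine ⟨fun j hj => sum_nonneg fun i hi => mul_nonneg (ih.1 i (mem_range.1 hi))
      ((hA i (mem_range.1 hi)).1 j hj), ?_⟩
    simp only [powerIter]
    rw [sum_comm, ← ih.2]
    refine sum_congr rfl fun i hi => ?_
    rw [← mul_sum, (hA i (mem_range.1 hi)).2, mul_one]

theorem isProb_cesaro {N M : ℕ} (hN : 1 ≤ N) (hM : 1 ≤ M) {A : ℕ → ℕ → ℝ}
    (hA : ∀ i < N, IsProb N (A i)) : IsProb N (cesaro N M A) := by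
  refine ⟨fun j hj => sum_nonneg fun t _ => div_nonneg ((isProb_powerIter hN hA t).1 j hj)
    (Nat.cast_nonneg _), ?_⟩
  have hM' : (M : ℝ) ≠ 0 := by positivity
  simp only [cesaro]
  rw [sum_comm]
  simp_rw [← sum_div, (isProb_powerIter hN hA _).2]
  simp [hM']

/-- A step of the chain shifts the averaged sequence by one, so the difference telescopes and only
the last and the first distribution survive. -/
theorem sum_cesaro_mul {N M : ℕ} (A : ℕ → ℕ → ℝ) (j : ℕ) :
    ∑ i ∈ range N, cesaro N M A i * A i j =
      cesaro N M A j + (powerIter N A M j - powerIter N A 0 j) / M := by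
  have h : ∑ i ∈ range N, cesaro N M A i * A i j = ∑ t ∈ range M, powerIter N A (t + 1) j / M := by
    simp only [cesaro, sum_mul]
    rw [sum_comm]
    refine sum_congr rfl fun t _ => ?_
    simp only [powerIter, sum_div]
    exact sum_congr rfl fun i _ => by ring
  rw [h, cesaro, sub_div, ← sum_range_sub (fun t => powerIter N A t j / (M : ℝ)), ← sum_add_distrib]
  exact sum_congr rfl fun t _ => by ring

/-- The average of a Markov chain over `M` steps is stationary up to an error of `2 / M`. -/
theorem cesaro_almost_stationary {N M : ℕ} (hN : 1 ≤ N) {A : ℕ → ℕ → ℝ}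
    (hA : ∀ i < N, IsProb N (A i)) {u : ℕ → ℝ} (hu : ∀ i < N, |u i| ≤ 1) :
    ∑ i ∈ range N, cesaro N M A i * ∑ j ∈ range N, A i j * u j ≤
      ∑ i ∈ range N, cesaro N M A i * u i + 2 / M := by
  have h1 : ∑ i ∈ range N, cesaro N M A i * ∑ j ∈ range N, A i j * u j =
      ∑ j ∈ range N, (∑ i ∈ range N, cesaro N M A i * A i j) * u j := by
    simp_rw [mul_sum, sum_mul]
    rw [sum_comm]
    exact sum_congr rfl fun j _ => sum_congr rfl fun i _ => by ring
  have h2 := abs_le.1 ((isProb_powerIter hN hA M).abs_sum_mul_le hu)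
  have h3 := abs_le.1 ((isProb_powerIter hN hA 0).abs_sum_mul_le hu)
  have h4 : ∑ j ∈ range N, (powerIter N A M j - powerIter N A 0 j) / M * u j =
      (∑ j ∈ range N, powerIter N A M j * u j - ∑ j ∈ range N, powerIter N A 0 j * u j) / M := by
    rw [← sum_sub_distrib, sum_div]
    exact sum_congr rfl fun j _ => by ring
  rw [h1]
  simp_rw [sum_cesaro_mul, add_mul]
  rw [sum_add_distrib, h4]
  gcongr
  linarith [h2.2, h3.1]

/-- From `log y ≥ 1 - 1 / y` at `y = 1 + x`, the claim reduces to `0 ≤ x² * (1 + 2 * x)`, which is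
where `x ≥ -1/2` enters. -/
theorem sub_two_mul_sq_le_log {x : ℝ} (hx : |x| ≤ 1 / 2) :
    x - 2 * x ^ 2 ≤ Real.log (1 + x) := by
  have h := abs_le.1 hx
  have hpos : 0 < 1 + x := by linarith [h.1]
  refine le_trans ?_ (Real.one_sub_inv_le_log_of_pos hpos)
  have : 1 - (1 + x)⁻¹ = x / (1 + x) := by field_simp; ring
  rw [this, le_div_iff₀ hpos]
  nlinarith [mul_nonneg (sq_nonneg x) (by linarith [h.1] : (0 : ℝ) ≤ 1 + 2 * x)]

theorem abs_mw_exponent_le {k : ℕ} (hk : 2 ≤ k) {p u : ℝ} (hp : 0 ≤ p) (hp1 : p ≤ 1)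
    (hu : |u| ≤ 1) : |p * u / k| ≤ 1 / 2 := by
  have hk' : (2 : ℝ) ≤ k := by exact_mod_cast hk
  rw [abs_div, abs_mul, abs_of_nonneg hp, Nat.abs_cast, div_le_div_iff₀ (by positivity) (by norm_num)]
  nlinarith [abs_nonneg u, mul_le_mul hp1 hu (abs_nonneg u) zero_le_one]

/-! ### Regret of one expert by the potential method -/

section regret

variable {N k : ℕ} {V : ℕ → ℕ → ℕ → ℝ} {p u : ℕ → ℕ → ℝ}

theorem mw_weight_pos (hk : 2 ≤ k) (hV0 : V 0 = 0)
    (hV : ∀ t, V (t + 1) = mwUpdate k (V t) (p t) (u t))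
    (hp : ∀ t, ∀ i < N, 0 ≤ p t i ∧ p t i ≤ 1) (hu : ∀ t, ∀ j < N, |u t j| ≤ 1) (t : ℕ) :
    ∀ i < N, ∀ j < N, 0 < 1 + V t i j := by
  induction t with
  | zero => intro i _ j _; simp [hV0]
  | succ t ih =>
    intro i hi j hj
    rw [hV, mwUpdate]
    have := abs_le.1 (abs_mw_exponent_le hk (hp t i hi).1 (hp t i hi).2 (hu t j hj))
    have h2 : 0 < (1 + V t i j) * (1 + p t i * u t j / k) :=
      mul_pos (ih i hi j hj) (by linarith [this.1])
    linarith

theorem isProb_mwTrans {W : ℕ → ℕ → ℝ} (hW : ∀ i < N, ∀ j < N, 0 < 1 + W i j) (hN : 1 ≤ N) :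
    ∀ i < N, IsProb N (mwTrans N W i) := by
  intro i hi
  have hpos : 0 < ∑ l ∈ range N, (1 + W i l) :=
    sum_pos (fun j hj => hW i hi j (mem_range.1 hj)) ⟨0, mem_range.2 hN⟩
  refine ⟨fun j hj => div_nonneg (hW i hi j hj).le hpos.le, ?_⟩
  simp only [mwTrans]
  rw [← sum_div, div_self hpos.ne']

/-- The regret of a single expert of the multiplicative weights method. -/
theorem mw_expert_regret (hk : 2 ≤ k) (hN : 1 ≤ N) (hV0 : V 0 = 0)
    (hV : ∀ t, V (t + 1) = mwUpdate k (V t) (p t) (u t))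
    (hp : ∀ t, ∀ i < N, 0 ≤ p t i ∧ p t i ≤ 1) (hu : ∀ t, ∀ j < N, |u t j| ≤ 1) (T : ℕ)
    {i j : ℕ} (hi : i < N) (hj : j < N) :
    ∑ t ∈ range T, p t i * u t j ≤
      ∑ t ∈ range T, p t i * ∑ l ∈ range N, mwTrans N (V t) i l * u t l +
        k * Real.log N + 2 / k * ∑ t ∈ range T, p t i := by
  have hpos := mw_weight_pos hk hV0 hV hp hu
  have hk' : (0 : ℝ) < k := by positivity
  have hZ : ∀ t, 0 < ∑ l ∈ range N, (1 + V t i l) := fun t =>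
    sum_pos (fun l hl => hpos t i hi l (mem_range.1 hl)) ⟨0, mem_range.2 hN⟩
  -- Potential argument: the total weight grows by the factor `1 + p * g / k`, where `g` is the
  -- utility of the expert's own mixture, and `log (1 + x) ≤ x`.
  have upper : ∀ T, Real.log (∑ l ∈ range N, (1 + V T i l)) ≤ Real.log N +
      (∑ t ∈ range T, p t i * ∑ l ∈ range N, mwTrans N (V t) i l * u t l) / k := by
    intro T
    induction T with
    | zero => simp [hV0]
    | succ T ih =>
      set g := ∑ l ∈ range N, mwTrans N (V T) i l * u T l with hg
      have hstep : ∑ l ∈ range N, (1 + V (T + 1) i l) =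
          (∑ l ∈ range N, (1 + V T i l)) * (1 + p T i * g / k) := by
        have h1 : (∑ l ∈ range N, (1 + V T i l)) * g = ∑ l ∈ range N, (1 + V T i l) * u T l := by
          rw [hg, mul_sum]
          refine sum_congr rfl fun l _ => ?_
          rw [mwTrans]; field_simp [(hZ T).ne']
        have h2 : (∑ l ∈ range N, (1 + V T i l)) * (1 + p T i * g / k) =
            ∑ l ∈ range N, (1 + V T i l) +
              p T i / k * ((∑ l ∈ range N, (1 + V T i l)) * g) := by ring
        rw [h2, h1, mul_sum, ← sum_add_distrib]
        refine sum_congr rfl fun l _ => ?_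
        rw [hV, mwUpdate]; ring
      have hf : 0 < 1 + p T i * g / k := by
        have := hstep ▸ hZ (T + 1)
        exact (mul_pos_iff_of_pos_left (hZ T)).1 this
      rw [hstep, Real.log_mul (hZ T).ne' hf.ne', sum_range_succ, add_div]
      have := Real.log_le_sub_one_of_pos hf
      linarith
  -- The weight of the single action `j` bounds the total weight from below.
  have lower : ∀ T, (∑ t ∈ range T, p t i * u t j) / k -
      2 / k ^ 2 * ∑ t ∈ range T, p t i ≤ Real.log (1 + V T i j) := by
    intro T
    induction T with
    | zero => simp [hV0]
    | succ T ih =>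
      have hx := abs_mw_exponent_le hk (hp T i hi).1 (hp T i hi).2 (hu T j hj)
      have hf : 0 < 1 + p T i * u T j / k := by linarith [(abs_le.1 hx).1]
      have hstep : 1 + V (T + 1) i j = (1 + V T i j) * (1 + p T i * u T j / k) := by
        rw [hV, mwUpdate]; ring
      rw [hstep, Real.log_mul (hpos T i hi j hj).ne' hf.ne', sum_range_succ, sum_range_succ]
      have h1 := sub_two_mul_sq_le_log hx
      -- Keeping `p ≤ 1` to the first power, via `p² ≤ p`, matters: summed over the experts, the
      -- errors then cost `2 * T / k` rather than `N` times as much.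
      have h2 : (p T i * u T j / k) ^ 2 ≤ p T i / k ^ 2 := by
        rw [div_pow]
        gcongr
        have h3 : u T j ^ 2 ≤ 1 := by
          rw [← sq_abs]; exact pow_le_one₀ (abs_nonneg _) (hu T j hj)
        have := hp T i hi
        rw [mul_pow]
        nlinarith [mul_nonneg this.1 (sub_nonneg.2 this.2), sq_nonneg (p T i)]
      have h3 : 2 / (k : ℝ) ^ 2 * p T i = 2 * (p T i / k ^ 2) := by ring
      rw [add_div, mul_add, h3]
      linarith
  have hle : 1 + V T i j ≤ ∑ l ∈ range N, (1 + V T i l) :=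
    single_le_sum (f := fun l => 1 + V T i l) (fun l hl => (hpos T i hi l (mem_range.1 hl)).le)
      (mem_range.2 hj)
  have h := (lower T).trans ((Real.log_le_log (hpos T i hi j hj) hle).trans (upper T))
  have h' := mul_le_mul_of_nonneg_left h hk'.le
  have e1 : (k : ℝ) * ((∑ t ∈ range T, p t i * u t j) / k - 2 / k ^ 2 * ∑ t ∈ range T, p t i) =
      ∑ t ∈ range T, p t i * u t j - 2 / k * ∑ t ∈ range T, p t i := by
    field_simp
  rw [e1, mul_add, mul_div_cancel₀ _ hk'.ne'] at h'
  linarith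

end regret

/-! ### Swap regret of the combined method -/

/-- The state of the method before round `t`, when the utilities are `u 0, u 1, …`: the first
update is with zero utilities and changes nothing. -/
noncomputable def mwPlay (N M k : ℕ) (u : ℕ → ℕ → ℝ) (t : ℕ) : (ℕ → ℕ → ℝ) × (ℕ → ℝ) :=
  mwState N M k (0 :: (List.range t).map u)

theorem mwPlay_succ (N M k : ℕ) (u : ℕ → ℕ → ℝ) (t : ℕ) :
    mwPlay N M k u (t + 1) = mwStep N M k (mwPlay N M k u t) (u t) := by
  simp [mwPlay, mwState, List.range_succ, List.foldl_append]

/-- Storing weights as `1 + V` makes zeroed memory encode uniform weights, and a zero utility leaves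
them so. The first round therefore needs no special code. -/
theorem mwPlay_zero (N M k : ℕ) (u : ℕ → ℕ → ℝ) :
    mwPlay N M k u 0 = (0, cesaro N M (mwTrans N 0)) := by
  have : mwUpdate k 0 0 0 = 0 := by funext i j; simp [mwUpdate]
  simp [mwPlay, mwState, mwStep, this]

theorem mwPlay_snd (N M k : ℕ) (u : ℕ → ℕ → ℝ) (t : ℕ) :
    (mwPlay N M k u t).2 = cesaro N M (mwTrans N (mwPlay N M k u t).1) := by
  cases t with
  | zero => rw [mwPlay_zero]
  | succ t => rw [mwPlay_succ]; rfl

theorem mwPlay_weight_pos {N M k : ℕ} (hN : 1 ≤ N) (hM : 1 ≤ M) (hk : 2 ≤ k) {u : ℕ → ℕ → ℝ}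
    (hu : ∀ t, ∀ j < N, |u t j| ≤ 1) (t : ℕ) :
    ∀ i < N, ∀ j < N, 0 < 1 + (mwPlay N M k u t).1 i j := by
  induction t with
  | zero => intro i _ j _; simp [mwPlay_zero]
  | succ t ih =>
    intro i hi j hj
    have hp := isProb_cesaro hN hM (isProb_mwTrans ih hN)
    rw [← mwPlay_snd] at hp
    rw [mwPlay_succ]
    simp only [mwStep, mwUpdate]
    have := abs_le.1 (abs_mw_exponent_le hk (hp.1 i hi) (hp.le_one hi) (hu t j hj))
    have h2 := mul_pos (ih i hi j hj) (by linarith [this.1] :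
      0 < 1 + (mwPlay N M k u t).2 i * u t j / k)
    linarith

theorem isProb_mwPlay {N M k : ℕ} (hN : 1 ≤ N) (hM : 1 ≤ M) (hk : 2 ≤ k) {u : ℕ → ℕ → ℝ}
    (hu : ∀ t, ∀ j < N, |u t j| ≤ 1) (t : ℕ) : IsProb N (mwPlay N M k u t).2 := by
  rw [mwPlay_snd]
  exact isProb_cesaro hN hM (isProb_mwTrans (mwPlay_weight_pos hN hM hk hu t) hN)

/-- The swap regret of the method. -/
theorem mwPlay_swap_regret {N M k : ℕ} (hN : 1 ≤ N) (hM : 1 ≤ M) (hk : 2 ≤ k) {u : ℕ → ℕ → ℝ}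
    (hu : ∀ t, ∀ j < N, |u t j| ≤ 1) (T : ℕ) {f : ℕ → ℕ} (hf : ∀ i < N, f i < N) :
    ∑ i ∈ range N, ∑ t ∈ range T, (mwPlay N M k u t).2 i * (u t (f i) - u t i) ≤
      N * (k * Real.log N) + 2 / k * T + 2 / M * T := by
  have hprob := isProb_mwPlay hN hM hk hu
  have h1 : ∀ i ∈ range N, ∑ t ∈ range T, (mwPlay N M k u t).2 i * u t (f i) ≤
      ∑ t ∈ range T, (mwPlay N M k u t).2 i *
        ∑ l ∈ range N, mwTrans N (mwPlay N M k u t).1 i l * u t l +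
        k * Real.log N + 2 / k * ∑ t ∈ range T, (mwPlay N M k u t).2 i := by
    intro i hi
    refine mw_expert_regret (V := fun t => (mwPlay N M k u t).1)
      (p := fun t => (mwPlay N M k u t).2) hk hN ?_ ?_ ?_ hu T (mem_range.1 hi)
      (hf i (mem_range.1 hi))
    · simp [mwPlay_zero]
    · intro t; simp [mwPlay_succ, mwStep]
    · exact fun t i hi => ⟨(hprob t).1 i hi, (hprob t).le_one hi⟩
  have h2 := sum_le_sum h1
  -- Near-stationarity turns the experts' mixtures, averaged with `p`, back into the utility of `p`
  -- itself.
  have h3 : ∀ t ∈ range T, ∑ i ∈ range N, (mwPlay N M k u t).2 i *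
        ∑ l ∈ range N, mwTrans N (mwPlay N M k u t).1 i l * u t l ≤
      ∑ i ∈ range N, (mwPlay N M k u t).2 i * u t i + 2 / M := by
    intro t _
    rw [mwPlay_snd]
    exact cesaro_almost_stationary hN
      (isProb_mwTrans (mwPlay_weight_pos hN hM hk hu t) hN) (hu t)
  have h4 := sum_le_sum h3
  have h5 : ∑ i ∈ range N, ∑ t ∈ range T, (mwPlay N M k u t).2 i = T := by
    rw [sum_comm]; simp [(hprob _).2]
  have h6 : ∑ i ∈ range N, ∑ t ∈ range T, (mwPlay N M k u t).2 i *
        ∑ l ∈ range N, mwTrans N (mwPlay N M k u t).1 i l * u t l =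
      ∑ t ∈ range T, ∑ i ∈ range N, (mwPlay N M k u t).2 i *
        ∑ l ∈ range N, mwTrans N (mwPlay N M k u t).1 i l * u t l := sum_comm
  rw [sum_add_distrib, sum_add_distrib, ← mul_sum (a := 2 / (k : ℝ)), h5, h6] at h2
  rw [sum_add_distrib] at h4
  simp only [sum_const, card_range, nsmul_eq_mul] at h2 h4
  simp_rw [mul_sub, sum_sub_distrib]
  rw [sum_comm (s := range N) (t := range T) (f := fun i t => (mwPlay N M k u t).2 i * u t i)]
  linarith

/-! ### Approximation of convex hulls by few points -/

/-- The volume of a shell, up to the volume of the unit ball, is at most its thickness times the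
size of its outer sphere. -/
theorem add_pow_sub_sub_pow_le {R h : ℝ} (hh : 0 ≤ h) (hR : h ≤ R) {d : ℕ} (hd : 1 ≤ d) :
    (R + h) ^ d - (R - h) ^ d ≤ 2 * d * h * (R + h) ^ (d - 1) := by
  obtain ⟨d, rfl⟩ : ∃ e, d = e + 1 := ⟨d - 1, by omega⟩
  simp only [Nat.add_sub_cancel]
  induction d with
  | zero => simp; linarith
  | succ d ih =>
    have ih := ih (by omega)
    have h1 : (R - h) ^ (d + 1) ≤ (R + h) ^ (d + 1) :=
      pow_le_pow_left₀ (by linarith) (by linarith) _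
    have h2 := mul_le_mul_of_nonneg_left ih (by linarith : 0 ≤ R + h)
    have h3 : (R + h) ^ (d + 1 + 1) - (R - h) ^ (d + 1 + 1) =
        (R + h) * ((R + h) ^ (d + 1) - (R - h) ^ (d + 1)) + 2 * h * (R - h) ^ (d + 1) := by ring
    have h4 : 2 * ((d + 1 + 1 : ℕ) : ℝ) * h * (R + h) ^ (d + 1) =
        (R + h) * (2 * ((d + 1 : ℕ) : ℝ) * h * (R + h) ^ d) + 2 * h * (R + h) ^ (d + 1) := by
      push_cast; ring
    rw [h3, h4]
    nlinarith [mul_le_mul_of_nonneg_left h1 (by linarith : 0 ≤ 2 * h)]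

open MeasureTheory Metric in
/-- A separated subset of a sphere of radius `2` has few points. -/
theorem card_le_of_separated {d : ℕ} (hd : 1 ≤ d) {η : ℝ} (hη : 0 < η) (hη1 : η ≤ 1)
    {F : Finset (EuclideanSpace ℝ (Fin d))} (hF : ∀ z ∈ F, ‖z‖ = 2)
    (hsep : ∀ z ∈ F, ∀ z' ∈ F, z ≠ z' → η < ‖z - z'‖) :
    (F.card : ℝ) ≤ 2 * d * (5 / η) ^ (d - 1) := by
  set μ : Measure (EuclideanSpace ℝ (Fin d)) := volume
  have hball : ∀ (x : EuclideanSpace ℝ (Fin d)) (r : ℝ), 0 < r →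
      μ (ball x r) = ENNReal.ofReal (r ^ d) * μ (ball 0 1) := by
    intro x r hr
    rw [Measure.addHaar_ball_of_pos μ x hr]; simp
  have h0 : μ (ball (0 : EuclideanSpace ℝ (Fin d)) 1) ≠ 0 := (measure_ball_pos μ _ one_pos).ne'
  have htop : μ (ball (0 : EuclideanSpace ℝ (Fin d)) 1) ≠ ⊤ := measure_ball_lt_top.ne
  have hdisj : Set.PairwiseDisjoint (F : Set (EuclideanSpace ℝ (Fin d)))
      (fun z => ball z (η / 2)) := by
    intro z hz z' hz' hne
    refine ball_disjoint_ball ?_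
    rw [dist_eq_norm]
    linarith [hsep z hz z' hz' hne]
  have hU := measure_biUnion_finset (μ := μ) hdisj (fun z _ => measurableSet_ball)
  -- The small balls also avoid a slightly smaller concentric ball, so they are packed into a shell
  -- of thickness `η`. This saves a factor `η` and yields exponent `d - 1` instead of `d`.
  have hUd : Disjoint (⋃ z ∈ F, ball z (η / 2))
      (ball (0 : EuclideanSpace ℝ (Fin d)) (2 - η / 2)) := by
    simp only [Set.disjoint_iUnion_left]
    intro z hz
    refine ball_disjoint_ball ?_
    rw [dist_zero_right, hF z hz]
    linarith
  have hsub : (⋃ z ∈ F, ball z (η / 2)) ∪ ball (0 : EuclideanSpace ℝ (Fin d)) (2 - η / 2) ⊆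
      ball 0 (2 + η / 2) := by
    refine Set.union_subset (Set.iUnion₂_subset fun z hz => ?_) (ball_subset_ball (by linarith))
    refine ball_subset_ball' ?_
    rw [dist_zero_right, hF z hz]
    linarith
  have hm := measure_mono (μ := μ) hsub
  rw [measure_union hUd measurableSet_ball, hU, sum_congr rfl fun z _ => hball z (η / 2) (by linarith),
    hball 0 (2 - η / 2) (by linarith), hball 0 (2 + η / 2) (by linarith), sum_const, nsmul_eq_mul, ← mul_assoc,
    ← add_mul] at hm
  have hm' := (ENNReal.mul_le_mul_iff_left h0 htop).1 hm
  have e1 : (F.card : ENNReal) = ENNReal.ofReal (F.card : ℝ) := by simp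
  rw [e1, ← ENNReal.ofReal_mul (by positivity), ← ENNReal.ofReal_add (by positivity)
    (pow_nonneg (by linarith) _), ENNReal.ofReal_le_ofReal_iff (by positivity)] at hm'
  have hkey := add_pow_sub_sub_pow_le (R := 2) (h := η / 2) (by linarith) (by linarith) hd
  obtain ⟨e, rfl⟩ : ∃ e, d = e + 1 := ⟨d - 1, by omega⟩
  simp only [Nat.add_sub_cancel] at hkey ⊢
  have h5 : (2 + η / 2) ^ e ≤ (5 / 2) ^ e := pow_le_pow_left₀ (by linarith) (by linarith) _
  have h6 : (F.card : ℝ) * (η / 2) ^ (e + 1) ≤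
      2 * ((e + 1 : ℕ) : ℝ) * (η / 2) * (5 / 2) ^ e :=
    calc _ ≤ 2 * ((e + 1 : ℕ) : ℝ) * (η / 2) * (2 + η / 2) ^ e := by linarith
      _ ≤ _ := by gcongr
  have h7 : 2 * ((e + 1 : ℕ) : ℝ) * (5 / η) ^ e * (η / 2) ^ (e + 1) =
      2 * ((e + 1 : ℕ) : ℝ) * (η / 2) * (5 / 2) ^ e := by
    have : (5 / η) * (η / 2) = 5 / 2 := by field_simp
    rw [← this, mul_pow, pow_succ]; ring
  rw [← h7] at h6
  exact le_of_mul_le_mul_right h6 (by positivity)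

/-- A separated set of the largest possible cardinality is a net: a point far from all its members
could be added. The volume bound guarantees that a largest cardinality exists. -/
theorem exists_sphere_net {d : ℕ} (hd : 1 ≤ d) {η : ℝ} (hη : 0 < η) (hη1 : η ≤ 1) :
    ∃ F : Finset (EuclideanSpace ℝ (Fin d)), (F.card : ℝ) ≤ 2 * d * (5 / η) ^ (d - 1) ∧
      ∀ z : EuclideanSpace ℝ (Fin d), ‖z‖ = 2 → ∃ z' ∈ F, ‖z - z'‖ ≤ η := by
  classical
  let P : ℕ → Prop := fun n => ∃ F : Finset (EuclideanSpace ℝ (Fin d)), F.card = n ∧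
    (∀ z ∈ F, ‖z‖ = 2) ∧ ∀ z ∈ F, ∀ z' ∈ F, z ≠ z' → η < ‖z - z'‖
  have hbd : ∀ n, P n → n ≤ ⌊2 * d * (5 / η) ^ (d - 1)⌋₊ := by
    rintro n ⟨F, rfl, h1, h2⟩
    exact Nat.le_floor (card_le_of_separated hd hη hη1 h1 h2)
  have hP0 : P 0 := ⟨∅, by simp⟩
  obtain ⟨F, hc, h1, h2⟩ := Nat.findGreatest_spec (hbd 0 hP0) hP0
  refine ⟨F, card_le_of_separated hd hη hη1 h1 h2, fun z hz => ?_⟩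
  by_contra! hcon
  have hzF : z ∉ F := fun h => by have := hcon z h; simp at this; linarith
  have hP : P (F.card + 1) := by
    refine ⟨insert z F, card_insert_of_notMem hzF, ?_, ?_⟩
    · simpa [hz] using h1
    · intro x hx x' hx' hne
      rw [mem_insert] at hx hx'
      rcases hx with rfl | hx <;> rcases hx' with rfl | hx'
      · exact absurd rfl hne
      · exact hcon _ hx'
      · rw [norm_sub_rev]; exact hcon _ hx
      · exact h2 _ hx _ hx' hne
  have := Nat.le_findGreatest (hbd _ hP) hP
  omega

/-- The points of `S` lie in the hull of `a` and support it in every direction up to `δ`. -/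
def IsHullNet {d n : ℕ} (a : Fin n → EuclideanSpace ℝ (Fin d)) (δ : ℝ)
    (S : List (EuclideanSpace ℝ (Fin d))) : Prop :=
  (∀ x ∈ S, x ∈ convexHull ℝ (Set.range a)) ∧
  ∀ x ∈ convexHull ℝ (Set.range a), ∀ y, ∃ z ∈ S, inner ℝ x y ≤ inner ℝ z y + δ * ‖y‖

theorem norm_le_one_of_mem_hull {d n : ℕ} {a : Fin n → EuclideanSpace ℝ (Fin d)}
    (ha : ∀ i, ‖a i‖ ≤ 1) {x : EuclideanSpace ℝ (Fin d)}
    (hx : x ∈ convexHull ℝ (Set.range a)) : ‖x‖ ≤ 1 := by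
  have : convexHull ℝ (Set.range a) ⊆ Metric.closedBall 0 1 := by
    refine convexHull_min ?_ (convex_closedBall _ _)
    rintro _ ⟨i, rfl⟩
    simpa using ha i
  simpa using this hx

/-- Nearest points of a net of a larger sphere approximate a convex body in the unit ball. -/
theorem exists_isHullNet {d n : ℕ} (hd : 1 ≤ d) (hn : 1 ≤ n)
    {a : Fin n → EuclideanSpace ℝ (Fin d)} (ha : ∀ i, ‖a i‖ ≤ 1) {η : ℝ} (hη : 0 < η)
    (hη1 : η ≤ 1) :
    ∃ S : List (EuclideanSpace ℝ (Fin d)), (S.length : ℝ) ≤ 2 * d * (5 / η) ^ (d - 1) ∧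
      IsHullNet a (η ^ 2 / 4) S := by
  obtain ⟨F, hFc, hF⟩ := exists_sphere_net hd hη hη1
  set K := convexHull ℝ (Set.range a) with hK
  have hKconv : Convex ℝ K := convex_convexHull _ _
  have hKne : K.Nonempty := ⟨a ⟨0, hn⟩, subset_convexHull _ _ ⟨_, rfl⟩⟩
  have hKc : IsCompact K := (Set.finite_range a).isCompact_convexHull (𝕜 := ℝ)
  have hproj : ∀ z : EuclideanSpace ℝ (Fin d), ∃ x ∈ K, ∀ x' ∈ K, inner ℝ (z - x) (x' - x) ≤ 0 := by
    intro z
    obtain ⟨x, hx, hxz⟩ := exists_norm_eq_iInf_of_complete_convex hKne hKc.isComplete hKconv z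
    exact ⟨x, hx, (norm_eq_iInf_iff_real_inner_le_zero hKconv hx).1 hxz⟩
  choose pr hprK hpr using hproj
  refine ⟨F.toList.map pr, by simpa using hFc, ?_, ?_⟩
  · intro x hx
    obtain ⟨z, -, rfl⟩ := List.mem_map.1 hx
    exact hprK z
  · intro x hx y
    have hx1 : ‖x‖ ≤ 1 := norm_le_one_of_mem_hull ha hx
    by_cases hy : y = 0
    · obtain ⟨e, he⟩ : ∃ e : EuclideanSpace ℝ (Fin d), ‖e‖ = 2 :=
        ⟨EuclideanSpace.single ⟨0, hd⟩ 2, by simp⟩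
      obtain ⟨z', hz', -⟩ := hF e he
      exact ⟨pr z', List.mem_map.2 ⟨z', by simpa using hz', rfl⟩, by simp [hy]⟩
    have hypos : 0 < ‖y‖ := norm_pos_iff.2 hy
    set e := ‖y‖⁻¹ • y with he
    have he1 : ‖e‖ = 1 := by rw [he, norm_smul]; simp [hypos.ne']
    have hye : y = ‖y‖ • e := by rw [he, smul_smul, mul_inv_cancel₀ hypos.ne', one_smul]
    -- Follow the ray from `x` in direction `e` until it meets the sphere of radius 2; as `‖x‖ ≤ 1`,
    -- this happens at some `r` between 1 and 3.
    obtain ⟨r, hr, hr2⟩ : ∃ r ∈ Set.Icc (0 : ℝ) 3, ‖x + r • e‖ = 2 := by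
      have hcont : ContinuousOn (fun r : ℝ => ‖x + r • e‖) (Set.Icc 0 3) := by fun_prop
      refine intermediate_value_Icc (by norm_num) hcont ⟨by simp; linarith, ?_⟩
      have : ‖(3 : ℝ) • e‖ ≤ ‖x + (3 : ℝ) • e‖ + ‖x‖ := by
        have := norm_sub_le (x + (3 : ℝ) • e) x
        simpa using this
      rw [norm_smul, he1] at this
      norm_num at this
      linarith
    have hr1 : 1 ≤ r := by
      have := norm_add_le x (r • e)
      rw [norm_smul, he1, hr2, Real.norm_of_nonneg hr.1] at this
      linarith
    obtain ⟨z', hz', hzz'⟩ := hF _ hr2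
    refine ⟨pr z', List.mem_map.2 ⟨z', by simpa using hz', rfl⟩, ?_⟩
    have h1 := hpr z' x hx
    set p := pr z' with hp
    -- The middle term is nonpositive because `p` is the projection of `z'`. With `q = ‖x - p‖` what
    -- remains is at most `η * q - q²`, hence at most `η² / 4`: this negative square makes the error
    -- quadratic.
    have h2 : r * inner ℝ e (x - p) = inner ℝ (x + r • e - z') (x - p) +
        inner ℝ (z' - p) (x - p) - ‖x - p‖ ^ 2 := by
      rw [← real_inner_self_eq_norm_sq, ← inner_add_left, ← inner_sub_left, ← real_inner_smul_left]
      congr 1; abel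
    have h3 := real_inner_le_norm (x + r • e - z') (x - p)
    have h4 : inner ℝ e (x - p) ≤ η ^ 2 / 4 := by
      by_cases hneg : inner ℝ e (x - p) ≤ 0
      · exact hneg.trans (by positivity)
      · have h5 : inner ℝ e (x - p) ≤ r * inner ℝ e (x - p) :=
          le_mul_of_one_le_left (not_le.1 hneg).le hr1
        have h6 : ‖x + r • e - z'‖ * ‖x - p‖ ≤ η * ‖x - p‖ := by gcongr
        nlinarith [sq_nonneg (‖x - p‖ - η / 2)]
    have h7 : inner ℝ x y - inner ℝ p y = ‖y‖ * inner ℝ e (x - p) := by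
      rw [← inner_sub_left, ← real_inner_smul_left, ← hye, real_inner_comm]
    have h8 := mul_le_mul_of_nonneg_left h4 hypos.le
    linarith

/-! ### Loops that fill arrays -/

namespace RamProg

/-- Fill the first `B` entries of row `i` of the array `A`. -/
def fillRow (c : ℕ) (B : NExpr) (A : ℕ) (i : NExpr) (e : RExpr) : RamProg :=
  forN c B (setR A i (nvar c) e)

/-- Add `B` values to an entry of the array `A`. -/
def sumInto (c : ℕ) (B : NExpr) (A : ℕ) (i j : NExpr) (e : RExpr) : RamProg :=
  forN c B (setR A i j (.add (.get A i j) e))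

/-- Fill row `0` of `A` with sums. -/
def sumRow (c c' : ℕ) (B B' : NExpr) (A : ℕ) (e : RExpr) : RamProg :=
  forN c B (block [setR A (.const 0) (nvar c) (.cast (.const 0)),
    sumInto c' B' A (.const 0) (nvar c) e])

attribute [simp] fillRow sumInto sumRow

end RamProg

namespace Runs

variable {O : OracleEnv} {X : ℕ} {s : RamState} {Q : RamState → Prop}

/-- When entry `j` is computed it still has its old value, so `e` may read it; this permits updates
in place. -/
theorem fillRow (hX : 4 ≤ X) (hO : O.Ok) {c A n r : ℕ} {B i : NExpr} {e : RExpr} (f : ℕ → ℝ)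
    (hn : n ≤ X) (hB : ∀ σ : RamState, (∀ b, b ≠ c → σ.N b = s.N b) → B.eval σ = n)
    (hi : ∀ σ : RamState, (∀ b, b ≠ c → σ.N b = s.N b) → ∀ j < n, σ.N c 0 0 = j → i.eval σ = r)
    (he : ∀ j < n, ∀ σ : RamState, (∀ b, b ≠ c → σ.N b = s.N b) → σ.N c 0 0 = j →
      (∀ b, b ≠ A → σ.R b = s.R b) → σ.R A r j = s.R A r j → e.eval σ = f j)
    (hQ : ∀ σ : RamState, (∀ b, b ≠ c → σ.N b = s.N b) → (∀ b, b ≠ A → σ.R b = s.R b) →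
      (∀ r' j', σ.R A r' j' = if r' = r ∧ j' < n then f j' else s.R A r' j') → Q σ) :
    Runs O X 4 (.fillRow c B A i e) s Q := by
  refine Runs.forN (e := 0) hX hO hn (by simp) (fun k σ => ∀ r' j', σ.R A r' j' =
    if r' = r ∧ j' < k then f j' else s.R A r' j') ?_ ?_ ?_ ?_ ?_
  · intro σ _ hR _ r' j'; simp [hR]
  · intro k σ hF _
    exact hB σ fun b hb => hF.1 b (by simp [hb])
  · intro k σ hk hF hc hI
    refine Runs.setR hX ?_
    have hN : ∀ b, b ≠ c → σ.N b = s.N b := fun b hb => hF.1 b (by simp [hb])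
    rw [hi σ hN k hk hc, he k hk σ hN hc (fun b hb => hF.2 b (by simp [hb])) (by simp [hI])]
    intro r' j'
    simp only [RamState.writeR_R_self, NExpr.eval, hc, hI]
    by_cases h1 : r' = r ∧ j' = k
    · simp [h1]
    · rw [if_neg h1]
      refine if_congr ?_ rfl rfl
      rw [Nat.lt_succ_iff_lt_or_eq, and_or_left, or_iff_left h1]
  · intro k σ x h; exact h
  · intro σ hF hI
    exact hQ σ (fun b hb => hF.1 b (by simp [hb])) (fun b hb => hF.2 b (by simp [hb])) hI

theorem sumInto (hX : 4 ≤ X) (hO : O.Ok) {c A n r q : ℕ} {B i j : NExpr} {e : RExpr} (f : ℕ → ℝ)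
    (hn : n ≤ X) (hB : ∀ σ : RamState, (∀ b, b ≠ c → σ.N b = s.N b) → B.eval σ = n)
    (hi : ∀ σ : RamState, (∀ b, b ≠ c → σ.N b = s.N b) → i.eval σ = r)
    (hj : ∀ σ : RamState, (∀ b, b ≠ c → σ.N b = s.N b) → j.eval σ = q)
    (he : ∀ l < n, ∀ σ : RamState, (∀ b, b ≠ c → σ.N b = s.N b) → σ.N c 0 0 = l →
      (∀ b, b ≠ A → σ.R b = s.R b) → e.eval σ = f l)
    (hQ : ∀ σ : RamState, (∀ b, b ≠ c → σ.N b = s.N b) → (∀ b, b ≠ A → σ.R b = s.R b) →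
      (∀ r' j', σ.R A r' j' =
        if r' = r ∧ j' = q then s.R A r q + ∑ l ∈ range n, f l else s.R A r' j') → Q σ) :
    Runs O X 4 (.sumInto c B A i j e) s Q := by
  refine Runs.forN (e := 0) hX hO hn (by simp) (fun k σ => ∀ r' j', σ.R A r' j' =
    if r' = r ∧ j' = q then s.R A r q + ∑ l ∈ range k, f l else s.R A r' j') ?_ ?_ ?_ ?_ ?_
  · intro σ _ hR _ r' j'
    by_cases h : r' = r ∧ j' = q
    · simp [hR, h]
    · simp [hR, h]
  · intro k σ hF _
    exact hB σ fun b hb => hF.1 b (by simp [hb])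
  · intro k σ hk hF hc hI
    refine Runs.setR hX ?_
    have hN : ∀ b, b ≠ c → σ.N b = s.N b := fun b hb => hF.1 b (by simp [hb])
    simp only [RExpr.eval]
    rw [hi σ hN, hj σ hN, he k hk σ hN hc (fun b hb => hF.2 b (by simp [hb]))]
    intro r' j'
    simp only [RamState.writeR_R_self, hI]
    by_cases h1 : r' = r ∧ j' = q
    · simp [h1, sum_range_succ, add_assoc]
    · simp [h1]
  · intro k σ x h; exact h
  · intro σ hF hI
    exact hQ σ (fun b hb => hF.1 b (by simp [hb])) (fun b hb => hF.2 b (by simp [hb])) hI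

theorem sumRow (hX : 4 ≤ X) (hO : O.Ok) {c c' A n m : ℕ} {B B' : NExpr} {e : RExpr}
    (f : ℕ → ℕ → ℝ) (hcc : c ≠ c') (hn : n ≤ X) (hm : m ≤ X)
    (hB : ∀ σ : RamState, (∀ b, b ≠ c → b ≠ c' → σ.N b = s.N b) → B.eval σ = n)
    (hB' : ∀ σ : RamState, (∀ b, b ≠ c → b ≠ c' → σ.N b = s.N b) → B'.eval σ = m)
    (he : ∀ i < n, ∀ l < m, ∀ σ : RamState, (∀ b, b ≠ c → b ≠ c' → σ.N b = s.N b) →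
      σ.N c 0 0 = i → σ.N c' 0 0 = l → (∀ b, b ≠ A → σ.R b = s.R b) → e.eval σ = f i l)
    (hQ : ∀ σ : RamState, (∀ b, b ≠ c → b ≠ c' → σ.N b = s.N b) →
      (∀ b, b ≠ A → σ.R b = s.R b) → (∀ i < n, σ.R A 0 i = ∑ l ∈ range m, f i l) → Q σ) :
    Runs O X 10 (.sumRow c c' B B' A e) s Q := by
  refine Runs.forN (e := 6) hX hO hn (by simp [hcc]) (fun k σ => ∀ i < k, σ.R A 0 i =
    ∑ l ∈ range m, f i l) ?_ ?_ ?_ ?_ ?_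
  · intro σ _ hR _ r' j'; omega
  · intro k σ hF _
    exact hB σ fun b hb hb' => hF.1 b (by simp [hb, hb'])
  · intro k σ hk hF hc hI
    have hN : ∀ b, b ≠ c → b ≠ c' → σ.N b = s.N b := fun b hb hb' => hF.1 b (by simp [hb, hb'])
    have hR : ∀ b, b ≠ A → σ.R b = s.R b := fun b hb => hF.2 b (by simp [hb])
    refine Runs.block_cons hX hO (Runs.setR (Q := fun σ' => σ'.N = σ.N ∧
      (∀ b, b ≠ A → σ'.R b = σ.R b) ∧ σ'.R A 0 k = 0 ∧ ∀ i < k, σ'.R A 0 i = σ.R A 0 i) hX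
      ⟨rfl, fun b hb => RamState.writeR_R_ne _ _ _ _ hb, by simp [hc], ?_⟩) ?_
    · intro i hi
      simp [hc, hi.ne]
    · rintro σ₁ - ⟨hN₁, hR₁, h0, hlt⟩
      refine Runs.block_cons (e := 4) hX hO (Runs.sumInto hX hO (r := 0) (q := k) (f k) hm ?_ ?_ ?_
        ?_ (Q := fun σ' => ∀ i < k + 1, σ'.R A 0 i = ∑ l ∈ range m, f i l) ?_) ?_
      · intro σ₂ h
        exact hB' σ₂ fun b hb hb' => by rw [h b hb', hN₁, hN b hb hb']
      · intro σ₂ h; rfl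
      · intro σ₂ h
        simp [h c hcc, hN₁, hc]
      · intro l hl σ₂ h hl' hR₂
        exact he k hk l hl σ₂ (fun b hb hb' => by rw [h b hb', hN₁, hN b hb hb'])
          (by rw [h c hcc, hN₁, hc]) hl' (fun b hb => by rw [hR₂ b hb, hR₁ b hb, hR b hb])
      · intro σ₂ _ _ h i hi
        rw [h]
        rcases Nat.lt_succ_iff_lt_or_eq.1 hi with hi | rfl
        · simp [hi.ne, hlt i hi, hI i hi]
        · simp [h0]
      · intro σ₂ _ h
        exact Runs.block_nil hX h
  · intro k σ x h; exact h
  · intro σ hF hI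
    exact hQ σ (fun b hb hb' => hF.1 b (by simp [hb, hb'])) (fun b hb => hF.2 b (by simp [hb])) hI

end Runs

/-! ### The program for one round of the swap regret method -/

/-- The reciprocal of the step size for `N` actions and horizon `T`. -/
noncomputable def stepK (N T : ℕ) : ℕ := sInf {k | 2 ≤ k ∧ T ≤ k * k * N}

theorem stepK_spec {N : ℕ} (hN : 1 ≤ N) (T : ℕ) : 2 ≤ stepK N T ∧ T ≤ stepK N T * stepK N T * N := by
  have : (T + 2) ∈ {k | 2 ≤ k ∧ T ≤ k * k * N} := ⟨by omega, by
    nlinarith [Nat.mul_le_mul_left ((T + 2) * (T + 2)) hN]⟩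
  exact Nat.sInf_mem ⟨_, this⟩

/-- This is the form in which an upward search delivers the step size: the present candidate passes
and all smaller ones failed. -/
theorem stepK_eq {N T k : ℕ} (hk : 2 ≤ k) (hT : T ≤ k * k * N)
    (hlt : ∀ k', 2 ≤ k' → k' < k → k' * k' * N < T) : stepK N T = k := by
  refine le_antisymm (Nat.sInf_le ⟨hk, hT⟩) (not_lt.1 fun h => ?_)
  have hm : stepK N T ∈ {k | 2 ≤ k ∧ T ≤ k * k * N} := Nat.sInf_mem ⟨k, hk, hT⟩
  exact absurd (hlt _ hm.1 h) (not_lt.2 hm.2)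

theorem stepK_lt {N T k : ℕ} (h : k < stepK N T) (hk : 2 ≤ k) : k * k * N < T := by
  by_contra hT
  exact absurd (Nat.sInf_le (⟨hk, not_lt.1 hT⟩ : k ∈ {k | 2 ≤ k ∧ T ≤ k * k * N})) (not_le.2 h)

/-- The arrays used by a player: number of points `n` (index array), points `S`, weights `V`,
distribution `p`, observation `y`, oracle `o`, and the sparse list that is the output. -/
structure PlayerLayout where
  n : ℕ
  S : ℕ
  V : ℕ
  p : ℕ
  y : ℕ
  o : ℕ
  len : ℕ
  act : ℕ
  wt : ℕ

/-- The arrays of a player are distinct and different from those used for temporary values. -/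
def PlayerLayout.Ok (ℓ : PlayerLayout) : Prop :=
  [ℓ.n, ℓ.len, ℓ.act, 3, 4, 10, 11, 12, 13, 14, 15].Nodup ∧
    [ℓ.S, ℓ.V, ℓ.p, ℓ.y, ℓ.wt, 3, 4, 5, 10, 11, 12, 13].Nodup

namespace RamProg

abbrev rone : RExpr := .cast (.const 1)

abbrev rrow (A : ℕ) (j : NExpr) : RExpr := .get A (.const 0) j

/-- Computation of the step size. -/
def stepProg (n : ℕ) : RamProg :=
  block [setN 15 (.const 0) (.const 0) (.const 2),
    .while (.realLT (.mul (.mul (.cast (nvar 15)) (.cast (nvar 15))) (.cast (nvar n)))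
      (.cast (nvar 11))) (setN 15 (.const 0) (.const 0) (.add (nvar 15) (.const 1)))]

/-- Utilities of the points for the present observation. -/
def utilProg (ℓ : PlayerLayout) : RamProg :=
  sumRow 12 13 (nvar ℓ.n) (nvar 10) 10
    (.mul (.get ℓ.S (nvar 12) (nvar 13)) (rrow ℓ.y (nvar 13)))

/-- Update of the weights. -/
def weightProg (ℓ : PlayerLayout) : RamProg :=
  forN 12 (nvar ℓ.n) (fillRow 13 (nvar ℓ.n) ℓ.V (nvar 12)
    (.sub (.mul (.add rone (.get ℓ.V (nvar 12) (nvar 13)))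
      (.add rone (.div (.mul (rrow ℓ.p (nvar 12)) (rrow 10 (nvar 13))) (.cast (nvar 15))))) rone))

/-- Row sums of the weights. -/
def rowSumProg (ℓ : PlayerLayout) : RamProg :=
  sumRow 12 13 (nvar ℓ.n) (nvar ℓ.n) 11 (.add rone (.get ℓ.V (nvar 12) (nvar 13)))

/-- One step of the Markov chain. -/
def chainProg (ℓ : PlayerLayout) : RamProg :=
  block [fillRow 12 (nvar ℓ.n) ℓ.p (.const 0)
      (.add (rrow ℓ.p (nvar 12)) (.div (rrow 12 (nvar 12)) (.cast (nvar 11)))),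
    sumRow 12 13 (nvar ℓ.n) (nvar ℓ.n) 13 (.mul (rrow 12 (nvar 13))
      (.div (.add rone (.get ℓ.V (nvar 13) (nvar 12))) (rrow 11 (nvar 13)))),
    fillRow 12 (nvar ℓ.n) 12 (.const 0) (rrow 13 (nvar 12))]

/-- Computation of the next distribution. -/
def cesaroProg (ℓ : PlayerLayout) : RamProg :=
  block [fillRow 12 (nvar ℓ.n) 12 (.const 0) (.div rone (.cast (nvar ℓ.n))),
    fillRow 12 (nvar ℓ.n) ℓ.p (.const 0) (.cast (.const 0)),
    forN 14 (nvar 11) (chainProg ℓ)]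

/-- Update of weights and distribution. -/
def mwProg (ℓ : PlayerLayout) : RamProg :=
  block [stepProg ℓ.n, utilProg ℓ, weightProg ℓ, rowSumProg ℓ, cesaroProg ℓ]

end RamProg

open RamProg in
theorem runs_stepProg {O : OracleEnv} {X : ℕ} (hX : 4 ≤ X) (hO : O.Ok) {s : RamState} {n N T : ℕ}
    (hn : n ≠ 15) (hN1 : 1 ≤ N) (hTX : T ≤ X) (hN : s.N n 0 0 = N) (hT : s.N 11 0 0 = T) :
    Runs O X 4 (stepProg n) s (fun σ => σ.N 15 0 0 = stepK N T) := by
  refine Runs.block_cons (e := 3) hX hO (Runs.setN hX (Q := fun σ => σ.N 15 0 0 = 2) (by simp)) ?_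
  intro σ hF h2
  have hNσ : σ.N n 0 0 = N := by rw [hF.1 n (by simpa using hn), hN]
  have hTσ : σ.N 11 0 0 = T := by rw [hF.1 11 (by simp), hT]
  refine Runs.block_cons (e := 2) hX hO (Runs.while_of (e := 0) hX hTX
    (fun j σ => σ.N 15 0 0 = 2 + j ∧ σ.N n 0 0 = N ∧ σ.N 11 0 0 = T ∧
      ∀ k, 2 ≤ k → k < 2 + j → k * k * N < T) ⟨h2, hNσ, hTσ, by omega⟩ ?_) ?_
  · rintro j σ' ⟨h15, hN', hT', hlt⟩ hb
    simp only [RamTest.Holds, RExpr.eval, NExpr.eval, h15, hN', hT'] at hb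
    have hb' : (2 + j) * (2 + j) * N < T := by exact_mod_cast hb
    -- As `N ≥ 1`, a true guard gives `(2 + j)² < T`, so there are fewer than `T` iterations.
    refine ⟨by nlinarith [Nat.mul_le_mul_left ((2 + j) * (2 + j)) hN1],
      Runs.setN hX ⟨by simp [h15, add_assoc], ?_, ?_, ?_⟩⟩
    · rw [RamState.writeN_N_ne _ _ _ _ hn, hN']
    · rw [RamState.writeN_N_ne _ _ _ _ (by norm_num), hT']
    · intro k hk hk'
      rcases Nat.lt_succ_iff_lt_or_eq.1 hk' with h | rfl
      · exact hlt k hk h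
      · exact hb'
  · rintro σ' - ⟨j, ⟨h15, hN', hT', hlt⟩, hb⟩
    refine Runs.block_nil hX ?_
    simp only [RamTest.Holds, RExpr.eval, NExpr.eval, h15, hN', hT'] at hb
    rw [h15, stepK_eq (by omega) _ hlt]
    have : ¬ ((2 + j) * (2 + j) * N < T) := by exact_mod_cast hb
    omega

open RamProg in
theorem runs_weightProg {O : OracleEnv} {X : ℕ} (hX : 4 ≤ X) (hO : O.Ok) {ℓ : PlayerLayout}
    (hℓ : ℓ.Ok) {s : RamState} {N k : ℕ} {V : ℕ → ℕ → ℝ} {p u : ℕ → ℝ} (hNX : N ≤ X)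
    (hN : s.N ℓ.n 0 0 = N) (hk : s.N 15 0 0 = k) (hV : ∀ i < N, ∀ j < N, s.R ℓ.V i j = V i j)
    (hp : ∀ i < N, s.R ℓ.p 0 i = p i) (hu : ∀ i < N, s.R 10 0 i = u i) :
    Runs O X 8 (weightProg ℓ) s
      (fun σ => ∀ i < N, ∀ j < N, σ.R ℓ.V i j = mwUpdate k V p u i j) := by
  have hd := hℓ
  simp only [PlayerLayout.Ok, List.nodup_cons, List.mem_cons, not_or] at hd
  refine Runs.forN hX hO hNX (by simp) (fun k' σ => ∀ i < N, ∀ j < N, σ.R ℓ.V i j =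
    if i < k' then mwUpdate k V p u i j else V i j) ?_ ?_ ?_ (fun _ _ _ h => h) ?_
  · intro σ hF hR _ i hi j hj
    simp [hR, hV i hi j hj]
  · intro k' σ hF _
    simp only [NExpr.eval]
    rw [hF.1 _ (by simp; grind only), hN]
  · intro k' σ hk' hF hc hI
    have hnσ : σ.N ℓ.n 0 0 = N := by rw [hF.1 _ (by simp; grind only), hN]
    refine Runs.fillRow hX hO (r := k') (fun j => mwUpdate k V p u k' j) hNX ?_ ?_ ?_ ?_
    · intro σ' h
      simp only [NExpr.eval]
      rw [h _ (by grind only), hnσ]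
    · intro σ' h j _ _
      simp only [NExpr.eval]
      rw [h _ (by grind only), hc]
    · intro j hj σ' h hj' hR hself
      have h12 : σ'.N 12 0 0 = k' := by rw [h _ (by grind only), hc]
      have h15 : σ'.N 15 0 0 = k := by rw [h _ (by grind only), hF.1 _ (by simp), hk]
      simp only [RExpr.eval, NExpr.eval, h12, hj', h15, hself]
      rw [hR _ (by grind only), hR _ (by grind only), hF.2 ℓ.p (by simp; grind only), hF.2 10 (by simp; grind only),
        hp k' hk', hu j hj, hI k' hk' j hj]
      simp [mwUpdate]
    · intro σ' h hR h' i hi j hj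
      rw [h']
      by_cases hik : i = k'
      · simp [hik, hj]
      · rw [if_neg (by omega), hI i hi j hj]
        exact if_congr (by omega) rfl rfl
  · intro σ _ h i hi j hj
    rw [h i hi j hj, if_pos hi]

open RamProg in
theorem runs_utilProg {O : OracleEnv} {X : ℕ} (hX : 4 ≤ X) (hO : O.Ok) {ℓ : PlayerLayout}
    (hℓ : ℓ.Ok) {s : RamState} {N d : ℕ} {S : ℕ → ℕ → ℝ} {y : ℕ → ℝ} (hNX : N ≤ X) (hdX : d ≤ X)
    (hN : s.N ℓ.n 0 0 = N) (hd : s.N 10 0 0 = d) (hS : ∀ i < N, ∀ j < d, s.R ℓ.S i j = S i j)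
    (hy : ∀ i < d, s.R ℓ.y 0 i = y i) :
    Runs O X 10 (utilProg ℓ) s (fun σ => ∀ i < N, σ.R 10 0 i = ∑ l ∈ range d, S i l * y l) := by
  have hd' := hℓ
  simp only [PlayerLayout.Ok, List.nodup_cons, List.mem_cons, not_or] at hd'
  refine Runs.sumRow hX hO (fun i l => S i l * y l) (by norm_num) hNX hdX ?_ ?_ ?_
    (fun σ _ _ h => h)
  · intro σ h
    simp only [NExpr.eval]
    rw [h _ (by grind only) (by grind only), hN]
  · intro σ h
    simp only [NExpr.eval]
    rw [h _ (by grind only) (by grind only), hd]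
  · intro i hi l hl σ h h12 h13 hR
    simp only [NExpr.eval, RExpr.eval, h12, h13]
    rw [hR _ (by grind only), hR _ (by grind only), hS i hi l hl, hy l hl]

open RamProg in
theorem runs_rowSumProg {O : OracleEnv} {X : ℕ} (hX : 4 ≤ X) (hO : O.Ok) {ℓ : PlayerLayout}
    (hℓ : ℓ.Ok) {s : RamState} {N : ℕ} {V : ℕ → ℕ → ℝ} (hNX : N ≤ X) (hN : s.N ℓ.n 0 0 = N)
    (hV : ∀ i < N, ∀ j < N, s.R ℓ.V i j = V i j) :
    Runs O X 10 (rowSumProg ℓ) s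
      (fun σ => ∀ i < N, σ.R 11 0 i = ∑ l ∈ range N, (1 + V i l)) := by
  have hd' := hℓ
  simp only [PlayerLayout.Ok, List.nodup_cons, List.mem_cons, not_or] at hd'
  have hB : ∀ σ : RamState, (∀ b, b ≠ 12 → b ≠ 13 → σ.N b = s.N b) → (nvar ℓ.n).eval σ = N := by
    intro σ h
    simp only [NExpr.eval]
    rw [h _ (by grind only) (by grind only), hN]
  refine Runs.sumRow hX hO (fun i l => 1 + V i l) (by norm_num) hNX hNX hB hB ?_
    (fun σ _ _ h => h)
  intro i hi l hl σ h h12 h13 hR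
  simp only [NExpr.eval, RExpr.eval, h12, h13]
  rw [hR _ (by grind only), hV i hi l hl]
  simp

open RamProg in
-- The present distribution is added to the average before it is advanced. The new one goes to a
-- separate array first, because each of its entries needs all old entries.
theorem runs_chainProg {O : OracleEnv} {X : ℕ} (hX : 4 ≤ X) (hO : O.Ok) {ℓ : PlayerLayout}
    (hℓ : ℓ.Ok) {s : RamState} {N T : ℕ} {V : ℕ → ℕ → ℝ} {p x : ℕ → ℝ} (hNX : N ≤ X)
    (hN : s.N ℓ.n 0 0 = N) (hT : s.N 11 0 0 = T) (hV : ∀ i < N, ∀ j < N, s.R ℓ.V i j = V i j)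
    (hp : ∀ i < N, s.R ℓ.p 0 i = p i) (hx : ∀ i < N, s.R 12 0 i = x i)
    (hZ : ∀ i < N, s.R 11 0 i = ∑ l ∈ range N, (1 + V i l)) :
    Runs O X 13 (chainProg ℓ) s (fun σ => (∀ i < N, σ.R ℓ.p 0 i = p i + x i / T) ∧
      ∀ i < N, σ.R 12 0 i = ∑ l ∈ range N, x l * mwTrans N V l i) := by
  have hd' := hℓ
  simp only [PlayerLayout.Ok, List.nodup_cons, List.mem_cons, not_or] at hd'
  refine Runs.block_cons (e := 12) hX hO (Runs.mono hX (Runs.fillRow hX hO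
    (Q := fun σ => ∀ i < N, σ.R ℓ.p 0 i = p i + x i / T) (fun i => p i + x i / T) (r := 0) hNX
    ?_ ?_ ?_ ?_) (by norm_num)) ?_
  · intro σ h
    simp only [NExpr.eval]
    rw [h _ (by grind only), hN]
  · intro σ _ j _ _; rfl
  · intro j hj σ h hj' hR hself
    simp only [NExpr.eval, RExpr.eval, hj', hself]
    rw [hR _ (by grind only), hp j hj, hx j hj, h _ (by grind only), hT]
  · intro σ _ _ h i hi
    rw [h]; simp [hi]
  intro σ hF hpσ
  have hNσ : σ.N ℓ.n 0 0 = N := by rw [hF.1 _ (by simp; grind only), hN]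
  have hB : ∀ σ' : RamState, (∀ b, b ≠ 12 → b ≠ 13 → σ'.N b = σ.N b) →
      (nvar ℓ.n).eval σ' = N := by
    intro σ' h
    simp only [NExpr.eval]
    rw [h _ (by grind only) (by grind only), hNσ]
  refine Runs.block_cons (e := 11) hX hO (Runs.mono hX (Runs.sumRow hX hO
    (Q := fun σ => ∀ i < N, σ.R 13 0 i = ∑ l ∈ range N, x l * mwTrans N V l i)
    (fun i l => x l * mwTrans N V l i) (by norm_num) hNX hNX hB hB ?_ (fun σ _ _ h => h))
    (by norm_num)) ?_
  · intro i hi l hl σ' h h12 h13 hR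
    simp only [NExpr.eval, RExpr.eval, h12, h13]
    rw [hR _ (by grind only), hR _ (by grind only), hR _ (by grind only), hF.2 12 (by simp; grind only),
      hF.2 ℓ.V (by simp; grind only), hF.2 11 (by simp; grind only), hx l hl, hV l hl i hi, hZ l hl]
    simp [mwTrans]
  intro σ₁ hF₁ hx₁
  refine Runs.block_cons (e := 10) hX hO (Runs.mono hX (Runs.fillRow hX hO
    (Q := fun σ => (∀ i < N, σ.R ℓ.p 0 i = p i + x i / T) ∧
      ∀ i < N, σ.R 12 0 i = ∑ l ∈ range N, x l * mwTrans N V l i)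
    (fun i => ∑ l ∈ range N, x l * mwTrans N V l i) (r := 0) hNX
    ?_ ?_ ?_ ?_) (by norm_num)) (fun σ _ h => Runs.block_nil hX h)
  · intro σ' h
    simp only [NExpr.eval]
    rw [h _ (by grind only), hF₁.1 _ (by simp; grind only), hNσ]
  · intro σ' _ j _ _; rfl
  · intro j hj σ' h hj' hR _
    simp only [NExpr.eval, RExpr.eval, hj']
    rw [hR _ (by grind only), hx₁ j hj]
  · intro σ' _ hR h
    refine ⟨fun i hi => ?_, fun i hi => ?_⟩
    · rw [hR _ (by grind only), hF₁.2 _ (by simp; grind only), hpσ i hi]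
    · rw [h]; simp [hi]

open RamProg in
theorem runs_cesaroProg {O : OracleEnv} {X : ℕ} (hX : 4 ≤ X) (hO : O.Ok) {ℓ : PlayerLayout}
    (hℓ : ℓ.Ok) {s : RamState} {N T : ℕ} {V : ℕ → ℕ → ℝ} (hNX : N ≤ X) (hTX : T ≤ X)
    (hN : s.N ℓ.n 0 0 = N) (hT : s.N 11 0 0 = T) (hV : ∀ i < N, ∀ j < N, s.R ℓ.V i j = V i j)
    (hZ : ∀ i < N, s.R 11 0 i = ∑ l ∈ range N, (1 + V i l)) :
    Runs O X 20 (cesaroProg ℓ) s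
      (fun σ => ∀ i < N, σ.R ℓ.p 0 i = cesaro N T (mwTrans N V) i) := by
  have hd' := hℓ
  simp only [PlayerLayout.Ok, List.nodup_cons, List.mem_cons, not_or] at hd'
  refine Runs.block_cons (e := 19) hX hO (Runs.mono hX (Runs.fillRow hX hO
    (Q := fun σ => ∀ i < N, σ.R 12 0 i = powerIter N (mwTrans N V) 0 i)
    (powerIter N (mwTrans N V) 0) (r := 0) hNX ?_ ?_ ?_ ?_) (by norm_num)) ?_
  · intro σ h
    simp only [NExpr.eval]
    rw [h _ (by grind only), hN]
  · intro σ _ j _ _; rfl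
  · intro j hj σ h hj' hR hself
    simp only [NExpr.eval, RExpr.eval, powerIter]
    rw [h _ (by grind only), hN]
    simp
  · intro σ _ _ h i hi
    rw [h]; simp [hi]
  intro σ₁ hF₁ hx₁
  refine Runs.block_cons (e := 18) hX hO (Runs.mono hX (Runs.fillRow hX hO
    (Q := fun σ => ∀ i < N, σ.R ℓ.p 0 i = 0) (fun _ => 0) (r := 0) hNX ?_ ?_ ?_ ?_)
    (by norm_num)) ?_
  · intro σ h
    simp only [NExpr.eval]
    rw [h _ (by grind only), hF₁.1 _ (by simp; grind only), hN]
  · intro σ _ j _ _; rfl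
  · intro j hj σ h hj' hR hself
    simp
  · intro σ _ _ h i hi
    rw [h]; simp [hi]
  intro σ₂ hF₂ hp₂
  have hx₂ : ∀ i < N, σ₂.R 12 0 i = powerIter N (mwTrans N V) 0 i := by
    intro i hi
    rw [hF₂.2 _ (by simp; grind only), hx₁ i hi]
  have hN₂ : σ₂.N ℓ.n 0 0 = N := by
    rw [hF₂.1 _ (by simp; grind only), hF₁.1 _ (by simp; grind only), hN]
  have hT₂ : σ₂.N 11 0 0 = T := by
    rw [hF₂.1 _ (by simp), hF₁.1 _ (by simp), hT]
  have hV₂ : σ₂.R ℓ.V = s.R ℓ.V := by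
    rw [hF₂.2 _ (by simp; grind only), hF₁.2 _ (by simp; grind only)]
  have hZ₂ : σ₂.R 11 = s.R 11 := by
    rw [hF₂.2 _ (by simp; grind only), hF₁.2 _ (by simp)]
  refine Runs.block_cons (e := 17) hX hO (Runs.forN (e := 13) hX hO hTX (by simp [chainProg])
    (fun t σ => (∀ i < N, σ.R ℓ.p 0 i = ∑ t' ∈ range t, powerIter N (mwTrans N V) t' i / T) ∧
      ∀ i < N, σ.R 12 0 i = powerIter N (mwTrans N V) t i) ?_ ?_ ?_ (fun _ _ _ h => h) ?_)
    (fun σ _ h => Runs.block_nil hX h)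
  · intro σ _ hR _
    rw [hR]
    exact ⟨by simpa using hp₂, hx₂⟩
  · intro t σ hF _
    simp only [NExpr.eval]
    rw [hF.1 _ (by simp [chainProg]), hT₂]
  · intro t σ ht hF _ hI
    refine Runs.conseq hO (runs_chainProg (V := V) hX hO hℓ hNX (T := T) ?_ ?_ ?_ hI.1 hI.2 ?_) ?_
    · rw [hF.1 _ (by simp [chainProg]; grind only), hN₂]
    · rw [hF.1 _ (by simp [chainProg]), hT₂]
    · rw [hF.2 _ (by simp [chainProg]; grind only), hV₂]; exact hV
    · rw [hF.2 _ (by simp [chainProg]; grind only), hZ₂]; exact hZ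
    · rintro σ' - ⟨h1, h2⟩
      refine ⟨fun i hi => ?_, fun i hi => ?_⟩
      · rw [h1 i hi, sum_range_succ]
      · rw [h2 i hi]; rfl
  · intro σ _ h i hi
    exact h.1 i hi

open RamProg in
-- Work space: natural arrays 10, 11 and 15 hold the dimension, the horizon and the step parameter,
-- and 12 to 14 are counters; real arrays 10 to 13 hold utilities, row sums, and the present and
-- next distribution of the chain. The horizon doubles as the number of steps of the chain.
theorem runs_mwProg {O : OracleEnv} {X : ℕ} (hX : 4 ≤ X) (hO : O.Ok) {ℓ : PlayerLayout}
    (hℓ : ℓ.Ok) {s : RamState} {N T d : ℕ} {S V : ℕ → ℕ → ℝ} {p y : ℕ → ℝ} (hN1 : 1 ≤ N)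
    (hNX : N ≤ X) (hTX : T ≤ X) (hdX : d ≤ X) (hN : s.N ℓ.n 0 0 = N) (hT : s.N 11 0 0 = T)
    (hd : s.N 10 0 0 = d) (hS : ∀ i < N, ∀ j < d, s.R ℓ.S i j = S i j)
    (hy : ∀ i < d, s.R ℓ.y 0 i = y i) (hV : ∀ i < N, ∀ j < N, s.R ℓ.V i j = V i j)
    (hp : ∀ i < N, s.R ℓ.p 0 i = p i) :
    Runs O X 25 (mwProg ℓ) s (fun σ =>
      (∀ i < N, ∀ j < N, σ.R ℓ.V i j =
        (mwStep N T (stepK N T) (V, p) (fun i => ∑ l ∈ range d, S i l * y l)).1 i j) ∧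
      ∀ i < N, σ.R ℓ.p 0 i =
        (mwStep N T (stepK N T) (V, p) (fun i => ∑ l ∈ range d, S i l * y l)).2 i) := by
  have hd' := hℓ
  simp only [PlayerLayout.Ok, List.nodup_cons, List.mem_cons, not_or] at hd'
  refine Runs.block_cons (e := 24) hX hO (Runs.mono hX
    (runs_stepProg hX hO (by grind only) hN1 hTX hN hT) (by norm_num)) fun σ₁ hF₁ hk => ?_
  have hN₁ : ∀ b, b ≠ 15 → σ₁.N b = s.N b := fun b hb => hF₁.1 b (by simpa [stepProg] using hb)
  have hR₁ : σ₁.R = s.R := funext fun b => hF₁.2 b (by simp [stepProg])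
  rw [← hN₁ _ (by grind only)] at hN hT hd
  rw [← hR₁] at hS hy hV hp
  refine Runs.block_cons (e := 23) hX hO (Runs.mono hX
    (runs_utilProg hX hO hℓ hNX hdX hN hd hS hy) (by norm_num)) fun σ₂ hF₂ hu => ?_
  have hN₂ : ∀ b, b ≠ 12 → b ≠ 13 → σ₂.N b = σ₁.N b := fun b hb hb' =>
    hF₂.1 b (by simp [utilProg, hb, hb'])
  have hR₂ : ∀ b, b ≠ 10 → σ₂.R b = σ₁.R b := fun b hb => hF₂.2 b (by simpa [utilProg] using hb)
  rw [← hN₂ _ (by grind only) (by grind only)] at hN hT hk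
  rw [← hR₂ _ (by grind only)] at hV hp
  refine Runs.block_cons (e := 22) hX hO (Runs.mono hX
    (runs_weightProg hX hO hℓ hNX hN hk hV hp hu) (by norm_num)) fun σ₃ hF₃ hV₃ => ?_
  have hN₃ : ∀ b, b ≠ 12 → b ≠ 13 → σ₃.N b = σ₂.N b := fun b hb hb' =>
    hF₃.1 b (by simp [weightProg, hb, hb'])
  rw [← hN₃ _ (by grind only) (by grind only)] at hN hT
  refine Runs.block_cons (e := 21) hX hO (Runs.mono hX
    (runs_rowSumProg hX hO hℓ hNX hN hV₃) (by norm_num)) fun σ₄ hF₄ hZ => ?_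
  have hN₄ : ∀ b, b ≠ 12 → b ≠ 13 → σ₄.N b = σ₃.N b := fun b hb hb' =>
    hF₄.1 b (by simp [rowSumProg, hb, hb'])
  have hR₄ : ∀ b, b ≠ 11 → σ₄.R b = σ₃.R b := fun b hb => hF₄.2 b (by simpa [rowSumProg] using hb)
  rw [← hN₄ _ (by grind only) (by grind only)] at hN hT
  rw [← hR₄ _ (by grind only)] at hV₃
  refine Runs.block_cons (e := 20) hX hO (Runs.conseq hO
    (runs_cesaroProg hX hO hℓ hNX hTX hN hT hV₃ hZ) fun σ₅ hF₅ hp₅ => ?_)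
    (fun σ _ h => Runs.block_nil hX h)
  refine ⟨?_, hp₅⟩
  rw [hF₅.2 _ (by simp [cesaroProg, chainProg]; grind only)]
  exact hV₃

/-! ### Output of a mixed action as a sparse list -/

/-- The memory holds the sparse list `l` in the arrays `len`, `act`, `wt`. -/
def HoldsList (σ : RamState) (len act wt : ℕ) (l : List (ℕ × ℝ)) : Prop :=
  σ.N len 0 0 = l.length ∧ ∀ r < l.length, l[r]? = some (σ.N act 0 r, σ.R wt 0 r)

theorem HoldsList.congr {σ σ' : RamState} {len act wt : ℕ} {l : List (ℕ × ℝ)}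
    (h : HoldsList σ len act wt l) (h1 : σ'.N len = σ.N len) (h2 : σ'.N act = σ.N act)
    (h3 : σ'.R wt = σ.R wt) : HoldsList σ' len act wt l := by
  rw [HoldsList, h1, h2, h3]; exact h

theorem HoldsList.append {σ σ' : RamState} {len act wt : ℕ} {l : List (ℕ × ℝ)} {x : ℕ} {w : ℝ}
    (h : HoldsList σ len act wt l) (h1 : σ'.N len 0 0 = l.length + 1)
    (h2 : ∀ r, σ'.N act 0 r = if r = l.length then x else σ.N act 0 r)
    (h3 : ∀ r, σ'.R wt 0 r = if r = l.length then w else σ.R wt 0 r) :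
    HoldsList σ' len act wt (l ++ [(x, w)]) := by
  refine ⟨by simp [h1], fun r hr => ?_⟩
  rw [h2, h3]
  by_cases hrl : r = l.length
  · simp [hrl]
  · have hr' : r < l.length := by simp at hr; omega
    rw [List.getElem?_append_left hr', h.2 r hr']
    simp [hrl]

theorem HoldsList.mem {σ : RamState} {len act wt : ℕ} {l : List (ℕ × ℝ)}
    (h : HoldsList σ len act wt l) {r : ℕ} (hr : r < σ.N len 0 0) :
    (σ.N act 0 r, σ.R wt 0 r) ∈ l := by
  rw [h.1] at hr
  exact List.mem_of_getElem? (h.2 r hr)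

theorem sum_range_eq_sum_map {α M : Type*} [AddCommMonoid M] (l : List α) (f : α → M) (g : ℕ → M)
    (h : ∀ r, ∀ hr : r < l.length, g r = f l[r]) :
    ∑ r ∈ range l.length, g r = (l.map f).sum := by
  have h1 : ∑ r ∈ range l.length, g r = ((List.range l.length).map g).sum := rfl
  rw [h1]
  congr 1
  refine List.ext_getElem (by simp) fun r hr hr' => ?_
  simp only [List.length_map, List.length_range] at hr
  simp [h r hr]

theorem HoldsList.sum_range {σ : RamState} {len act wt : ℕ} {l : List (ℕ × ℝ)} {M : Type*}
    [AddCommMonoid M] (h : HoldsList σ len act wt l) (F : ℕ → ℝ → M) :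
    ∑ r ∈ range (σ.N len 0 0), F (σ.N act 0 r) (σ.R wt 0 r) =
      (l.map fun e => F e.1 e.2).sum := by
  rw [h.1]
  refine sum_range_eq_sum_map l _ _ fun r hr => ?_
  have := h.2 r hr
  rw [List.getElem?_eq_getElem hr, Option.some_inj] at this
  rw [this]

namespace DecompOracle

variable {d n : ℕ} {a : Fin n → EuclideanSpace ℝ (Fin d)} (D : DecompOracle a)

/-- The list of actions and weights for the distribution `p` on the points `x`. -/
def mixList (x : ℕ → EuclideanSpace ℝ (Fin d)) (N : ℕ) (p : ℕ → ℝ) : List (ℕ × ℝ) :=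
  (List.range N).flatMap fun i => (D.dec (x i)).map fun e => ((e.1 : ℕ), p i * e.2)

theorem act_N_len (s : RamState) : (D.act s).N 3 0 0 = (D.dec (s.readVec d 3)).length := by
  simp [act]

theorem act_N_act (s : RamState) {r : ℕ} (hr : r < (D.dec (s.readVec d 3)).length) :
    (D.act s).N 4 0 r = ((D.dec (s.readVec d 3))[r].1 : ℕ) := by
  simp [act, hr]

theorem act_R_wt (s : RamState) {r : ℕ} (hr : r < (D.dec (s.readVec d 3)).length) :
    (D.act s).R 4 0 r = (D.dec (s.readVec d 3))[r].2 := by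
  simp [act, hr]

theorem act_N_ne (s : RamState) {b : ℕ} (h3 : b ≠ 3) (h4 : b ≠ 4) : (D.act s).N b = s.N b := by
  funext i j; simp [act, h3, h4]

theorem act_R_ne (s : RamState) {b : ℕ} (h4 : b ≠ 4) : (D.act s).R b = s.R b := by
  funext i j; simp [act, h4]

end DecompOracle

namespace RamProg

/-- Append the answer of the oracle, weighted by `w`, to the output. -/
def copyProg (ℓ : PlayerLayout) : RamProg :=
  forN 13 (nvar 3) (block [setN ℓ.act (.const 0) (nvar ℓ.len) (.get 4 (.const 0) (nvar 13)),
    setR ℓ.wt (.const 0) (nvar ℓ.len) (.mul (rrow ℓ.p (nvar 12)) (rrow 4 (nvar 13))),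
    setN ℓ.len (.const 0) (.const 0) (.add (nvar ℓ.len) (.const 1))])

/-- Decompose all points and output the resulting mixed action. -/
def outProg (ℓ : PlayerLayout) : RamProg :=
  block [setN ℓ.len (.const 0) (.const 0) (.const 0),
    forN 12 (nvar ℓ.n) (block [fillRow 13 (nvar 10) 3 (.const 0) (.get ℓ.S (nvar 12) (nvar 13)),
      call ℓ.o, copyProg ℓ])]

/-- One round of a player. -/
def roundProg (ℓ : PlayerLayout) : RamProg := block [mwProg ℓ, outProg ℓ]

end RamProg

open RamProg in
theorem runs_copyProg {O : OracleEnv} {X : ℕ} (hX : 4 ≤ X) (hO : O.Ok) {ℓ : PlayerLayout}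
    (hℓ : ℓ.Ok) {s : RamState} {i : ℕ} {w : ℝ} {l m : List (ℕ × ℝ)} (hmX : m.length ≤ X)
    (h3 : s.N 3 0 0 = m.length) (hi : s.N 12 0 0 = i) (hw : s.R ℓ.p 0 i = w)
    (hl : HoldsList s ℓ.len ℓ.act ℓ.wt l)
    (hm : ∀ r, ∀ hr : r < m.length, s.N 4 0 r = m[r].1 ∧ s.R 4 0 r = m[r].2) :
    Runs O X 7 (copyProg ℓ) s (fun σ => HoldsList σ ℓ.len ℓ.act ℓ.wt
      (l ++ m.map fun e => (e.1, w * e.2))) := by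
  have hd := hℓ
  simp only [PlayerLayout.Ok, List.nodup_cons, List.mem_cons, not_or] at hd
  refine Runs.forN (e := 3) hX hO hmX (by simp; grind only) (fun r σ =>
    HoldsList σ ℓ.len ℓ.act ℓ.wt (l ++ (m.take r).map fun e => (e.1, w * e.2))) ?_ ?_ ?_ ?_ ?_
  · intro σ hF hR hN
    simpa using hl.congr (hN _ (by grind only)) (hN _ (by grind only)) (by rw [hR])
  · intro r σ hF _
    simp only [NExpr.eval]
    rw [hF.1 _ (by simp; grind only), h3]
  · intro r σ hr hF hc hI
    set L := l ++ (m.take r).map fun e => (e.1, w * e.2) with hL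
    have h12 : σ.N 12 0 0 = i := by rw [hF.1 _ (by simp; grind only), hi]
    have h4 : σ.N 4 0 r = m[r].1 := by rw [hF.1 _ (by simp; grind only), (hm r hr).1]
    have h4' : σ.R 4 0 r = m[r].2 := by rw [hF.2 _ (by simp; grind only), (hm r hr).2]
    have hp' : σ.R ℓ.p 0 i = w := by rw [hF.2 _ (by simp; grind only), hw]
    refine Runs.block_cons (e := 2) hX hO (Runs.setN hX
      (Q := fun σ' => σ'.N ℓ.len 0 0 = L.length ∧ σ'.N 13 0 0 = r ∧ σ'.N 12 0 0 = i ∧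
        (∀ q, σ'.N ℓ.act 0 q = if q = L.length then m[r].1 else σ.N ℓ.act 0 q) ∧ σ'.R = σ.R)
      ?_) ?_
    · simp only [NExpr.eval, hI.1, hc, h4]
      refine ⟨?_, ?_, ?_, fun q => by simp, rfl⟩
      · rw [RamState.writeN_N_ne _ _ _ _ (by grind only), hI.1]
      · rw [RamState.writeN_N_ne _ _ _ _ (by grind only), hc]
      · rw [RamState.writeN_N_ne _ _ _ _ (by grind only), h12]
    rintro σ₁ - ⟨a1, a2, a3, a4, a5⟩
    refine Runs.block_cons (e := 1) hX hO (Runs.setR hX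
      (Q := fun σ' => σ'.N = σ₁.N ∧
        (∀ q, σ'.R ℓ.wt 0 q = if q = L.length then w * m[r].2 else σ.R ℓ.wt 0 q)) ?_) ?_
    · refine ⟨rfl, fun q => ?_⟩
      simp only [NExpr.eval, RExpr.eval, a1, a2, a3, a5, h4', hp']
      simp [a5]
    rintro σ₂ - ⟨b1, b2⟩
    -- The length is raised last, so both preceding writes address the slot just behind the list.
    refine Runs.block_cons (e := 0) hX hO (Runs.setN hX ?_) (Q₁ := fun σ => HoldsList σ ℓ.len ℓ.act
      ℓ.wt (l ++ (m.take (r + 1)).map fun e => (e.1, w * e.2)))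
        (fun σ _ h => Runs.block_nil hX h)
    simp only [NExpr.eval]
    rw [List.take_succ_eq_append_getElem hr, List.map_append, ← List.append_assoc, ← hL]
    refine hI.append (x := m[r].1) (w := w * m[r].2) ?_ (fun q => ?_) (fun q => ?_)
    · simp [b1, a1]
    · rw [RamState.writeN_N_ne _ _ _ _ (by grind only), b1, a4]
    · simp [b2]
  · intro r σ x h
    exact h.congr (RamState.writeN_N_ne _ _ _ _ (by grind only))
      (RamState.writeN_N_ne _ _ _ _ (by grind only)) rfl
  · intro σ _ h
    simpa using h

open RamProg in
theorem runs_outProg {O : OracleEnv} {X : ℕ} (hX : 4 ≤ X) (hO : O.Ok) {ℓ : PlayerLayout}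
    (hℓ : ℓ.Ok) {d n : ℕ} {a : Fin n → EuclideanSpace ℝ (Fin d)} {D : DecompOracle a}
    (hact : O.act ℓ.o = D.act) (hcost : O.cost ℓ.o ≤ X) {s : RamState} {N : ℕ}
    {x : ℕ → EuclideanSpace ℝ (Fin d)} {p : ℕ → ℝ} (hNX : N ≤ X) (hdX : d ≤ X)
    (hlen : ∀ i < N, (D.dec (x i)).length ≤ X) (hN : s.N ℓ.n 0 0 = N) (hd : s.N 10 0 0 = d)
    (hS : ∀ i < N, ∀ j : Fin d, s.R ℓ.S i j = x i j) (hp : ∀ i < N, s.R ℓ.p 0 i = p i) :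
    Runs O X 17 (outProg ℓ) s
      (fun σ => HoldsList σ ℓ.len ℓ.act ℓ.wt (D.mixList x N p)) := by
  have hd' := hℓ
  simp only [PlayerLayout.Ok, List.nodup_cons, List.mem_cons, not_or] at hd'
  refine Runs.block_cons (e := 16) hX hO (Runs.setN hX
    (Q := fun σ => HoldsList σ ℓ.len ℓ.act ℓ.wt []) ⟨by simp, by simp⟩) ?_
  intro σ₀ hF₀ hl₀
  refine Runs.block_cons (e := 15) hX hO (Runs.mono hX (Runs.forN (e := 10) hX hO hNX
    (by simp [copyProg]; grind only) (fun r σ => HoldsList σ ℓ.len ℓ.act ℓ.wt (D.mixList x r p))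
    ?_ ?_ ?_ ?_ (fun σ _ h => h)) (by norm_num)) (fun σ _ h => Runs.block_nil hX h)
  · intro σ hF hR hN
    simpa [DecompOracle.mixList] using
      hl₀.congr (hN _ (by grind only)) (hN _ (by grind only)) (by rw [hR])
  · intro r σ hF _
    simp only [NExpr.eval]
    rw [hF.1 _ (by simp [copyProg]; grind only), hF₀.1 _ (by simp; grind only), hN]
  · intro r σ hr hF hc hI
    have hdσ : σ.N 10 0 0 = d := by
      rw [hF.1 _ (by simp [copyProg]; grind only), hF₀.1 _ (by simp; grind only), hd]
    have hSσ : σ.R ℓ.S = s.R ℓ.S := by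
      rw [hF.2 _ (by simp [copyProg]; grind only), hF₀.2 _ (by simp)]
    have hpσ : σ.R ℓ.p = s.R ℓ.p := by
      rw [hF.2 _ (by simp [copyProg]; grind only), hF₀.2 _ (by simp)]
    refine Runs.block_cons (e := 9) hX hO (Runs.mono hX (Runs.fillRow hX hO (r := 0)
      (Q := fun σ' => σ'.readVec d 3 = x r) (fun j => s.R ℓ.S r j) hdX ?_ ?_ ?_ ?_)
      (by norm_num)) ?_
    · intro σ' h
      simp only [NExpr.eval]
      rw [h _ (by grind only), hdσ]
    · intro σ' _ _ _ _; rfl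
    · intro j hj σ' h hj' hR _
      simp only [RExpr.eval, NExpr.eval, hj', h 12 (by norm_num), hc]
      rw [hR _ (by grind only), hSσ]
    · intro σ' _ _ h
      ext j
      simp [RamState.readVec, h, hS r hr]
    intro σ₁ hF₁ hv
    refine Runs.block_cons (e := 8) hX hO (Runs.mono hX (Runs.call (e := 0) hcost
      (Q := fun σ' => σ' = D.act σ₁) (by rw [hact])) (by norm_num)) ?_
    rintro σ₂ hF₂ rfl
    have hlen' := D.act_N_len σ₁
    rw [hv] at hlen'
    have hact' := fun r => D.act_N_act σ₁ (r := r)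
    have hwt' := fun r => D.act_R_wt σ₁ (r := r)
    simp only [hv] at hact' hwt'
    refine Runs.block_cons (e := 7) hX hO (Runs.conseq hO (runs_copyProg (i := r) (w := p r)
      (l := D.mixList x r p) (m := (D.dec (x r)).map fun e => ((e.1 : ℕ), e.2)) hX hO hℓ
      ?_ ?_ ?_ ?_ ?_ ?_) ?_)
      (Q₁ := fun σ => HoldsList σ ℓ.len ℓ.act ℓ.wt (D.mixList x (r + 1) p))
      (fun σ _ h => Runs.block_nil hX h)
    · simpa using hlen r hr
    · simpa using hlen'
    · rw [D.act_N_ne _ (by norm_num) (by norm_num), hF₁.1 _ (by simp), hc]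
    · rw [D.act_R_ne _ (by grind only), hF₁.2 _ (by simp; grind only), hpσ, hp r hr]
    · refine hI.congr ?_ ?_ ?_
      · rw [D.act_N_ne _ (by grind only) (by grind only), hF₁.1 _ (by simp; grind only)]
      · rw [D.act_N_ne _ (by grind only) (by grind only), hF₁.1 _ (by simp; grind only)]
      · rw [D.act_R_ne _ (by grind only), hF₁.2 _ (by simp; grind only)]
    · intro q hq
      simp only [List.length_map] at hq
      simp [hact' q hq, hwt' q hq]
    · intro σ _ h
      simpa [DecompOracle.mixList, List.range_succ, List.flatMap_append, Function.comp_def] using h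
  · intro r σ y h
    exact h.congr (RamState.writeN_N_ne _ _ _ _ (by grind only))
      (RamState.writeN_N_ne _ _ _ _ (by grind only)) rfl

open RamProg in
theorem runs_roundProg {O : OracleEnv} {X : ℕ} (hX : 4 ≤ X) (hO : O.Ok) {ℓ : PlayerLayout}
    (hℓ : ℓ.Ok) {d n : ℕ} {a : Fin n → EuclideanSpace ℝ (Fin d)} {D : DecompOracle a}
    (hact : O.act ℓ.o = D.act) (hcost : O.cost ℓ.o ≤ X) {s : RamState} {N T : ℕ}
    {x : ℕ → EuclideanSpace ℝ (Fin d)} {V : ℕ → ℕ → ℝ} {p : ℕ → ℝ} {y : EuclideanSpace ℝ (Fin d)}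
    (hN1 : 1 ≤ N) (hNX : N ≤ X) (hTX : T ≤ X) (hdX : d ≤ X)
    (hlen : ∀ i < N, (D.dec (x i)).length ≤ X) (hN : s.N ℓ.n 0 0 = N) (hT : s.N 11 0 0 = T)
    (hd : s.N 10 0 0 = d) (hS : ∀ i < N, ∀ j : Fin d, s.R ℓ.S i j = x i j)
    (hy : ∀ j : Fin d, s.R ℓ.y 0 j = y j) (hV : ∀ i < N, ∀ j < N, s.R ℓ.V i j = V i j)
    (hp : ∀ i < N, s.R ℓ.p 0 i = p i) :
    Runs O X 27 (roundProg ℓ) s (fun σ =>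
      (∀ i < N, ∀ j < N, σ.R ℓ.V i j =
        (mwStep N T (stepK N T) (V, p) (fun i => inner ℝ (x i) y)).1 i j) ∧
      (∀ i < N, σ.R ℓ.p 0 i =
        (mwStep N T (stepK N T) (V, p) (fun i => inner ℝ (x i) y)).2 i) ∧
      HoldsList σ ℓ.len ℓ.act ℓ.wt
        (D.mixList x N (mwStep N T (stepK N T) (V, p) (fun i => inner ℝ (x i) y)).2)) := by
  have hd' := hℓ
  simp only [PlayerLayout.Ok, List.nodup_cons, List.mem_cons, not_or] at hd'
  -- Coordinates are padded by zero to natural indices, the form in which the machine's loops sum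
  -- them.
  set S : ℕ → ℕ → ℝ := fun i j => if h : j < d then x i ⟨j, h⟩ else 0 with hSdef
  set z : ℕ → ℝ := fun j => if h : j < d then y ⟨j, h⟩ else 0 with hzdef
  have hinner : (fun i => inner ℝ (x i) y) = fun i => ∑ l ∈ range d, S i l * z l := by
    funext i
    rw [sum_range, PiLp.inner_apply]
    refine sum_congr rfl fun l _ => ?_
    simp [hSdef, hzdef, mul_comm]
  rw [hinner]
  refine Runs.block_cons (e := 26) hX hO (Runs.mono hX (runs_mwProg (S := S) (y := z) hX hO hℓ hN1
    hNX hTX hdX hN hT hd ?_ ?_ hV hp) (by norm_num)) ?_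
  · intro i hi j hj
    simpa [hSdef, hj] using hS i hi ⟨j, hj⟩
  · intro j hj
    simpa [hzdef, hj] using hy ⟨j, hj⟩
  rintro σ₁ hF₁ ⟨hV₁, hp₁⟩
  have hmod : ∀ b, b ≠ 12 → b ≠ 13 → b ≠ 14 → b ≠ 15 → σ₁.N b = s.N b := fun b h1 h2 h3 h4 =>
    hF₁.1 b (by simp [mwProg, stepProg, utilProg, weightProg, rowSumProg, cesaroProg, chainProg,
      h1, h2, h3, h4])
  refine Runs.block_cons (e := 25) hX hO (Runs.mono hX (Runs.conseq hO (runs_outProg (x := x)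
    (N := N) (D := D) hX hO hℓ hact hcost hNX hdX hlen ?_ ?_ ?_ hp₁) ?_) (by norm_num))
    (fun σ _ h => Runs.block_nil hX h)
  · rw [hmod _ (by grind only) (by grind only) (by grind only) (by grind only), hN]
  · rw [hmod _ (by grind only) (by grind only) (by grind only) (by grind only), hd]
  · rw [hF₁.2 _ (by simp [mwProg, stepProg, utilProg, weightProg, rowSumProg, cesaroProg, chainProg]
                    grind only)]
    exact hS
  · intro σ hF h
    refine ⟨?_, ?_, h⟩
    · rw [hF.2 _ (by simp [outProg, copyProg]; grind only)]; exact hV₁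
    · rw [hF.2 _ (by simp [outProg, copyProg]; grind only)]; exact hp₁

/-! ### The learning algorithm of a player -/

theorem norm_embed_le_one {d m : ℕ} {b : Fin m → EuclideanSpace ℝ (Fin d)} (hb : ∀ j, ‖b j‖ ≤ 1)
    (q : MixedAction m) : ‖embed b q‖ ≤ 1 := by
  refine (norm_sum_le _ _).trans ?_
  rw [← q.2.2]
  refine sum_le_sum fun j _ => ?_
  have h0 : 0 ≤ q j := q.2.1 j
  rw [norm_smul, Real.norm_of_nonneg h0]
  exact mul_le_of_le_one_right h0 (hb j)

namespace DecompOracle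

variable {d n : ℕ} {a : Fin n → EuclideanSpace ℝ (Fin d)} (D : DecompOracle a)

/-- The weight of the action `i` in the decomposition of `x`. -/
noncomputable def weight (x : EuclideanSpace ℝ (Fin d)) (i : Fin n) : ℝ :=
  ((D.dec x).map fun e => if e.1 = i then e.2 else 0).sum

/-- One identity for all linear statistics of an answer of the oracle: constant scalars give total
mass, and the vectors `a i` give the embedded point. -/
theorem sum_weight_smul {M : Type*} [AddCommGroup M] [Module ℝ M] (x : EuclideanSpace ℝ (Fin d))
    (g : Fin n → M) : ∑ i, D.weight x i • g i = ((D.dec x).map fun e => e.2 • g e.1).sum := by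
  unfold weight
  induction D.dec x with
  | nil => simp
  | cons e l ih => simp [add_smul, sum_add_distrib, ih, ite_smul]

theorem weight_mem {x : EuclideanSpace ℝ (Fin d)} (hx : x ∈ convexHull ℝ (Set.range a)) :
    D.weight x ∈ stdSimplex ℝ (Fin n) := by
  refine ⟨fun i => List.sum_nonneg fun r hr => ?_, ?_⟩
  · obtain ⟨e, he, rfl⟩ := List.mem_map.1 hr
    split_ifs
    · exact D.nonneg x hx e he
    · exact le_rfl
  · simpa [D.sum_one x hx] using D.sum_weight_smul x (fun _ => (1 : ℝ))

theorem sum_weight_smul_self {x : EuclideanSpace ℝ (Fin d)}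
    (hx : x ∈ convexHull ℝ (Set.range a)) : ∑ i, D.weight x i • a i = x := by
  rw [sum_weight_smul, D.embeds x hx]

/-- The mixed action given by the distribution `p` on the points `x`. -/
noncomputable def mixWeight (x : ℕ → EuclideanSpace ℝ (Fin d)) (N : ℕ) (p : ℕ → ℝ)
    (i : Fin n) : ℝ := ∑ s ∈ range N, p s * D.weight (x s) i

variable {x : ℕ → EuclideanSpace ℝ (Fin d)} {N : ℕ} {p : ℕ → ℝ}

theorem mixWeight_mem (hx : ∀ s < N, x s ∈ convexHull ℝ (Set.range a)) (hp : IsProb N p) :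
    D.mixWeight x N p ∈ stdSimplex ℝ (Fin n) := by
  refine ⟨fun i => sum_nonneg fun s hs => mul_nonneg (hp.1 s (mem_range.1 hs))
    ((D.weight_mem (hx s (mem_range.1 hs))).1 i), ?_⟩
  simp only [mixWeight]
  rw [sum_comm, ← hp.2]
  refine sum_congr rfl fun s hs => ?_
  rw [← mul_sum, (D.weight_mem (hx s (mem_range.1 hs))).2, mul_one]

theorem sum_mixWeight_smul {M : Type*} [AddCommGroup M] [Module ℝ M] (g : Fin n → M) :
    ∑ i, D.mixWeight x N p i • g i = ∑ s ∈ range N, p s • ∑ i, D.weight (x s) i • g i := by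
  simp only [mixWeight, sum_smul]
  rw [sum_comm]
  simp only [smul_sum, mul_smul]

theorem sum_mixList {M : Type*} [AddCommMonoid M] (f : ℕ × ℝ → M) :
    ((D.mixList x N p).map f).sum = ∑ s ∈ range N,
      ((D.dec (x s)).map fun e => f ((e.1 : ℕ), p s * e.2)).sum := by
  have h : ∀ l : List ℕ, ((l.flatMap fun i => (D.dec (x i)).map
      fun e => ((e.1 : ℕ), p i * e.2)).map f).sum =
      (l.map fun s => ((D.dec (x s)).map fun e => f ((e.1 : ℕ), p s * e.2)).sum).sum := by
    intro l
    induction l with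
    | nil => simp
    | cons i l ih => simp [ih, Function.comp_def]
  exact h _

theorem sum_mixList_smul {M : Type*} [AddCommGroup M] [Module ℝ M] (g : ℕ → M) :
    ((D.mixList x N p).map fun e => e.2 • g e.1).sum = ∑ i, D.mixWeight x N p i • g i := by
  rw [sum_mixList, sum_mixWeight_smul]
  refine sum_congr rfl fun s _ => ?_
  rw [sum_weight_smul, List.smul_sum, List.map_map]
  simp [Function.comp_def, mul_smul]

theorem sum_mixList_ite (i : Fin n) :
    ((D.mixList x N p).map fun e => if e.1 = (i : ℕ) then e.2 else 0).sum =
      D.mixWeight x N p i := by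
  have := D.sum_mixList_smul (x := x) (N := N) (p := p) (fun k => if k = (i : ℕ) then (1 : ℝ) else 0)
  simp only [smul_eq_mul, mul_ite, mul_one, mul_zero] at this
  rw [this, sum_eq_single i]
  · simp
  · intro j _ hj; rw [if_neg (fun h => hj (Fin.ext h))]
  · simp

theorem mem_mixList (hx : ∀ s < N, x s ∈ convexHull ℝ (Set.range a)) (hp : IsProb N p)
    {e : ℕ × ℝ} (he : e ∈ D.mixList x N p) : e.1 < n ∧ 0 ≤ e.2 := by
  obtain ⟨s, hs, he⟩ := List.mem_flatMap.1 he
  obtain ⟨e', he', rfl⟩ := List.mem_map.1 he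
  rw [List.mem_range] at hs
  exact ⟨e'.1.2, mul_nonneg (hp.1 s hs) (D.nonneg _ (hx s hs) e' he')⟩

theorem length_mixList_le {X : ℕ} (hlen : ∀ s < N, (D.dec (x s)).length ≤ X) :
    (D.mixList x N p).length ≤ N * X := by
  have : ∀ m ≤ N, (D.mixList x m p).length ≤ m * X := by
    intro m
    induction m with
    | zero => simp [mixList]
    | succ m ih =>
      intro hm
      have h1 := ih (by omega)
      have h2 := hlen m (by omega)
      simp only [mixList, List.range_succ, List.flatMap_append, List.length_append,
        List.flatMap_singleton, List.length_map] at h1 ⊢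
      rw [add_mul]; omega
  exact this N le_rfl

end DecompOracle

/-- The points of a list, indexed by natural numbers. -/
noncomputable def pt {d : ℕ} (S : List (EuclideanSpace ℝ (Fin d))) (i : ℕ) : EuclideanSpace ℝ (Fin d) :=
  S.getD i 0

theorem pt_mem {d : ℕ} {S : List (EuclideanSpace ℝ (Fin d))} {i : ℕ} (hi : i < S.length) :
    pt S i ∈ S := by
  rw [pt, List.getD_eq_getElem _ _ hi]
  exact List.getElem_mem hi

/-- The state of a player who has seen the observations `ys`. -/
noncomputable def playerState {d : ℕ} (S : List (EuclideanSpace ℝ (Fin d))) (T : ℕ)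
    (ys : List (EuclideanSpace ℝ (Fin d))) : (ℕ → ℕ → ℝ) × (ℕ → ℝ) :=
  mwState S.length T (stepK S.length T) (ys.map fun y i => inner ℝ (pt S i) y)

theorem playerState_append {d : ℕ} (S : List (EuclideanSpace ℝ (Fin d))) (T : ℕ)
    (ys : List (EuclideanSpace ℝ (Fin d))) (y : EuclideanSpace ℝ (Fin d)) :
    playerState S T (ys ++ [y]) = mwStep S.length T (stepK S.length T) (playerState S T ys)
      (fun i => inner ℝ (pt S i) y) := by
  simp [playerState, mwState]

/-- The zero vector shown in the first round has utility zero at every point, so it is precisely the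
idle round built into `mwPlay`. -/
theorem playerState_eq_mwPlay {d : ℕ} (S : List (EuclideanSpace ℝ (Fin d))) (T t : ℕ)
    (y : ℕ → EuclideanSpace ℝ (Fin d)) :
    playerState S T (0 :: (List.range t).map y) =
      mwPlay S.length T (stepK S.length T) (fun t i => inner ℝ (pt S i) (y t)) t := by
  have : (fun i => inner ℝ (pt S i) (0 : EuclideanSpace ℝ (Fin d))) = (0 : ℕ → ℝ) := by
    funext i; simp
  rw [playerState, mwPlay, List.map_cons, this, List.map_map]
  rfl

section player

variable {d n m : ℕ} {a : Fin n → EuclideanSpace ℝ (Fin d)} {b : Fin m → EuclideanSpace ℝ (Fin d)}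
  {S : List (EuclideanSpace ℝ (Fin d))} {T : ℕ}

theorem abs_inner_pt_le_one (ha : ∀ i, ‖a i‖ ≤ 1) (hS : ∀ x ∈ S, x ∈ convexHull ℝ (Set.range a))
    {i : ℕ} (hi : i < S.length) {y : EuclideanSpace ℝ (Fin d)} (hy : ‖y‖ ≤ 1) :
    |inner ℝ (pt S i) y| ≤ 1 := by
  refine (abs_real_inner_le_norm _ _).trans ?_
  have := norm_le_one_of_mem_hull ha (hS _ (pt_mem hi))
  exact mul_le_one₀ this (norm_nonneg _) hy

theorem isProb_playerState (ha : ∀ i, ‖a i‖ ≤ 1) (hS : ∀ x ∈ S, x ∈ convexHull ℝ (Set.range a))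
    (hN : 1 ≤ S.length) (hT : 1 ≤ T) {ys : List (EuclideanSpace ℝ (Fin d))}
    (hys : ∀ y ∈ ys, ‖y‖ ≤ 1) : IsProb S.length (playerState S T (0 :: ys)).2 := by
  -- A finite list of observations is extended by zeros, because the method is analysed for infinite
  -- utility sequences.
  have h : ys = (List.range ys.length).map fun t => ys.getD t 0 := by
    refine List.ext_getElem (by simp) fun r hr hr' => ?_
    rw [List.getElem_map, List.getElem_range, List.getD_eq_getElem _ _ hr]
  rw [h, playerState_eq_mwPlay]
  refine isProb_mwPlay hN hT (stepK_spec hN T).1 (fun t i hi => ?_) _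
  refine abs_inner_pt_le_one ha hS hi ?_
  by_cases ht : t < ys.length
  · rw [List.getD_eq_getElem _ _ ht]; exact hys _ (List.getElem_mem ht)
  · rw [List.getD_eq_default _ _ (not_lt.1 ht)]; simp

/-- The learning algorithm plays the decompositions of the points of `S` with the distribution
computed by the swap regret method. -/
def IsPlayer (D : DecompOracle a) (S : List (EuclideanSpace ℝ (Fin d))) (T : ℕ)
    (b : Fin m → EuclideanSpace ℝ (Fin d)) (L : LearningAlgorithm n m) : Prop :=
  ∀ h, (L h : Fin n → ℝ) = D.mixWeight (pt S) S.length (playerState S T (0 :: h.map (embed b))).2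

theorem exists_isPlayer (D : DecompOracle a) (ha : ∀ i, ‖a i‖ ≤ 1) (hb : ∀ j, ‖b j‖ ≤ 1)
    (hS : ∀ x ∈ S, x ∈ convexHull ℝ (Set.range a)) (hN : 1 ≤ S.length) (hT : 1 ≤ T) :
    ∃ L : LearningAlgorithm n m, IsPlayer D S T b L := by
  refine ⟨fun h => ⟨_, D.mixWeight_mem (fun s hs => hS _ (pt_mem hs))
    (isProb_playerState ha hS hN hT ?_)⟩, fun h => rfl⟩
  intro y hy
  obtain ⟨q, -, rfl⟩ := List.mem_map.1 hy
  exact norm_embed_le_one hb q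

/-- The regret of a player with respect to swap functions. -/
theorem IsPlayer.swap_regret {D : DecompOracle a} {L : LearningAlgorithm n m} {δ : ℝ}
    (hL : IsPlayer D S T b L) (hδ : 0 ≤ δ) (ha : ∀ i, ‖a i‖ ≤ 1) (hb : ∀ j, ‖b j‖ ≤ 1)
    (hS : IsHullNet a δ S) (hN : 1 ≤ S.length) (hT : 1 ≤ T) (q : ℕ → MixedAction m)
    (φ : Fin n → Fin n) :
    ∑ t ∈ range T, ∑ i, (L ((List.range t).map q) : Fin n → ℝ) i *
        inner ℝ (a (φ i) - a i) (embed b (q t)) ≤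
      S.length * (stepK S.length T * Real.log S.length) + 2 / stepK S.length T * T + 2 + δ * T := by
  set N := S.length with hNdef
  set k := stepK N T with hk
  set y : ℕ → EuclideanSpace ℝ (Fin d) := fun t => embed b (q t) with hy
  set u : ℕ → ℕ → ℝ := fun t i => inner ℝ (pt S i) (y t) with hu
  set p : ℕ → ℕ → ℝ := fun t => (mwPlay N T k u t).2 with hp
  have hy1 : ∀ t, ‖y t‖ ≤ 1 := fun t => norm_embed_le_one hb _
  have hu1 : ∀ t, ∀ j < N, |u t j| ≤ 1 := fun t j hj => abs_inner_pt_le_one ha hS.1 hj (hy1 t)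
  have hk2 : 2 ≤ k := (stepK_spec hN T).1
  have hprob : ∀ t, IsProb N (p t) := isProb_mwPlay hN hT hk2 hu1
  have hLt : ∀ t, (L ((List.range t).map q) : Fin n → ℝ) = D.mixWeight (pt S) N (p t) := by
    intro t
    rw [hL, List.map_map]
    have := playerState_eq_mwPlay S T t y
    rw [hy] at this
    rw [show (embed b ∘ q) = fun t => embed b (q t) from rfl, this]
  have hhull : ∀ s < N, pt S s ∈ convexHull ℝ (Set.range a) := fun s hs => hS.1 _ (pt_mem hs)
  -- The effect of `φ` on point `s`. It does not depend on the round because the oracle always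
  -- decomposes `s` in the same way.
  set x' : ℕ → EuclideanSpace ℝ (Fin d) := fun s => ∑ i, D.weight (pt S s) i • a (φ i) with hx'
  have hx'hull : ∀ s < N, x' s ∈ convexHull ℝ (Set.range a) := fun s hs =>
    (convex_convexHull ℝ _).sum_mem (fun i _ => (D.weight_mem (hhull s hs)).1 i)
      (D.weight_mem (hhull s hs)).2 fun i _ => subset_convexHull _ _ ⟨_, rfl⟩
  set Y : ℕ → EuclideanSpace ℝ (Fin d) := fun s => ∑ t ∈ range T, p t s • y t with hY
  -- A single net point replaces `x' s` in all rounds at once: only the aggregate direction `Y s`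
  -- matters, and the choice may be made in hindsight.
  have hsel : ∀ s, ∃ r, s < N → r < N ∧
      inner ℝ (x' s) (Y s) ≤ inner ℝ (pt S r) (Y s) + δ * ‖Y s‖ := by
    intro s
    by_cases hs : s < N
    · obtain ⟨z, hz, hzy⟩ := hS.2 _ (hx'hull s hs) (Y s)
      obtain ⟨r, hr, rfl⟩ := List.getElem_of_mem hz
      exact ⟨r, fun _ => ⟨hr, by rwa [pt, List.getD_eq_getElem _ _ hr]⟩⟩
    · exact ⟨0, fun h => absurd h hs⟩
  choose f hf using hsel
  have hreg := mwPlay_swap_regret hN hT hk2 hu1 T (f := f) fun s hs => (hf s hs).1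
  have hround : ∀ t, ∑ i, (L ((List.range t).map q) : Fin n → ℝ) i *
      inner ℝ (a (φ i) - a i) (y t) = ∑ s ∈ range N, p t s * inner ℝ (x' s - pt S s) (y t) := by
    intro t
    have h1 : ∑ i, D.mixWeight (pt S) N (p t) i • (a (φ i) - a i) =
        ∑ s ∈ range N, p t s • (x' s - pt S s) := by
      rw [D.sum_mixWeight_smul]
      refine sum_congr rfl fun s hs => ?_
      simp only [smul_sub (D.weight _ _), sum_sub_distrib]
      rw [D.sum_weight_smul_self (hhull s (mem_range.1 hs))]
    have h2 := congrArg (fun v => inner ℝ v (y t)) h1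
    simp only [sum_inner, real_inner_smul_left] at h2
    rw [hLt]
    exact h2
  -- Summed over `s` these bounds give `T`, so replacing every `x' s` costs `δ * T` in total.
  have hYn : ∀ s < N, ‖Y s‖ ≤ ∑ t ∈ range T, p t s := by
    intro s hs
    refine (norm_sum_le _ _).trans (sum_le_sum fun t _ => ?_)
    rw [norm_smul, Real.norm_of_nonneg ((hprob t).1 s hs)]
    exact mul_le_of_le_one_right ((hprob t).1 s hs) (hy1 t)
  have hinY : ∀ (z : EuclideanSpace ℝ (Fin d)) s,
      inner ℝ z (Y s) = ∑ t ∈ range T, p t s * inner ℝ z (y t) := by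
    intro z s
    simp only [hY, inner_sum, real_inner_smul_right]
  have hs : ∀ s ∈ range N, ∑ t ∈ range T, p t s * inner ℝ (x' s - pt S s) (y t) ≤
      ∑ t ∈ range T, p t s * (u t (f s) - u t s) + δ * ∑ t ∈ range T, p t s := by
    intro s hs
    have hs := mem_range.1 hs
    have h1 := (hf s hs).2
    have h2 := mul_le_mul_of_nonneg_left (hYn s hs) hδ
    rw [← hinY, inner_sub_left]
    simp only [mul_sub, sum_sub_distrib, hu]
    rw [← hinY, ← hinY]
    linarith
  have hsum := sum_le_sum hs
  rw [sum_add_distrib, ← mul_sum] at hsum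
  have hone : ∑ s ∈ range N, ∑ t ∈ range T, p t s = T := by
    rw [sum_comm]; simp [(hprob _).2]
  rw [hone] at hsum
  have hT' : (T : ℝ) ≠ 0 := by positivity
  -- With `M = T` steps of the chain, the stationarity error over all rounds is just 2.
  rw [div_mul_cancel₀ _ hT'] at hreg
  calc _ = ∑ t ∈ range T, ∑ s ∈ range N, p t s * inner ℝ (x' s - pt S s) (y t) :=
        sum_congr rfl fun t _ => hround t
    _ = ∑ s ∈ range N, ∑ t ∈ range T, p t s * inner ℝ (x' s - pt S s) (y t) := sum_comm
    _ ≤ _ := by linarith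

end player

/-! ### The program of a player -/

/-- The arrays used by the program of a single player. -/
def soloLayout : PlayerLayout where
  n := 16
  S := 0
  V := 14
  p := 15
  y := 1
  o := 0
  len := 1
  act := 2
  wt := 2

theorem soloLayout_ok : soloLayout.Ok := by
  constructor <;> decide

namespace RamProg

/-- The program of a single player. -/
def playerProg : RamProg :=
  block [setN 10 (.const 0) (.const 0) (.get 0 (.const 0) (.const 0)),
    setN 11 (.const 0) (.const 0) (.get 0 (.const 0) (.const 1)),
    setN 16 (.const 0) (.const 0) (.get 0 (.const 0) (.const 2)),
    roundProg soloLayout]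

end RamProg

theorem RamState.writeVec_R_self {d : ℕ} (s : RamState) (A : ℕ) (x : EuclideanSpace ℝ (Fin d))
    (j : Fin d) : (s.writeVec A x).R A 0 j = x j := by
  simp [RamState.writeVec]

theorem RamState.writeVec_R_ne {d : ℕ} (s : RamState) {A B : ℕ} (x : EuclideanSpace ℝ (Fin d))
    (h : B ≠ A) : (s.writeVec A x).R B = s.R B := by
  funext i j; simp [RamState.writeVec, h]

theorem RamState.writeVec_N {d : ℕ} (s : RamState) (A : ℕ) (x : EuclideanSpace ℝ (Fin d)) :
    (s.writeVec A x).N = s.N := rfl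

section

variable {d n m : ℕ} {a : Fin n → EuclideanSpace ℝ (Fin d)} {b : Fin m → EuclideanSpace ℝ (Fin d)}
  {S : List (EuclideanSpace ℝ (Fin d))} {T : ℕ}

theorem playerEnv_ok (D : DecompOracle a) : (playerEnv D).Ok := by
  intro o s
  simp only [playerEnv]
  split_ifs
  · exact ⟨fun b h3 h4 => D.act_N_ne s h3 h4, fun b h4 _ => D.act_R_ne s h4⟩
  · exact ⟨fun _ _ _ => rfl, fun _ _ _ => rfl⟩

theorem HoldsList.displaysAction {D : DecompOracle a} {σ : RamState}
    {x : ℕ → EuclideanSpace ℝ (Fin d)} {N : ℕ} {p : ℕ → ℝ}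
    (h : HoldsList σ 1 2 2 (D.mixList x N p))
    (hx : ∀ s < N, x s ∈ convexHull ℝ (Set.range a)) (hp : IsProb N p) {P : MixedAction n}
    (hP : (P : Fin n → ℝ) = D.mixWeight x N p) : DisplaysAction σ P := by
  refine ⟨fun r hr => D.mem_mixList hx hp (h.mem hr), fun i => ?_⟩
  rw [hP, h.sum_range (fun k w => if k = (i : ℕ) then w else 0), D.sum_mixList_ite]

/-- The invariant of the program of a player after the observations `ys`. -/
def PlayerInv (d : ℕ) (S : List (EuclideanSpace ℝ (Fin d))) (T : ℕ) (σ : RamState)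
    (ys : List (EuclideanSpace ℝ (Fin d))) : Prop :=
  σ.N 0 = (playerInit T S).N 0 ∧ σ.R 0 = (playerInit T S).R 0 ∧
  (∀ i < S.length, ∀ j < S.length, σ.R 14 i j = (playerState S T ys).1 i j) ∧
  ∀ i < S.length, σ.R 15 0 i = (playerState S T ys).2 i

theorem playerInv_init : PlayerInv d S T (playerInit T S) [] := by
  refine ⟨rfl, rfl, fun i _ j _ => ?_, fun i _ => ?_⟩ <;>
    simp [playerInit, playerState, mwState]

open RamProg in
-- The input arrays are never overwritten, so the parameters can be read anew each round; only the
-- weights and the distribution need to persist. Processing the new observation comes before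
-- playing, hence the output belongs to `ys ++ [y]`.
theorem runs_playerProg {D : DecompOracle a} {X : ℕ} (hX : 4 ≤ X)
    (hS : ∀ x ∈ S, x ∈ convexHull ℝ (Set.range a)) (hN : 1 ≤ S.length) (hNX : S.length ≤ X)
    (hTX : T ≤ X) (hcost : D.cost ≤ X) {σ : RamState}
    {ys : List (EuclideanSpace ℝ (Fin d))} (hσ : PlayerInv d S T σ ys)
    (y : EuclideanSpace ℝ (Fin d)) :
    Runs (playerEnv D) X 31 playerProg (σ.writeVec 1 y) (fun σ' => PlayerInv d S T σ' (ys ++ [y]) ∧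
      HoldsList σ' 1 2 2 (D.mixList (pt S) S.length (playerState S T (ys ++ [y])).2)) := by
  have hO := playerEnv_ok D
  obtain ⟨h0, hR0, hV, hp⟩ := hσ
  have hcost' : d + D.time + 1 ≤ X := hcost
  refine Runs.conseq hO (Q := fun σ' =>
    (∀ i < S.length, ∀ j < S.length, σ'.R 14 i j = (playerState S T (ys ++ [y])).1 i j) ∧
    (∀ i < S.length, σ'.R 15 0 i = (playerState S T (ys ++ [y])).2 i) ∧
    HoldsList σ' 1 2 2 (D.mixList (pt S) S.length (playerState S T (ys ++ [y])).2)) ?_ ?_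
  · refine Runs.block_cons (e := 30) hX hO (Runs.setN hX (Q := fun σ' =>
      σ'.N 10 0 0 = d ∧ σ'.N 0 = σ.N 0 ∧ σ'.R = (σ.writeVec 1 y).R) ⟨?_, ?_, rfl⟩) ?_
    · simp [RamState.writeVec_N, h0, playerInit]
    · rw [RamState.writeN_N_ne _ _ _ _ (by norm_num), RamState.writeVec_N]
    rintro σ₁ - ⟨hd₁, hN₁, hR₁⟩
    refine Runs.block_cons (e := 29) hX hO (Runs.setN hX (Q := fun σ' =>
      σ'.N 11 0 0 = T ∧ σ'.N 10 0 0 = d ∧ σ'.N 0 = σ.N 0 ∧ σ'.R = (σ.writeVec 1 y).R)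
      ⟨?_, ?_, ?_, hR₁⟩) ?_
    · simp [hN₁, h0, playerInit]
    · rw [RamState.writeN_N_ne _ _ _ _ (by norm_num), hd₁]
    · rw [RamState.writeN_N_ne _ _ _ _ (by norm_num), hN₁]
    rintro σ₂ - ⟨hT₂, hd₂, hN₂, hR₂⟩
    refine Runs.block_cons (e := 28) hX hO (Runs.setN hX (Q := fun σ' =>
      σ'.N 16 0 0 = S.length ∧ σ'.N 11 0 0 = T ∧ σ'.N 10 0 0 = d ∧ σ'.R = (σ.writeVec 1 y).R)
      ⟨?_, ?_, ?_, hR₂⟩) ?_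
    · simp [hN₂, h0, playerInit]
    · rw [RamState.writeN_N_ne _ _ _ _ (by norm_num), hT₂]
    · rw [RamState.writeN_N_ne _ _ _ _ (by norm_num), hd₂]
    rintro σ₃ - ⟨hn₃, hT₃, hd₃, hR₃⟩
    refine Runs.block_cons (e := 27) hX hO (Q₁ := fun σ' =>
      (∀ i < S.length, ∀ j < S.length, σ'.R 14 i j = (playerState S T (ys ++ [y])).1 i j) ∧
      (∀ i < S.length, σ'.R 15 0 i = (playerState S T (ys ++ [y])).2 i) ∧
      HoldsList σ' 1 2 2 (D.mixList (pt S) S.length (playerState S T (ys ++ [y])).2)) ?_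
      (fun σ _ h => Runs.block_nil hX h)
    rw [playerState_append]
    refine runs_roundProg (ℓ := soloLayout) (D := D) (x := pt S) (N := S.length) (T := T)
      (V := (playerState S T ys).1) (p := (playerState S T ys).2) (y := y)
      hX hO soloLayout_ok (by funext s; rfl) hcost hN hNX hTX (by omega) ?_ hn₃ hT₃ hd₃
      ?_ ?_ ?_ ?_
    · exact fun i hi => (D.length_le _ (hS _ (pt_mem hi))).trans (by omega)
    · intro i hi j
      rw [hR₃]
      simp only [soloLayout]
      rw [RamState.writeVec_R_ne _ _ (by norm_num), hR0]
      simp [playerInit, pt]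
    · intro j
      rw [hR₃]
      exact RamState.writeVec_R_self _ _ _ _
    · rw [hR₃]
      simp only [soloLayout]
      rw [RamState.writeVec_R_ne _ _ (by norm_num)]
      exact hV
    · rw [hR₃]
      simp only [soloLayout]
      rw [RamState.writeVec_R_ne _ _ (by norm_num)]
      exact hp
  · rintro σ' hF ⟨h1, h2, h3⟩
    refine ⟨⟨?_, ?_, h1, h2⟩, h3⟩
    · rw [hF.1 0 (by simp [playerProg, roundProg, mwProg, stepProg, utilProg, weightProg,
        rowSumProg, cesaroProg, chainProg, outProg, copyProg, soloLayout]), RamState.writeVec_N, h0]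
    · rw [hF.2 0 (by simp [playerProg, roundProg, mwProg, stepProg, utilProg, weightProg,
        rowSumProg, cesaroProg, chainProg, outProg, copyProg, soloLayout]),
        RamState.writeVec_R_ne _ _ (by norm_num), hR0]

theorem map_observation_eq (q : ℕ → MixedAction m) (t : ℕ) :
    (List.range (t + 1)).map (observation b q) =
      0 :: ((List.range t).map q).map (embed b) := by
  rw [List.range_succ_eq_map, List.map_cons, List.map_map, List.map_map]
  rfl

theorem runsWithin_playerProg {D : DecompOracle a} {X : ℕ} (hX : 4 ≤ X) (ha : ∀ i, ‖a i‖ ≤ 1)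
    (hb : ∀ j, ‖b j‖ ≤ 1) (hS : ∀ x ∈ S, x ∈ convexHull ℝ (Set.range a)) (hN : 1 ≤ S.length)
    (hNX : S.length ≤ X) (hT : 1 ≤ T) (hTX : T ≤ X) (hcost : D.cost ≤ X)
    {L : LearningAlgorithm n m} (hL : IsPlayer D S T b L) :
    RunsWithin RamProg.playerProg (playerEnv D) (playerInit T S) b T (X ^ 31) L := by
  intro q
  -- The successor is chosen for every memory, with a dummy value where the invariant fails, so that
  -- the trajectory can be defined by plain recursion.
  have hstep : ∀ t σ, ∃ σ', PlayerInv d S T σ ((List.range t).map (observation b q)) →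
      PlayerInv d S T σ' ((List.range (t + 1)).map (observation b q)) ∧
      ∃ c ≤ X ^ 31, RamExec (playerEnv D) RamProg.playerProg
        (σ.writeVec 1 (observation b q t)) σ' c ∧
        DisplaysAction σ' (L ((List.range t).map q)) := by
    intro t σ
    by_cases h : PlayerInv d S T σ ((List.range t).map (observation b q))
    · obtain ⟨σ', c, hx, hc, hi, hl⟩ :=
        runs_playerProg hX hS hN hNX hTX hcost h (observation b q t)
      refine ⟨σ', fun _ => ⟨by simpa [List.range_succ] using hi, c, hc, hx, ?_⟩⟩
      have e : (List.range t).map (observation b q) ++ [observation b q t] =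
          0 :: ((List.range t).map q).map (embed b) := by
        rw [← map_observation_eq, List.range_succ, List.map_append]; rfl
      rw [e] at hl
      refine hl.displaysAction (fun s hs => hS _ (pt_mem hs))
        (isProb_playerState ha hS hN hT ?_) (hL _)
      intro y hy
      obtain ⟨q', -, rfl⟩ := List.mem_map.1 hy
      exact norm_embed_le_one hb q'
    · exact ⟨σ, fun h' => absurd h' h⟩
  choose g hg using hstep
  set σ : ℕ → RamState := fun t => Nat.rec (playerInit T S) (fun t σ => g t σ) t with hσ
  have hinv : ∀ t, PlayerInv d S T (σ t) ((List.range t).map (observation b q)) := by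
    intro t
    induction t with
    | zero => exact playerInv_init
    | succ t ih => exact (hg t (σ t) ih).1
  exact ⟨σ, rfl, fun t _ => (hg t (σ t) (hinv t)).2⟩

end

/-! ### Correlated equilibria from play -/

/-- The bound on the swap regret per round. -/
noncomputable def regretRate (N T : ℕ) (δ : ℝ) : ℝ :=
  (N * (stepK N T * Real.log N) + 2 / stepK N T * T + 2 + δ * T) / T

/-- The regret bound holds against any fixed sequence of opponent actions; this presents the
adaptively generated histories as initial segments of such sequences. -/
theorem playHistory_eq {n m : ℕ} (L : LearningAlgorithm n m) (A : LearningAlgorithm m n) (t : ℕ) :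
    playHistory L A t = ((List.range t).map fun t => L (playHistory L A t).2,
      (List.range t).map fun t => A (playHistory L A t).1) := by
  induction t with
  | zero => rfl
  | succ t ih =>
    rw [List.range_succ, List.map_append, List.map_append, playHistory]
    simp only [List.map_cons, List.map_nil]
    have e1 := congrArg Prod.fst ih
    have e2 := congrArg Prod.snd ih
    simp only at e1 e2
    rw [← e1, ← e2]

theorem averagePlay_mem {n m : ℕ} (L : LearningAlgorithm n m) (A : LearningAlgorithm m n) {T : ℕ}
    (hT : 1 ≤ T) : averagePlay L A T ∈ stdSimplex ℝ (Fin n × Fin m) := by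
  refine ⟨fun e => mul_nonneg (by positivity) (sum_nonneg fun t _ =>
    mul_nonneg ((L _).2.1 _) ((A _).2.1 _)), ?_⟩
  simp only [averagePlay]
  rw [← mul_sum, sum_comm]
  have : ∀ t ∈ range T, ∑ e : Fin n × Fin m, (L (playHistory L A t).2 : Fin n → ℝ) e.1 *
      (A (playHistory L A t).1 : Fin m → ℝ) e.2 = 1 := by
    intro t _
    rw [Fintype.sum_prod_type]
    simp_rw [← mul_sum]
    rw [← sum_mul]
    have h1 := (L (playHistory L A t).2).2.2
    have h2 := (A (playHistory L A t).1).2.2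
    exact (congrArg₂ (· * ·) h1 h2).trans (one_mul 1)
  rw [sum_congr rfl this]
  have hT' : (T : ℝ) ≠ 0 := by positivity
  simp [hT']

/-- By bilinearity, `T` times the gain of a swap under the average distribution is the swap regret
against the observed embeddings. The Adversary's case has the roles exchanged and uses symmetry of
the inner product. -/
theorem isCorrelatedEq_averagePlay {d n m T : ℕ} (hT : 1 ≤ T) (G : StructuredGame d n m)
    {DL : DecompOracle G.v} {DA : DecompOracle G.w'} {S S' : List (EuclideanSpace ℝ (Fin d))}
    {δ δ' ε : ℝ} (hδ : 0 ≤ δ) (hδ' : 0 ≤ δ') (hS : IsHullNet G.v δ S) (hS' : IsHullNet G.w' δ' S')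
    (hN : 1 ≤ S.length) (hN' : 1 ≤ S'.length) {L : LearningAlgorithm n m}
    {A : LearningAlgorithm m n} (hL : IsPlayer DL S T G.w L) (hA : IsPlayer DA S' T G.v' A)
    (hε : regretRate S.length T δ ≤ ε) (hε' : regretRate S'.length T δ' ≤ ε) :
    IsCorrelatedEq G ε (averagePlay L A T) := by
  have hT' : (0 : ℝ) < T := by positivity
  refine ⟨averagePlay_mem L A hT, fun φ => ?_, fun φ => ?_⟩
  · have hreg := hL.swap_regret hδ G.norm_v G.norm_w hS hN hT
      (fun t => A (playHistory L A t).1) φ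
    refine le_trans ?_ ((div_le_div_of_nonneg_right hreg hT'.le).trans hε)
    rw [le_div_iff₀ hT']
    refine le_of_eq ?_
    simp only [averagePlay, sum_mul, mul_sum, mul_assoc]
    rw [sum_comm]
    refine sum_congr rfl fun t _ => ?_
    rw [Fintype.sum_prod_type]
    refine sum_congr rfl fun i _ => ?_
    have e := congrArg Prod.snd (playHistory_eq L A t)
    simp only at e
    rw [← e, embed, inner_sum, mul_sum]
    refine sum_congr rfl fun j _ => ?_
    rw [real_inner_smul_right, inner_sub_left]
    simp only [StructuredGame.uL]
    field_simp
  · have hreg := hA.swap_regret hδ' G.norm_w' G.norm_v' hS' hN' hT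
      (fun t => L (playHistory L A t).2) φ
    refine le_trans ?_ ((div_le_div_of_nonneg_right hreg hT'.le).trans hε')
    rw [le_div_iff₀ hT']
    refine le_of_eq ?_
    simp only [averagePlay, sum_mul, mul_sum, mul_assoc]
    rw [sum_comm]
    refine sum_congr rfl fun t _ => ?_
    rw [Fintype.sum_prod_type, sum_comm]
    refine sum_congr rfl fun j _ => ?_
    have e := congrArg Prod.fst (playHistory_eq L A t)
    simp only at e
    rw [← e, embed, inner_sum, mul_sum]
    refine sum_congr rfl fun i _ => ?_
    rw [real_inner_smul_right, inner_sub_left, real_inner_comm (G.v' i), real_inner_comm (G.v' i)]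
    simp only [StructuredGame.uA]
    field_simp

/-! ### The centralized program -/

/-- The memory holds the sparse joint distribution `l` in the output arrays. -/
def HoldsJoint (σ : RamState) (l : List (ℕ × ℕ × ℝ)) : Prop :=
  σ.N 1 0 0 = l.length ∧ ∀ r < l.length, l[r]? = some (σ.N 2 0 r, σ.N 6 0 r, σ.R 6 0 r)

theorem HoldsJoint.congr {σ σ' : RamState} {l : List (ℕ × ℕ × ℝ)} (h : HoldsJoint σ l)
    (h1 : σ'.N 1 = σ.N 1) (h2 : σ'.N 2 = σ.N 2) (h3 : σ'.N 6 = σ.N 6) (h4 : σ'.R 6 = σ.R 6) :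
    HoldsJoint σ' l := by
  rw [HoldsJoint, h1, h2, h3, h4]; exact h

theorem HoldsJoint.append {σ σ' : RamState} {l : List (ℕ × ℕ × ℝ)} {x x' : ℕ} {w : ℝ}
    (h : HoldsJoint σ l) (h1 : σ'.N 1 0 0 = l.length + 1)
    (h2 : ∀ r, σ'.N 2 0 r = if r = l.length then x else σ.N 2 0 r)
    (h3 : ∀ r, σ'.N 6 0 r = if r = l.length then x' else σ.N 6 0 r)
    (h4 : ∀ r, σ'.R 6 0 r = if r = l.length then w else σ.R 6 0 r) :
    HoldsJoint σ' (l ++ [(x, x', w)]) := by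
  refine ⟨by simp [h1], fun r hr => ?_⟩
  rw [h2, h3, h4]
  by_cases hrl : r = l.length
  · simp [hrl]
  · have hr' : r < l.length := by simp at hr; omega
    rw [List.getElem?_append_left hr', h.2 r hr']
    simp [hrl]

/-- The product of two sparse lists, scaled by `1 / T`. -/
noncomputable def prodList (T : ℕ) (l l' : List (ℕ × ℝ)) : List (ℕ × ℕ × ℝ) :=
  l.flatMap fun e => l'.map fun e' => (e.1, e'.1, e.2 * e'.2 / T)

theorem HoldsList.getElem {σ : RamState} {len act wt : ℕ} {l : List (ℕ × ℝ)}
    (h : HoldsList σ len act wt l) {r : ℕ} (hr : r < l.length) :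
    σ.N act 0 r = l[r].1 ∧ σ.R wt 0 r = l[r].2 := by
  have := h.2 r hr
  rw [List.getElem?_eq_getElem hr, Option.some_inj] at this
  rw [this]; exact ⟨rfl, rfl⟩

/-- The arrays used for the Learner by the centralized program. -/
def learnerLayout : PlayerLayout where
  n := 16
  S := 0
  V := 14
  p := 15
  y := 16
  o := 0
  len := 20
  act := 21
  wt := 20

/-- The arrays used for the Adversary by the centralized program. -/
def adversaryLayout : PlayerLayout where
  n := 17
  S := 1
  V := 17
  p := 18
  y := 19
  o := 1
  len := 22
  act := 23
  wt := 21

theorem learnerLayout_ok : learnerLayout.Ok := by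
  constructor <;> decide

theorem adversaryLayout_ok : adversaryLayout.Ok := by
  constructor <;> decide

namespace RamProg

/-- Computation of the embedding of a sparse list by look-ups. -/
def embedProg (len act wt y o : ℕ) : RamProg :=
  block [fillRow 12 (nvar 10) y (.const 0) (.cast (.const 0)),
    forN 12 (nvar len) (block [setN 5 (.const 0) (.const 0) (.get act (.const 0) (nvar 12)),
      call o,
      fillRow 13 (nvar 10) y (.const 0)
        (.add (rrow y (nvar 13)) (.mul (rrow wt (nvar 12)) (rrow 5 (nvar 13))))])]

/-- Append one entry to the output. -/
def joinEntryProg : RamProg :=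
  block [setN 2 (.const 0) (nvar 1) (.get 21 (.const 0) (nvar 12)),
    setN 6 (.const 0) (nvar 1) (.get 23 (.const 0) (nvar 13)),
    setR 6 (.const 0) (nvar 1)
      (.div (.mul (rrow 20 (nvar 12)) (rrow 21 (nvar 13))) (.cast (nvar 11))),
    setN 1 (.const 0) (.const 0) (.add (nvar 1) (.const 1))]

/-- Append the product of the two present mixed actions to the output. -/
def joinProg : RamProg := forN 12 (nvar 20) (forN 13 (nvar 22) joinEntryProg)

/-- Computation of the number of rounds. -/
def horizonProg : RamProg :=
  block [setN 11 (.const 0) (.const 0) (.const 1),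
    .while (.realLT (.mul (.cast (nvar 11)) (.mul (rrow 2 (.const 0)) (rrow 2 (.const 0))))
      (.mul (.cast (.const 1024)) (.mul (.cast (.add (nvar 16) (nvar 17)))
        (.mul (.cast (.add (nvar 16) (nvar 17))) (.cast (.add (nvar 16) (nvar 17)))))))
      (setN 11 (.const 0) (.const 0) (.add (nvar 11) (.const 1)))]

/-- One round of both players. -/
def jointRoundProg : RamProg :=
  block [roundProg learnerLayout, roundProg adversaryLayout, embedProg 20 21 20 19 4,
    embedProg 22 23 21 16 3, joinProg]

/-- The centralized program. -/
def centralProg : RamProg :=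
  block [setN 10 (.const 0) (.const 0) (.get 0 (.const 0) (.const 0)),
    setN 16 (.const 0) (.const 0) (.get 0 (.const 0) (.const 1)),
    setN 17 (.const 0) (.const 0) (.get 0 (.const 0) (.const 2)),
    horizonProg,
    forN 18 (nvar 11) jointRoundProg]

end RamProg

open RamProg in
theorem runs_joinEntryProg {O : OracleEnv} {X : ℕ} (hX : 4 ≤ X) (hO : O.Ok) {s : RamState}
    {T i j : ℕ} {e e' : ℕ × ℝ} {l : List (ℕ × ℕ × ℝ)} (hT : s.N 11 0 0 = T)
    (hi : s.N 12 0 0 = i) (hj : s.N 13 0 0 = j) (he : s.N 21 0 i = e.1 ∧ s.R 20 0 i = e.2)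
    (he' : s.N 23 0 j = e'.1 ∧ s.R 21 0 j = e'.2) (hl : HoldsJoint s l) :
    Runs O X 4 joinEntryProg s
      (fun σ => HoldsJoint σ (l ++ [(e.1, e'.1, e.2 * e'.2 / T)])) := by
  refine Runs.block_cons (e := 3) hX hO (Runs.setN hX
    (Q := fun σ => (∀ b, b ≠ 2 → σ.N b = s.N b) ∧
      (∀ r, σ.N 2 0 r = if r = l.length then e.1 else s.N 2 0 r) ∧ σ.R = s.R)
    ⟨fun b hb => RamState.writeN_N_ne _ _ _ _ hb, fun r => ?_, rfl⟩) ?_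
  · simp [hl.1, hi, he.1]
  rintro σ₁ - ⟨hN₁, h2₁, hR₁⟩
  refine Runs.block_cons (e := 2) hX hO (Runs.setN hX
    (Q := fun σ => (∀ b, b ≠ 2 → b ≠ 6 → σ.N b = s.N b) ∧
      (∀ r, σ.N 2 0 r = if r = l.length then e.1 else s.N 2 0 r) ∧
      (∀ r, σ.N 6 0 r = if r = l.length then e'.1 else s.N 6 0 r) ∧ σ.R = s.R)
    ⟨fun b hb hb' => ?_, fun r => ?_, fun r => ?_, hR₁⟩) ?_
  · rw [RamState.writeN_N_ne _ _ _ _ hb', hN₁ b hb]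
  · rw [RamState.writeN_N_ne _ _ _ _ (by norm_num), h2₁]
  · simp [hN₁, hl.1, hj, he'.1]
  rintro σ₂ - ⟨hN₂, h2₂, h6₂, hR₂⟩
  refine Runs.block_cons (e := 1) hX hO (Runs.setR hX
    (Q := fun σ => σ.N = σ₂.N ∧
      (∀ r, σ.R 6 0 r = if r = l.length then e.2 * e'.2 / T else s.R 6 0 r))
    ⟨rfl, fun r => ?_⟩) ?_
  · simp [hN₂, hR₂, hl.1, hi, hj, hT, he.2, he'.2]
  rintro σ₃ - ⟨hN₃, h6₃⟩
  refine Runs.block_cons (e := 0) hX hO (Runs.setN hX ?_) (Q₁ := fun σ => HoldsJoint σ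
    (l ++ [(e.1, e'.1, e.2 * e'.2 / T)])) (fun σ _ h => Runs.block_nil hX h)
  refine hl.append ?_ (fun r => ?_) (fun r => ?_) (fun r => h6₃ r)
  · simp [hN₃, hN₂, hl.1]
  · rw [RamState.writeN_N_ne _ _ _ _ (by norm_num), hN₃, h2₂]
  · rw [RamState.writeN_N_ne _ _ _ _ (by norm_num), hN₃, h6₂]

open RamProg in
theorem runs_joinProg {O : OracleEnv} {X : ℕ} (hX : 4 ≤ X) (hO : O.Ok) {s : RamState} {T : ℕ}
    {l l' : List (ℕ × ℝ)} {m : List (ℕ × ℕ × ℝ)} (hlX : l.length ≤ X) (hlX' : l'.length ≤ X)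
    (hT : s.N 11 0 0 = T) (hl : HoldsList s 20 21 20 l) (hl' : HoldsList s 22 23 21 l')
    (hm : HoldsJoint s m) :
    Runs O X 12 joinProg s (fun σ => HoldsJoint σ (m ++ prodList T l l')) := by
  refine Runs.forN (e := 8) hX hO hlX (by simp [joinEntryProg]) (fun i σ =>
    HoldsJoint σ (m ++ prodList T (l.take i) l')) ?_ ?_ ?_ ?_ ?_
  · intro σ _ hR hN
    simpa [prodList] using hm.congr (hN _ (by norm_num)) (hN _ (by norm_num)) (hN _ (by norm_num))
      (by rw [hR])
  · intro i σ hF _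
    simp only [NExpr.eval]
    rw [hF.1 20 (by simp [joinEntryProg]), hl.1]
  · intro i σ hi hF hc hI
    have hl₁ : HoldsList σ 20 21 20 l := hl.congr (hF.1 _ (by simp [joinEntryProg]))
      (hF.1 _ (by simp [joinEntryProg])) (hF.2 _ (by simp [joinEntryProg]))
    have hl₁' : HoldsList σ 22 23 21 l' := hl'.congr (hF.1 _ (by simp [joinEntryProg]))
      (hF.1 _ (by simp [joinEntryProg])) (hF.2 _ (by simp [joinEntryProg]))
    have hT₁ : σ.N 11 0 0 = T := by rw [hF.1 _ (by simp [joinEntryProg]), hT]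
    refine Runs.forN (e := 4) hX hO hlX' (by simp [joinEntryProg]) (fun j σ =>
      HoldsJoint σ (m ++ prodList T (l.take i) l' ++
        (l'.take j).map fun e' => (l[i].1, e'.1, l[i].2 * e'.2 / T))) ?_ ?_ ?_ ?_ ?_
    · intro σ _ hR hN
      simpa using hI.congr (hN _ (by norm_num)) (hN _ (by norm_num)) (hN _ (by norm_num))
        (by rw [hR])
    · intro j σ₁ hF₁ _
      simp only [NExpr.eval]
      rw [hF₁.1 22 (by simp [joinEntryProg]), hl₁'.1]
    · intro j σ₁ hj hF₁ hc₁ hI₁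
      have hl₂ : HoldsList σ₁ 20 21 20 l := hl₁.congr (hF₁.1 _ (by simp [joinEntryProg]))
        (hF₁.1 _ (by simp [joinEntryProg])) (hF₁.2 _ (by simp [joinEntryProg]))
      have hl₂' : HoldsList σ₁ 22 23 21 l' := hl₁'.congr (hF₁.1 _ (by simp [joinEntryProg]))
        (hF₁.1 _ (by simp [joinEntryProg])) (hF₁.2 _ (by simp [joinEntryProg]))
      rw [List.take_succ_eq_append_getElem hj, List.map_append, ← List.append_assoc]
      refine runs_joinEntryProg hX hO ?_ ?_ hc₁ (hl₂.getElem hi) (hl₂'.getElem hj) hI₁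
      · rw [hF₁.1 _ (by simp [joinEntryProg]), hT₁]
      · rw [hF₁.1 _ (by simp [joinEntryProg]), hc]
    · intro j σ x h
      exact h.congr (RamState.writeN_N_ne _ _ _ _ (by norm_num))
        (RamState.writeN_N_ne _ _ _ _ (by norm_num)) (RamState.writeN_N_ne _ _ _ _ (by norm_num)) rfl
    · intro σ₁ _ h
      rw [List.take_length, List.append_assoc] at h
      rw [List.take_succ_eq_append_getElem hi, prodList, List.flatMap_append,
        List.flatMap_singleton]
      exact h
  · intro i σ x h
    exact h.congr (RamState.writeN_N_ne _ _ _ _ (by norm_num))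
      (RamState.writeN_N_ne _ _ _ _ (by norm_num)) (RamState.writeN_N_ne _ _ _ _ (by norm_num)) rfl
  · intro σ _ h
    simpa using h

theorem lookup_N {d n : ℕ} (a : Fin n → EuclideanSpace ℝ (Fin d)) (s : RamState) :
    (lookup a s).N = s.N := by
  unfold lookup; split_ifs <;> rfl

theorem lookup_R_ne {d n : ℕ} (a : Fin n → EuclideanSpace ℝ (Fin d)) (s : RamState) {b : ℕ}
    (hb : b ≠ 5) : (lookup a s).R b = s.R b := by
  unfold lookup; split_ifs
  · exact RamState.writeVec_R_ne _ _ hb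
  · rfl

theorem lookup_R_self {d n : ℕ} (a : Fin n → EuclideanSpace ℝ (Fin d)) {s : RamState}
    (h : s.N 5 0 0 < n) (j : Fin d) : (lookup a s).R 5 0 j = a ⟨_, h⟩ j := by
  simp only [lookup, h, dite_true]
  exact RamState.writeVec_R_self _ _ _ _

/-- The embedding of an action, zero for a natural number that is no action. -/
noncomputable def extendZero {d n : ℕ} (a : Fin n → EuclideanSpace ℝ (Fin d)) (k : ℕ) :
    EuclideanSpace ℝ (Fin d) := if h : k < n then a ⟨k, h⟩ else 0

open RamProg in
-- The condition `hln` matters because a look-up of a number that is no action leaves the previous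
-- vector in place.
theorem runs_embedProg {O : OracleEnv} {X : ℕ} (hX : 4 ≤ X) (hO : O.Ok) {d n : ℕ}
    {a : Fin n → EuclideanSpace ℝ (Fin d)} {len act wt y o : ℕ} (hact : O.act o = lookup a)
    (hcost : O.cost o ≤ X) (hid : [len, act, 3, 4, 5, 10, 12, 13].Nodup ∧ [wt, y, 4, 5].Nodup)
    {s : RamState} {l : List (ℕ × ℝ)} (hdX : d ≤ X) (hlX : l.length ≤ X) (hd : s.N 10 0 0 = d)
    (hl : HoldsList s len act wt l) (hln : ∀ e ∈ l, e.1 < n) :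
    Runs O X 13 (embedProg len act wt y o) s
      (fun σ => ∀ j : Fin d, σ.R y 0 j = ((l.map fun e => e.2 • extendZero a e.1).sum :
        EuclideanSpace ℝ (Fin d)) j) := by
  obtain ⟨hid1, hid2⟩ := hid
  simp only [List.nodup_cons, List.mem_cons, not_or] at hid1 hid2
  refine Runs.block_cons (e := 12) hX hO (Runs.mono hX (Runs.fillRow hX hO (r := 0)
    (Q := fun σ => ∀ j : Fin d, σ.R y 0 j = 0) (fun _ => 0) hdX ?_ ?_ ?_ ?_) (by norm_num)) ?_
  · intro σ h
    simp only [NExpr.eval]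
    rw [h _ (by norm_num), hd]
  · intro σ _ _ _ _; rfl
  · intro j hj σ _ _ _ _; simp
  · intro σ _ _ h j
    simp [h]
  intro σ₀ hF₀ h₀
  have hl₀ : HoldsList σ₀ len act wt l := hl.congr (hF₀.1 _ (by simp; grind only))
    (hF₀.1 _ (by simp; grind only)) (hF₀.2 _ (by simp; grind only))
  refine Runs.block_cons (e := 11) hX hO (Runs.forN (e := 7) hX hO hlX (by simp) (fun r σ =>
    ∀ j : Fin d, σ.R y 0 j = (((l.take r).map fun e => e.2 • extendZero a e.1).sum :
        EuclideanSpace ℝ (Fin d)) j) ?_ ?_ ?_ (fun _ _ _ h => h) ?_)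
      (Q₁ := fun σ => ∀ j : Fin d, σ.R y 0 j = ((l.map fun e => e.2 • extendZero a e.1).sum :
        EuclideanSpace ℝ (Fin d)) j) (fun σ _ h => Runs.block_nil hX h)
  · intro σ _ hR _ j
    simp [hR, h₀]
  · intro r σ hF _
    simp only [NExpr.eval]
    rw [hF.1 _ (by simp; grind only), hl₀.1]
  · intro r σ hr hF hc hI
    have hl₁ : HoldsList σ len act wt l := hl₀.congr (hF.1 _ (by simp; grind only))
      (hF.1 _ (by simp; grind only)) (hF.2 _ (by simp; grind only))
    obtain ⟨ha, hw⟩ := hl₁.getElem hr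
    have hdσ : σ.N 10 0 0 = d := by
      rw [hF.1 _ (by simp), hF₀.1 _ (by simp), hd]
    have hlt : l[r].1 < n := hln _ (List.getElem_mem hr)
    refine Runs.block_cons (e := 6) hX hO (Runs.setN hX (Q := fun σ' => σ'.N 5 0 0 = l[r].1 ∧
      (∀ b, b ≠ 5 → σ'.N b = σ.N b) ∧ σ'.R = σ.R)
      ⟨by simp [hc, ha], fun b hb => RamState.writeN_N_ne _ _ _ _ hb, rfl⟩) ?_
    rintro σ₁ - ⟨h5, hN₁, hR₁⟩
    refine Runs.block_cons (e := 5) hX hO (Runs.mono hX (Runs.call (e := 0) hcost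
      (Q := fun σ' => σ'.N = σ₁.N ∧ (∀ b, b ≠ 5 → σ'.R b = σ.R b) ∧
        ∀ j : Fin d, σ'.R 5 0 j = extendZero a l[r].1 j) ?_) (by norm_num)) ?_
    · rw [hact]
      refine ⟨lookup_N _ _, fun b hb => by rw [lookup_R_ne _ _ hb, hR₁], fun j => ?_⟩
      have h5' : σ₁.N 5 0 0 < n := by rw [h5]; exact hlt
      rw [lookup_R_self a h5']
      simp only [extendZero, hlt, dite_true, h5]
    rintro σ₂ - ⟨hN₂, hR₂, h5₂⟩
    refine Runs.block_cons (e := 4) hX hO (Runs.fillRow hX hO (r := 0) (fun j =>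
      if h : j < d then (((l.take (r + 1)).map fun e => e.2 • extendZero a e.1).sum :
        EuclideanSpace ℝ (Fin d)) ⟨j, h⟩ else 0) hdX ?_ ?_ ?_ ?_)
      (Q₁ := fun σ => ∀ j : Fin d, σ.R y 0 j =
        (((l.take (r + 1)).map fun e => e.2 • extendZero a e.1).sum :
        EuclideanSpace ℝ (Fin d)) j) (fun σ _ h => Runs.block_nil hX h)
    · intro σ' h
      simp only [NExpr.eval]
      rw [h _ (by norm_num), hN₂, hN₁ _ (by norm_num), hdσ]
    · intro σ' _ _ _ _; rfl
    · intro j hj σ' h hj' hR hself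
      simp only [RExpr.eval, NExpr.eval, hj', hself, h 12 (by norm_num), hN₂,
        hN₁ 12 (by norm_num), hc]
      rw [hR _ (by grind only), hR _ (by grind only), hR₂ _ (by grind only), hR₂ _ (by grind only),
        hw, List.take_succ_eq_append_getElem hr, List.map_append, List.sum_append]
      have h1 := hI ⟨j, hj⟩
      have h2 := h5₂ ⟨j, hj⟩
      simp only at h1 h2
      simp [hj, h1, h2]
    · intro σ' _ _ h j
      simp [h]
  · intro σ _ h j
    simpa using h j

open RamProg in
-- The machine has no logarithm, so the search uses a cubic requirement on the numbers of points,
-- which dominates the one with logarithms. `T₀` only witnesses that the search ends.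
theorem runs_horizonProg {O : OracleEnv} {X : ℕ} (hX : 4 ≤ X) (hO : O.Ok) {s : RamState}
    {N N' T₀ : ℕ} {ε : ℝ} (hε : 0 < ε) (hT₀ : 1 ≤ T₀) (hTX : T₀ ≤ X) (hN : s.N 16 0 0 = N)
    (hN' : s.N 17 0 0 = N') (hεs : s.R 2 0 0 = ε)
    (hbig : 1024 * ((N : ℝ) + N') ^ 3 ≤ T₀ * ε ^ 2) :
    Runs O X 4 horizonProg s (fun σ => ∃ T, σ.N 11 0 0 = T ∧ 1 ≤ T ∧ T ≤ T₀ ∧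
      1024 * ((N : ℝ) + N') ^ 3 ≤ T * ε ^ 2) := by
  refine Runs.block_cons (e := 3) hX hO (Runs.setN hX (Q := fun σ => σ.N 11 0 0 = 1) (by simp)) ?_
  intro σ hF h1
  have hNσ : σ.N 16 0 0 = N := by rw [hF.1 _ (by simp), hN]
  have hNσ' : σ.N 17 0 0 = N' := by rw [hF.1 _ (by simp), hN']
  have hεσ : σ.R 2 0 0 = ε := by rw [hF.2 _ (by simp), hεs]
  refine Runs.block_cons (e := 2) hX hO (Runs.while_of (e := 0) hX hTX
    (fun j σ => σ.N 11 0 0 = 1 + j ∧ 1 + j ≤ T₀ ∧ σ.N 16 0 0 = N ∧ σ.N 17 0 0 = N' ∧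
      σ.R 2 0 0 = ε) ⟨h1, by omega, hNσ, hNσ', hεσ⟩ ?_) ?_
  · rintro j σ' ⟨h11, hle, h16, h17, h2⟩ hb
    simp only [RamTest.Holds, RExpr.eval, NExpr.eval, h11, h16, h17, h2] at hb
    push_cast at hb
    have hlt : ((1 + j : ℕ) : ℝ) < T₀ := by
      refine lt_of_mul_lt_mul_right (a := ε ^ 2) ?_ (by positivity)
      push_cast
      nlinarith
    have hlt' : 1 + j < T₀ := by exact_mod_cast hlt
    refine ⟨by omega, Runs.setN hX ⟨by simp [h11, add_assoc], by omega, ?_, ?_, h2⟩⟩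
    · rw [RamState.writeN_N_ne _ _ _ _ (by norm_num), h16]
    · rw [RamState.writeN_N_ne _ _ _ _ (by norm_num), h17]
  · rintro σ' - ⟨j, ⟨h11, hle, h16, h17, h2⟩, hb⟩
    refine Runs.block_nil hX ⟨1 + j, h11, by omega, hle, ?_⟩
    simp only [RamTest.Holds, RExpr.eval, NExpr.eval, h11, h16, h17, h2] at hb
    push_cast at hb ⊢
    nlinarith

attribute [simp] RamProg.roundProg RamProg.mwProg RamProg.stepProg RamProg.utilProg
  RamProg.weightProg RamProg.rowSumProg RamProg.cesaroProg RamProg.chainProg RamProg.outProg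
  RamProg.copyProg RamProg.embedProg RamProg.joinProg RamProg.joinEntryProg

/-! ### Simulation of both players in one memory -/

section

variable {d n m : ℕ} {G : StructuredGame d n m} {DL : DecompOracle G.v} {DA : DecompOracle G.w'}
  {S S' : List (EuclideanSpace ℝ (Fin d))} {T : ℕ}

theorem centralEnv_ok : (centralEnv G DL DA).Ok := by
  intro o s
  simp only [centralEnv]
  split_ifs
  · exact ⟨fun b h3 h4 => DL.act_N_ne s h3 h4, fun b h4 _ => DL.act_R_ne s h4⟩
  · exact ⟨fun b h3 h4 => DA.act_N_ne s h3 h4, fun b h4 _ => DA.act_R_ne s h4⟩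
  · exact ⟨fun b _ _ => by rw [lookup_N], fun b _ h5 => lookup_R_ne _ _ h5⟩
  · exact ⟨fun b _ _ => by rw [lookup_N], fun b _ h5 => lookup_R_ne _ _ h5⟩
  · exact ⟨fun b _ _ => by rw [lookup_N], fun b _ h5 => lookup_R_ne _ _ h5⟩
  · exact ⟨fun b _ _ => by rw [lookup_N], fun b _ h5 => lookup_R_ne _ _ h5⟩
  · exact ⟨fun _ _ _ => rfl, fun _ _ _ => rfl⟩

/-- The fixed data of the centralized program. -/
def CentralData (T : ℕ) (S S' : List (EuclideanSpace ℝ (Fin d))) (σ : RamState) : Prop :=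
  σ.N 10 0 0 = d ∧ σ.N 11 0 0 = T ∧ σ.N 16 0 0 = S.length ∧ σ.N 17 0 0 = S'.length ∧
  (∀ i < S.length, ∀ j : Fin d, σ.R 0 i j = pt S i j) ∧
  (∀ i < S'.length, ∀ j : Fin d, σ.R 1 i j = pt S' i j)

theorem CentralData.frame {p : RamProg} {σ σ' : RamState} (h : CentralData T S S' σ)
    (hF : Frame p σ σ') (hN : ∀ b ∈ [10, 11, 16, 17], ¬ p.modN b) (hR : ∀ b ∈ [0, 1], ¬ p.modR b) :
    CentralData T S S' σ' := by
  simp only [List.mem_cons, List.not_mem_nil, or_false, forall_eq_or_imp, forall_eq] at hN hR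
  rw [CentralData, hF.1 _ hN.1, hF.1 _ hN.2.1, hF.1 _ hN.2.2.1, hF.1 _ hN.2.2.2, hF.2 _ hR.1,
    hF.2 _ hR.2]
  exact h

/-- The memory of one of the players in the centralized program. -/
def PlayerMem (ℓ : PlayerLayout) (S : List (EuclideanSpace ℝ (Fin d))) (T : ℕ)
    (ys : List (EuclideanSpace ℝ (Fin d))) (σ : RamState) : Prop :=
  (∀ i < S.length, ∀ j < S.length, σ.R ℓ.V i j = (playerState S T ys).1 i j) ∧
  ∀ i < S.length, σ.R ℓ.p 0 i = (playerState S T ys).2 i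

theorem PlayerMem.congr {ℓ : PlayerLayout} {ys : List (EuclideanSpace ℝ (Fin d))}
    {σ σ' : RamState} (h : PlayerMem ℓ S T ys σ) (h1 : σ'.R ℓ.V = σ.R ℓ.V)
    (h2 : σ'.R ℓ.p = σ.R ℓ.p) : PlayerMem ℓ S T ys σ' := by
  rw [PlayerMem, h1, h2]; exact h

/-- The memory displays the vector `y`. -/
def HoldsVec (σ : RamState) (A : ℕ) (y : EuclideanSpace ℝ (Fin d)) : Prop :=
  ∀ j : Fin d, σ.R A 0 j = y j

theorem HoldsVec.congr {σ σ' : RamState} {A : ℕ} {y : EuclideanSpace ℝ (Fin d)}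
    (h : HoldsVec σ A y) (h' : σ'.R A = σ.R A) : HoldsVec σ' A y := by
  rw [HoldsVec, h']; exact h

/-- Moves are simultaneous: both players act on the old contents of real arrays 16 and 19, and the
new embeddings are written only afterwards. The hypotheses `hp` and `hp'` ensure that the lists name
genuine actions, as the look-ups require. -/
theorem runs_jointRoundProg {X : ℕ} (hX : 4 ≤ X) (hTX : T ≤ X)
    (hS : ∀ x ∈ S, x ∈ convexHull ℝ (Set.range G.v))
    (hS' : ∀ x ∈ S', x ∈ convexHull ℝ (Set.range G.w'))
    (hN : 1 ≤ S.length) (hN' : 1 ≤ S'.length) (hNX : S.length ≤ X) (hNX' : S'.length ≤ X)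
    (hcost : DL.cost ≤ X) (hcost' : DA.cost ≤ X) (hlen : S.length * DL.time ≤ X)
    (hlen' : S'.length * DA.time ≤ X) {σ : RamState} (hσ : CentralData T S S' σ)
    {ys ys' : List (EuclideanSpace ℝ (Fin d))} {y y' : EuclideanSpace ℝ (Fin d)}
    {J : List (ℕ × ℕ × ℝ)} (hL : PlayerMem learnerLayout S T ys σ)
    (hA : PlayerMem adversaryLayout S' T ys' σ) (hy : HoldsVec σ 16 y) (hy' : HoldsVec σ 19 y')
    (hJ : HoldsJoint σ J)
    (hp : IsProb S.length (playerState S T (ys ++ [y])).2)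
    (hp' : IsProb S'.length (playerState S' T (ys' ++ [y'])).2) :
    Runs (centralEnv G DL DA) X 29 RamProg.jointRoundProg σ (fun σ' =>
      PlayerMem learnerLayout S T (ys ++ [y]) σ' ∧ PlayerMem adversaryLayout S' T (ys' ++ [y']) σ' ∧
      HoldsVec σ' 16 (∑ j, DA.mixWeight (pt S') S'.length (playerState S' T (ys' ++ [y'])).2 j •
        G.w j) ∧
      HoldsVec σ' 19 (∑ i, DL.mixWeight (pt S) S.length (playerState S T (ys ++ [y])).2 i •
        G.v' i) ∧
      HoldsJoint σ' (J ++ prodList T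
        (DL.mixList (pt S) S.length (playerState S T (ys ++ [y])).2)
        (DA.mixList (pt S') S'.length (playerState S' T (ys' ++ [y'])).2))) := by
  have hO := centralEnv_ok (G := G) (DL := DL) (DA := DA)
  have hdX' : d + 1 ≤ X := by
    have : d + DL.time + 1 ≤ X := hcost
    omega
  have hdX : d ≤ X := by omega
  have hdec : ∀ i < S.length, (DL.dec (pt S i)).length ≤ DL.time := fun i hi =>
    DL.length_le _ (hS _ (pt_mem hi))
  have hdec' : ∀ i < S'.length, (DA.dec (pt S' i)).length ≤ DA.time := fun i hi =>
    DA.length_le _ (hS' _ (pt_mem hi))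
  have htime : DL.time ≤ X := by
    have : d + DL.time + 1 ≤ X := hcost
    omega
  have htime' : DA.time ≤ X := by
    have : d + DA.time + 1 ≤ X := hcost'
    omega
  set st := playerState S T (ys ++ [y]) with hst
  set st' := playerState S' T (ys' ++ [y']) with hst'
  set l := DL.mixList (pt S) S.length st.2 with hl
  set l' := DA.mixList (pt S') S'.length st'.2 with hl'
  have hlX : l.length ≤ X := (DL.length_mixList_le hdec).trans hlen
  have hlX' : l'.length ≤ X := (DA.length_mixList_le hdec').trans hlen'
  have hln : ∀ e ∈ l, e.1 < n := fun e he =>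
    (DL.mem_mixList (fun s hs => hS _ (pt_mem hs)) hp he).1
  have hln' : ∀ e ∈ l', e.1 < m := fun e he =>
    (DA.mem_mixList (fun s hs => hS' _ (pt_mem hs)) hp' he).1
  have hext : ∀ {k : ℕ} (f : Fin k → EuclideanSpace ℝ (Fin d)) (i : Fin k),
      extendZero f (i : ℕ) = f i := by
    intro k f i; simp [extendZero]
  have hemb : (l.map fun e => e.2 • extendZero G.v' e.1).sum =
      ∑ i, DL.mixWeight (pt S) S.length st.2 i • G.v' i := by
    rw [hl, DL.sum_mixList_smul]; simp_rw [hext]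
  have hemb' : (l'.map fun e => e.2 • extendZero G.w e.1).sum =
      ∑ j, DA.mixWeight (pt S') S'.length st'.2 j • G.w j := by
    rw [hl', DA.sum_mixList_smul]; simp_rw [hext]
  refine Runs.block_cons (e := 28) hX hO (Runs.mono hX (runs_roundProg (ℓ := learnerLayout)
    (D := DL) (x := pt S) (N := S.length) (T := T) (V := (playerState S T ys).1)
    (p := (playerState S T ys).2) (y := y) hX hO learnerLayout_ok (by funext s; rfl) hcost hN hNX
    hTX hdX (fun i hi => (hdec i hi).trans htime) hσ.2.2.1 hσ.2.1 hσ.1 hσ.2.2.2.2.1 hy hL.1 hL.2)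
    (by norm_num)) ?_
  rw [← playerState_append, ← hst, ← hl]
  rintro σ₁ hF₁ ⟨hV₁, hp₁, hl₁⟩
  have hσ₁ := hσ.frame hF₁ (by simp [learnerLayout]) (by simp [learnerLayout])
  have hL₁ : PlayerMem learnerLayout S T (ys ++ [y]) σ₁ := ⟨hV₁, hp₁⟩
  replace hA := hA.congr (hF₁.2 _ (by simp [learnerLayout, adversaryLayout]))
    (hF₁.2 _ (by simp [learnerLayout, adversaryLayout]))
  replace hy' := hy'.congr (hF₁.2 _ (by simp [learnerLayout]))
  replace hJ := hJ.congr (hF₁.1 _ (by simp [learnerLayout])) (hF₁.1 _ (by simp [learnerLayout]))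
    (hF₁.1 _ (by simp [learnerLayout])) (hF₁.2 _ (by simp [learnerLayout]))
  refine Runs.block_cons (e := 27) hX hO (runs_roundProg (ℓ := adversaryLayout)
    (D := DA) (x := pt S') (N := S'.length) (T := T) (V := (playerState S' T ys').1)
    (p := (playerState S' T ys').2) (y := y') hX hO adversaryLayout_ok (by funext s; rfl) hcost'
    hN' hNX' hTX hdX (fun i hi => (hdec' i hi).trans htime') hσ₁.2.2.2.1 hσ₁.2.1 hσ₁.1
    hσ₁.2.2.2.2.2 hy' hA.1 hA.2) ?_
  rw [← playerState_append, ← hst', ← hl']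
  rintro σ₂ hF₂ ⟨hV₂, hp₂, hl₂'⟩
  have hσ₂ := hσ₁.frame hF₂ (by simp [adversaryLayout]) (by simp [adversaryLayout])
  have hA₂ : PlayerMem adversaryLayout S' T (ys' ++ [y']) σ₂ := ⟨hV₂, hp₂⟩
  have hL₂ := hL₁.congr (hF₂.2 _ (by simp [learnerLayout, adversaryLayout]))
    (hF₂.2 _ (by simp [learnerLayout, adversaryLayout]))
  replace hJ := hJ.congr (hF₂.1 _ (by simp [adversaryLayout]))
    (hF₂.1 _ (by simp [adversaryLayout])) (hF₂.1 _ (by simp [adversaryLayout]))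
    (hF₂.2 _ (by simp [adversaryLayout]))
  have hl₂ : HoldsList σ₂ 20 21 20 l := hl₁.congr (hF₂.1 _ (by simp [adversaryLayout, learnerLayout]))
    (hF₂.1 _ (by simp [adversaryLayout, learnerLayout]))
    (hF₂.2 _ (by simp [adversaryLayout, learnerLayout]))
  replace hl₂' : HoldsList σ₂ 22 23 21 l' := hl₂'
  refine Runs.block_cons (e := 26) hX hO (Runs.mono hX (runs_embedProg (a := G.v') hX hO
    (by funext s; rfl) (by simpa [centralEnv] using hdX') (by decide) hdX hlX hσ₂.1 hl₂ hln) (by norm_num)) ?_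
  intro σ₃ hF₃ hv₃
  rw [hemb] at hv₃
  have hσ₃ := hσ₂.frame hF₃ (by simp) (by simp)
  have hA₃ := hA₂.congr (hF₃.2 _ (by simp [adversaryLayout])) (hF₃.2 _ (by simp [adversaryLayout]))
  have hL₃ := hL₂.congr (hF₃.2 _ (by simp [learnerLayout])) (hF₃.2 _ (by simp [learnerLayout]))
  replace hJ := hJ.congr (hF₃.1 _ (by simp)) (hF₃.1 _ (by simp)) (hF₃.1 _ (by simp))
    (hF₃.2 _ (by simp))
  have hl₃ := hl₂.congr (hF₃.1 _ (by simp)) (hF₃.1 _ (by simp)) (hF₃.2 _ (by simp))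
  have hl₃' := hl₂'.congr (hF₃.1 _ (by simp)) (hF₃.1 _ (by simp)) (hF₃.2 _ (by simp))
  refine Runs.block_cons (e := 25) hX hO (Runs.mono hX (runs_embedProg (a := G.w) hX hO
    (by funext s; rfl) (by simpa [centralEnv] using hdX') (by decide) hdX hlX' hσ₃.1 hl₃' hln') (by norm_num)) ?_
  intro σ₄ hF₄ hv₄
  rw [hemb'] at hv₄
  have hσ₄ := hσ₃.frame hF₄ (by simp) (by simp)
  have hA₄ := hA₃.congr (hF₄.2 _ (by simp [adversaryLayout])) (hF₄.2 _ (by simp [adversaryLayout]))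
  have hL₄ := hL₃.congr (hF₄.2 _ (by simp [learnerLayout])) (hF₄.2 _ (by simp [learnerLayout]))
  replace hJ := hJ.congr (hF₄.1 _ (by simp)) (hF₄.1 _ (by simp)) (hF₄.1 _ (by simp))
    (hF₄.2 _ (by simp))
  have hl₄ := hl₃.congr (hF₄.1 _ (by simp)) (hF₄.1 _ (by simp)) (hF₄.2 _ (by simp))
  have hl₄' := hl₃'.congr (hF₄.1 _ (by simp)) (hF₄.1 _ (by simp)) (hF₄.2 _ (by simp))
  have hv₄' : HoldsVec σ₄ 19 (∑ i, DL.mixWeight (pt S) S.length st.2 i • G.v' i) :=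
    HoldsVec.congr hv₃ (hF₄.2 _ (by simp))
  refine Runs.block_cons (e := 24) hX hO (Runs.mono hX (Runs.conseq hO (runs_joinProg hX hO hlX
    hlX' hσ₄.2.1 hl₄ hl₄' hJ) ?_) (by norm_num)) (fun σ _ h => Runs.block_nil hX h)
  intro σ₅ hF₅ hJ₅
  exact ⟨hL₄.congr (hF₅.2 _ (by simp [learnerLayout])) (hF₅.2 _ (by simp [learnerLayout])),
    hA₄.congr (hF₅.2 _ (by simp [adversaryLayout])) (hF₅.2 _ (by simp [adversaryLayout])),
    HoldsVec.congr hv₄ (hF₅.2 _ (by simp)), hv₄'.congr (hF₅.2 _ (by simp)), hJ₅⟩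

/-- The output of the centralized program after `T` rounds of a joint play. -/
noncomputable def jointList (DL : DecompOracle G.v) (DA : DecompOracle G.w')
    (S S' : List (EuclideanSpace ℝ (Fin d))) (T : ℕ) (y y' : ℕ → EuclideanSpace ℝ (Fin d))
    (t : ℕ) : List (ℕ × ℕ × ℝ) :=
  (List.range t).flatMap fun t => prodList T
    (DL.mixList (pt S) S.length (playerState S T ((List.range (t + 1)).map y)).2)
    (DA.mixList (pt S') S'.length (playerState S' T ((List.range (t + 1)).map y')).2)

theorem sum_map_flatMap_range {α M : Type*} [AddCommMonoid M] (f : ℕ → List α) (g : α → M)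
    (t : ℕ) : (((List.range t).flatMap f).map g).sum = ∑ k ∈ range t, ((f k).map g).sum := by
  induction t with
  | zero => simp
  | succ t ih => simp [List.range_succ, List.flatMap_append, ih, sum_range_succ]

theorem sum_prodList_ite (l l' : List (ℕ × ℝ)) (i j : ℕ) :
    ((prodList T l l').map fun e => if e.1 = i ∧ e.2.1 = j then e.2.2 else 0).sum =
      1 / T * ((l.map fun e => if e.1 = i then e.2 else 0).sum *
        (l'.map fun e => if e.1 = j then e.2 else 0).sum) := by
  have h1 : ∀ e : ℕ × ℝ, (l'.map fun e' => if e.1 = i ∧ e'.1 = j then e.2 * e'.2 / T else 0).sum =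
      1 / T * ((if e.1 = i then e.2 else 0) * (l'.map fun e => if e.1 = j then e.2 else 0).sum) := by
    intro e
    induction l' with
    | nil => simp
    | cons e' l' ih =>
      simp only [List.map_cons, List.sum_cons, ih]
      by_cases h : e.1 = i <;> by_cases h' : e'.1 = j <;> simp [h, h']
      ring
  induction l with
  | nil => simp [prodList]
  | cons e l ih =>
    have h2 : prodList T (e :: l) l' = l'.map (fun e' => (e.1, e'.1, e.2 * e'.2 / T)) ++
        prodList T l l' := rfl
    rw [h2, List.map_append, List.sum_append, ih, List.map_map, List.map_cons, List.sum_cons,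
      add_mul, mul_add, ← h1 e]
    rfl

theorem HoldsJoint.displaysJoint {σ : RamState} {l : List (ℕ × ℕ × ℝ)} (h : HoldsJoint σ l)
    (hl : ∀ e ∈ l, e.1 < n ∧ e.2.1 < m ∧ 0 ≤ e.2.2) {μ : Fin n × Fin m → ℝ}
    (hμ : ∀ i : Fin n, ∀ j : Fin m, μ (i, j) =
      (l.map fun e => if e.1 = (i : ℕ) ∧ e.2.1 = (j : ℕ) then e.2.2 else 0).sum) :
    DisplaysJoint σ μ := by
  refine ⟨fun r hr => ?_, fun e => ?_⟩
  · rw [h.1] at hr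
    exact hl _ (List.mem_of_getElem? (h.2 r hr))
  · rw [show e = (e.1, e.2) from rfl, hμ, h.1]
    symm
    refine sum_range_eq_sum_map l _ _ fun r hr => ?_
    have := h.2 r hr
    rw [List.getElem?_eq_getElem hr, Option.some_inj] at this
    rw [this]

open RamProg in
-- The horizon is known only at run time, so the learning algorithms whose play is reproduced are
-- part of the conclusion.
theorem runs_centralProg {X T₀ : ℕ} {ε : ℝ} (hX : 4 ≤ X) (hε : 0 < ε) (hT₀ : 1 ≤ T₀)
    (hTX : T₀ ≤ X) (hS : ∀ x ∈ S, x ∈ convexHull ℝ (Set.range G.v))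
    (hS' : ∀ x ∈ S', x ∈ convexHull ℝ (Set.range G.w'))
    (hN : 1 ≤ S.length) (hN' : 1 ≤ S'.length) (hNX : S.length ≤ X) (hNX' : S'.length ≤ X)
    (hcost : DL.cost ≤ X) (hcost' : DA.cost ≤ X) (hlen : S.length * DL.time ≤ X)
    (hlen' : S'.length * DA.time ≤ X)
    (hbig : 1024 * ((S.length : ℝ) + S'.length) ^ 3 ≤ T₀ * ε ^ 2) :
    Runs (centralEnv G DL DA) X 38 centralProg (centralInit ε S S') (fun σ =>
      ∃ (T : ℕ) (L : LearningAlgorithm n m) (A : LearningAlgorithm m n), 1 ≤ T ∧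
        1024 * ((S.length : ℝ) + S'.length) ^ 3 ≤ T * ε ^ 2 ∧ IsPlayer DL S T G.w L ∧
        IsPlayer DA S' T G.v' A ∧ DisplaysJoint σ (averagePlay L A T)) := by
  have hO := centralEnv_ok (G := G) (DL := DL) (DA := DA)
  set s := centralInit ε S S' with hs
  refine Runs.block_cons (e := 37) hX hO (Runs.setN hX (Q := fun σ => σ.N 10 0 0 = d ∧
    σ.N 0 = s.N 0 ∧ σ.N 1 = s.N 1 ∧ σ.R = s.R) ⟨?_, ?_, ?_, rfl⟩) ?_
  · simp [hs, centralInit]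
  · exact RamState.writeN_N_ne _ _ _ _ (by norm_num)
  · exact RamState.writeN_N_ne _ _ _ _ (by norm_num)
  rintro σ₁ - ⟨hd₁, h0₁, h1₁, hR₁⟩
  refine Runs.block_cons (e := 36) hX hO (Runs.setN hX (Q := fun σ => σ.N 16 0 0 = S.length ∧
    σ.N 10 0 0 = d ∧ σ.N 0 = s.N 0 ∧ σ.N 1 = s.N 1 ∧ σ.R = s.R) ⟨?_, ?_, ?_, ?_, hR₁⟩) ?_
  · simp [h0₁, hs, centralInit]
  · rw [RamState.writeN_N_ne _ _ _ _ (by norm_num), hd₁]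
  · rw [RamState.writeN_N_ne _ _ _ _ (by norm_num), h0₁]
  · rw [RamState.writeN_N_ne _ _ _ _ (by norm_num), h1₁]
  rintro σ₂ - ⟨hn₂, hd₂, h0₂, h1₂, hR₂⟩
  refine Runs.block_cons (e := 35) hX hO (Runs.setN hX (Q := fun σ => σ.N 17 0 0 = S'.length ∧
    σ.N 16 0 0 = S.length ∧ σ.N 10 0 0 = d ∧ σ.N 1 = s.N 1 ∧ σ.R = s.R)
    ⟨?_, ?_, ?_, ?_, hR₂⟩) ?_
  · simp [h0₂, hs, centralInit]
  · rw [RamState.writeN_N_ne _ _ _ _ (by norm_num), hn₂]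
  · rw [RamState.writeN_N_ne _ _ _ _ (by norm_num), hd₂]
  · rw [RamState.writeN_N_ne _ _ _ _ (by norm_num), h1₂]
  rintro σ₃ - ⟨hn₃', hn₃, hd₃, h1₃, hR₃⟩
  refine Runs.block_cons (e := 34) hX hO (Runs.mono hX (runs_horizonProg hX hO hε hT₀ hTX hn₃ hn₃'
    (by simp [hR₃, hs, centralInit]) hbig) (by norm_num)) ?_
  rintro σ₄ hF₄ ⟨T, hT₄, hT1, hTT₀, hTbig⟩
  have hN₄ : ∀ b, b ≠ 11 → σ₄.N b = σ₃.N b := fun b hb => hF₄.1 b (by simp [horizonProg, hb])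
  have hR₄ : σ₄.R = s.R := by
    rw [← hR₃]; exact funext fun b => hF₄.2 b (by simp [horizonProg])
  obtain ⟨L, hL⟩ := exists_isPlayer (T := T) DL G.norm_v G.norm_w hS hN hT1
  obtain ⟨A, hA⟩ := exists_isPlayer (T := T) DA G.norm_w' G.norm_v' hS' hN' hT1
  -- The abstract play is fixed first; the loop invariant then says that memory agrees with its
  -- prefix of length `t`.
  set q : ℕ → MixedAction m := fun t => A (playHistory L A t).1 with hq
  set q' : ℕ → MixedAction n := fun t => L (playHistory L A t).2 with hq'
  set y := observation G.w q with hy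
  set y' := observation G.v' q' with hy'
  have hdata₄ : CentralData T S S' σ₄ := by
    refine ⟨by rw [hN₄ _ (by norm_num), hd₃], hT₄, by rw [hN₄ _ (by norm_num), hn₃],
      by rw [hN₄ _ (by norm_num), hn₃'], fun i _ j => ?_, fun i _ j => ?_⟩
    · simp [hR₄, hs, centralInit, pt]
    · simp [hR₄, hs, centralInit, pt]
  have hprob : ∀ t, IsProb S.length (playerState S T ((List.range (t + 1)).map y)).2 := by
    intro t
    rw [hy, map_observation_eq]
    refine isProb_playerState G.norm_v hS hN hT1 fun z hz => ?_
    obtain ⟨p, -, rfl⟩ := List.mem_map.1 hz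
    exact norm_embed_le_one G.norm_w p
  have hprob' : ∀ t, IsProb S'.length (playerState S' T ((List.range (t + 1)).map y')).2 := by
    intro t
    rw [hy', map_observation_eq]
    refine isProb_playerState G.norm_w' hS' hN' hT1 fun z hz => ?_
    obtain ⟨p, -, rfl⟩ := List.mem_map.1 hz
    exact norm_embed_le_one G.norm_v' p
  have hLt : ∀ t, (q' t : Fin n → ℝ) =
      DL.mixWeight (pt S) S.length (playerState S T ((List.range (t + 1)).map y)).2 := by
    intro t
    have e := congrArg Prod.snd (playHistory_eq L A t)
    simp only at e
    rw [hq', hL, e, hy, map_observation_eq]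
  have hAt : ∀ t, (q t : Fin m → ℝ) =
      DA.mixWeight (pt S') S'.length (playerState S' T ((List.range (t + 1)).map y')).2 := by
    intro t
    have e := congrArg Prod.fst (playHistory_eq L A t)
    simp only at e
    rw [hq, hA, e, hy', map_observation_eq]
  refine Runs.block_cons (e := 33) hX hO (Runs.forN (e := 29) hX hO (hTT₀.trans hTX)
    (by simp [jointRoundProg, learnerLayout, adversaryLayout]) (fun t σ =>
      PlayerMem learnerLayout S T ((List.range t).map y) σ ∧
      PlayerMem adversaryLayout S' T ((List.range t).map y') σ ∧
      HoldsVec σ 16 (y t) ∧ HoldsVec σ 19 (y' t) ∧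
      HoldsJoint σ (jointList DL DA S S' T y y' t)) ?_ ?_ ?_ ?_ ?_)
    (fun σ _ h => Runs.block_nil hX h)
  · intro σ hF hRσ hNσ
    refine ⟨⟨fun i _ j _ => ?_, fun i _ => ?_⟩, ⟨fun i _ j _ => ?_, fun i _ => ?_⟩, fun j => ?_,
      fun j => ?_, ?_, fun r hr => ?_⟩
    · simp [hRσ, hR₄, hs, centralInit, learnerLayout, playerState, mwState]
    · simp [hRσ, hR₄, hs, centralInit, learnerLayout, playerState, mwState]
    · simp [hRσ, hR₄, hs, centralInit, adversaryLayout, playerState, mwState]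
    · simp [hRσ, hR₄, hs, centralInit, adversaryLayout, playerState, mwState]
    · simp [hRσ, hR₄, hs, centralInit, hy, observation]
    · simp [hRσ, hR₄, hs, centralInit, hy', observation]
    · rw [hNσ _ (by norm_num), hN₄ _ (by norm_num), h1₃]
      simp [jointList, hs, centralInit]
    · simp [jointList] at hr
  · intro t σ hF _
    simp only [NExpr.eval]
    rw [hF.1 _ (by simp [jointRoundProg, learnerLayout, adversaryLayout]), hT₄]
  · rintro t σ - hF - ⟨iL, iA, iy, iy', iJ⟩
    have hdata := hdata₄.frame hF (by simp [jointRoundProg, learnerLayout, adversaryLayout])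
      (by simp [jointRoundProg, learnerLayout, adversaryLayout])
    have e : (List.range (t + 1)).map y = (List.range t).map y ++ [y t] := by
      simp [List.range_succ]
    have e' : (List.range (t + 1)).map y' = (List.range t).map y' ++ [y' t] := by
      simp [List.range_succ]
    refine Runs.conseq hO (runs_jointRoundProg hX (hTT₀.trans hTX) hS hS' hN hN' hNX hNX' hcost
      hcost' hlen hlen' hdata iL iA iy iy' iJ (e ▸ hprob t) (e' ▸ hprob' t)) ?_
    rw [← e, ← e', ← hLt, ← hAt]
    rintro σ' - ⟨jL, jA, jy, jy', jJ⟩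
    refine ⟨jL, jA, jy, jy', ?_⟩
    have e2 : jointList DL DA S S' T y y' (t + 1) = jointList DL DA S S' T y y' t ++ prodList T
        (DL.mixList (pt S) S.length (playerState S T ((List.range (t + 1)).map y)).2)
        (DA.mixList (pt S') S'.length (playerState S' T ((List.range (t + 1)).map y')).2) := by
      rw [jointList, List.range_succ (n := t), List.flatMap_append, List.flatMap_singleton,
        ← List.range_succ]
      rfl
    rw [e2]
    exact jJ
  · rintro t σ x ⟨iL, iA, iy, iy', iJ⟩
    exact ⟨iL, iA, iy, iy', iJ.congr (RamState.writeN_N_ne _ _ _ _ (by norm_num))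
      (RamState.writeN_N_ne _ _ _ _ (by norm_num)) (RamState.writeN_N_ne _ _ _ _ (by norm_num)) rfl⟩
  · rintro σ - ⟨-, -, -, -, iJ⟩
    refine ⟨T, L, A, hT1, hTbig, hL, hA, iJ.displaysJoint ?_ ?_⟩
    · intro e he
      obtain ⟨t, -, he⟩ := List.mem_flatMap.1 he
      obtain ⟨f, hf, he⟩ := List.mem_flatMap.1 he
      obtain ⟨f', hf', rfl⟩ := List.mem_map.1 he
      have h1 := DL.mem_mixList (fun s hs => hS _ (pt_mem hs)) (hprob t) hf
      have h2 := DA.mem_mixList (fun s hs => hS' _ (pt_mem hs)) (hprob' t) hf'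
      exact ⟨h1.1, h2.1, div_nonneg (mul_nonneg h1.2 h2.2) (Nat.cast_nonneg _)⟩
    · intro i j
      rw [jointList, sum_map_flatMap_range, averagePlay, mul_sum]
      refine sum_congr rfl fun t _ => ?_
      rw [sum_prodList_ite, DL.sum_mixList_ite, DA.sum_mixList_ite, ← hLt, ← hAt]

end

/-! ### Choice of parameters -/

theorem log_natCast_le_sub_one {N : ℕ} (hN : 1 ≤ N) : Real.log N ≤ N - 1 :=
  Real.log_le_sub_one_of_pos (by exact_mod_cast hN)

/-- The step parameter is about `√(T / N)`, which balances `N * k * log N` against `T / k`. The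
bound `e / 2` leaves room for the factor two lost in choosing the accuracy. -/
theorem regretRate_le {N T : ℕ} (hN : 1 ≤ N) (hT : 1 ≤ T) {e : ℝ} (he : 0 < e) (he1 : e ≤ 1)
    (h : 1024 * N * (1 + Real.log N) ^ 2 ≤ T * e ^ 2) : regretRate N T (e / 4) ≤ e / 2 := by
  have hNr : (1 : ℝ) ≤ N := by exact_mod_cast hN
  have hTr : (1 : ℝ) ≤ T := by exact_mod_cast hT
  have hlog : 0 ≤ Real.log N := Real.log_nonneg hNr
  set l := 1 + Real.log N with hl
  have hl1 : 1 ≤ l := by linarith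
  obtain ⟨hk2, hkT⟩ := stepK_spec hN T
  set k := stepK N T with hk
  have hk2r : (2 : ℝ) ≤ k := by exact_mod_cast hk2
  have hkTr : (T : ℝ) ≤ k * k * N := by exact_mod_cast hkT
  have hke : 32 * l ≤ k * e := by
    have h1 : 1024 * N * l ^ 2 ≤ (k * k * N) * e ^ 2 := h.trans (by gcongr)
    have h2 : (32 * l) ^ 2 ≤ (k * e) ^ 2 := by
      refine le_of_mul_le_mul_right (a := (N : ℝ)) ?_ (by linarith)
      nlinarith
    exact le_of_sq_le_sq h2 (by positivity)
  have hk3 : 32 ≤ (k : ℝ) := by nlinarith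
  have hk3' : 32 ≤ k := by exact_mod_cast hk3
  -- Minimality of `k` gives the reverse comparison: as `k ≥ 32`, it implies `k² * N ≤ 2 * T`.
  have hlt : (k - 1) * (k - 1) * N < T := stepK_lt (by omega) (by omega)
  have hltr : ((k : ℝ) - 1) * (k - 1) * N < T := by
    have : (((k - 1) * (k - 1) * N : ℕ) : ℝ) < T := by exact_mod_cast hlt
    rw [Nat.cast_mul, Nat.cast_mul, Nat.cast_sub (by omega)] at this
    simpa using this
  have hT0 : (0 : ℝ) < T := by linarith
  rw [regretRate, div_le_iff₀ hT0]
  have p1 : N * (k * Real.log N) ≤ e / 8 * T := by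
    have a1 : (k : ℝ) * k * N ≤ 2 * T := by nlinarith
    have a2 : N * (k * Real.log N) ≤ N * (k * l) := by gcongr; linarith
    have a3 : N * (k * l) * 32 ≤ (k * k * N) * e := by
      nlinarith [mul_le_mul_of_nonneg_left hke (by positivity : (0 : ℝ) ≤ N * k)]
    have a4 : (k * k * N) * e ≤ 2 * T * e := by gcongr
    nlinarith
  have p2 : 2 / (k : ℝ) * T ≤ e / 16 * T := by
    refine mul_le_mul_of_nonneg_right ?_ hT0.le
    rw [div_le_div_iff₀ (by linarith) (by norm_num)]
    nlinarith
  have p3 : 2 ≤ e / 512 * T := by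
    have b1 : 1024 ≤ T * e ^ 2 := by
      refine le_trans ?_ h
      have : 1 ≤ N * l ^ 2 := by nlinarith [one_le_pow₀ hl1 (n := 2)]
      linarith
    have b2 : T * e ^ 2 ≤ T * e := by
      gcongr
      nlinarith
    linarith
  -- The four parts of the rate add up: `1/8 + 1/16 + 1/512 + 1/4 ≤ 1/2`.
  nlinarith

/-- A bound on the size of a net of scale `√e`. -/
noncomputable def netSize (d : ℕ) (e : ℝ) : ℝ := 2 * d * (5 / √e) ^ (d - 1)

theorem exists_net {d n : ℕ} (hd : 1 ≤ d) (hn : 1 ≤ n) {a : Fin n → EuclideanSpace ℝ (Fin d)}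
    (ha : ∀ i, ‖a i‖ ≤ 1) {e : ℝ} (he : 0 < e) (he1 : e ≤ 1) :
    ∃ S : List (EuclideanSpace ℝ (Fin d)), (S.length : ℝ) ≤ netSize d e ∧
      IsHullNet a (e / 4) S := by
  have := exists_isHullNet hd hn ha (Real.sqrt_pos.2 he) (Real.sqrt_le_one.2 he1)
  rwa [Real.sq_sqrt he.le] at this

open Classical in
/-- A net of the hull of `a` that supports it up to `e / 4`. -/
noncomputable def hullNet {d n : ℕ} (a : Fin n → EuclideanSpace ℝ (Fin d)) (e : ℝ) :
    List (EuclideanSpace ℝ (Fin d)) :=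
  if h : ∃ S : List (EuclideanSpace ℝ (Fin d)), (S.length : ℝ) ≤ netSize d e ∧
      IsHullNet a (e / 4) S then h.choose else []

theorem hullNet_spec {d n : ℕ} (hd : 1 ≤ d) (hn : 1 ≤ n) {a : Fin n → EuclideanSpace ℝ (Fin d)}
    (ha : ∀ i, ‖a i‖ ≤ 1) {e : ℝ} (he : 0 < e) (he1 : e ≤ 1) :
    ((hullNet a e).length : ℝ) ≤ netSize d e ∧ IsHullNet a (e / 4) (hullNet a e) := by
  have h := exists_net hd hn ha he he1
  rw [hullNet, dif_pos h]
  exact h.choose_spec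

theorem IsHullNet.length_pos {d n : ℕ} (hn : 1 ≤ n) {a : Fin n → EuclideanSpace ℝ (Fin d)} {δ : ℝ}
    {S : List (EuclideanSpace ℝ (Fin d))} (h : IsHullNet a δ S) : 1 ≤ S.length := by
  obtain ⟨z, hz, -⟩ := h.2 (a ⟨0, hn⟩) (subset_convexHull _ _ ⟨_, rfl⟩) 0
  exact List.length_pos_of_mem hz

/-- The number of rounds needed for accuracy `ε`. -/
noncomputable def roundsNeeded (C d : ℕ) (ε : ℝ) : ℝ :=
  ((C : ℝ) / ε) ^ (((d : ℝ) + 3) / 2) * (1 + Real.log (1 / ε)) ^ C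

/-- The accuracies that can be reached in `T` rounds. -/
def accuracies (C d T : ℕ) : Set ℝ := {ε | 0 < ε ∧ ε ≤ 1 ∧ roundsNeeded C d ε ≤ T}

/-- The algorithm may depend on `T` but not on `ε`, so it aims at nearly the best accuracy. A factor
two above the infimum avoids asking whether the infimum is attained; the infimum is positive since
every attainable accuracy is at least `1 / T`. -/
theorem exists_best_accuracy {C d T : ℕ} (hC : 1 ≤ C) (hT : 1 ≤ T)
    (hne : (accuracies C d T).Nonempty) :
    ∃ e ∈ accuracies C d T, ∀ ε ∈ accuracies C d T, e ≤ 2 * ε := by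
  have hTr : (0 : ℝ) < T := by exact_mod_cast hT
  have hlb : ∀ ε ∈ accuracies C d T, 1 / (T : ℝ) ≤ ε := by
    rintro ε ⟨h0, h1, h⟩
    have hCr : (1 : ℝ) ≤ C := by exact_mod_cast hC
    have hlog : 0 ≤ Real.log (1 / ε) := Real.log_nonneg (by rw [le_div_iff₀ h0]; linarith)
    have hC1 : 1 / ε ≤ (C : ℝ) / ε := by gcongr
    have hε1 : 1 ≤ 1 / ε := by rw [le_div_iff₀ h0]; linarith
    have h2 : (C : ℝ) / ε ≤ ((C : ℝ) / ε) ^ (((d : ℝ) + 3) / 2) :=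
      Real.self_le_rpow_of_one_le (hε1.trans hC1) (by
        have : (0 : ℝ) ≤ d := Nat.cast_nonneg d
        linarith)
    have h3 : ((C : ℝ) / ε) ^ (((d : ℝ) + 3) / 2) ≤ roundsNeeded C d ε :=
      le_mul_of_one_le_right (by linarith) (one_le_pow₀ (by linarith))
    rw [div_le_iff₀ hTr]
    have h4 : 1 / ε ≤ T := by linarith
    rw [div_le_iff₀ h0] at h4
    linarith
  have hs : 1 / (T : ℝ) ≤ sInf (accuracies C d T) := le_csInf hne hlb
  have hpos : 0 < sInf (accuracies C d T) := lt_of_lt_of_le (by positivity) hs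
  obtain ⟨e, he, hlt⟩ := exists_lt_of_csInf_lt hne (by linarith :
    sInf (accuracies C d T) < 2 * sInf (accuracies C d T))
  have hbdd : BddBelow (accuracies C d T) := ⟨_, hlb⟩
  exact ⟨e, he, fun ε hε => by linarith [csInf_le hbdd hε]⟩

/-- The exponent splits as `(d + 3) / 2 = (d - 1) / 2 + 2`: the first part pays for the net, the
second for `1 / e²`. Powers of the dimension from `netSize` and from `log N` are absorbed into the
base of the first part. -/
theorem net_rounds_le {C d N : ℕ} (hC : 1600 ≤ C) (hd : 1 ≤ d) (hN1 : 1 ≤ N) {e : ℝ} (he : 0 < e)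
    (he1 : e ≤ 1) (hN : (N : ℝ) ≤ netSize d e) :
    1024 * N * (1 + Real.log N) ^ 2 ≤ roundsNeeded C d e * e ^ 2 := by
  obtain ⟨k, rfl⟩ : ∃ k, d = k + 1 := ⟨d - 1, by omega⟩
  have hCr : (1600 : ℝ) ≤ C := by exact_mod_cast hC
  have hNr : (1 : ℝ) ≤ N := by exact_mod_cast hN1
  have hs : 0 < √e := Real.sqrt_pos.2 he
  set A := 5 / √e with hA
  have hApos : 0 < A := by positivity
  set l := Real.log (1 / e) with hl
  have hl0 : 0 ≤ l := Real.log_nonneg (by rw [le_div_iff₀ he]; linarith)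
  have hlogA : Real.log A ≤ 4 + l / 2 := by
    rw [hA, Real.log_div (by norm_num) hs.ne', Real.log_sqrt he.le, hl, one_div, Real.log_inv]
    have := Real.log_le_sub_one_of_pos (by norm_num : (0 : ℝ) < 5)
    linarith
  rw [netSize, Nat.add_sub_cancel, ← hA] at hN
  have hk0 : (0 : ℝ) ≤ k := Nat.cast_nonneg k
  push_cast at hN
  have hlogN : 1 + Real.log N ≤ 6 * (k + 1) * (1 + l) := by
    have h1 := Real.log_le_log (by linarith) hN
    rw [Real.log_mul (by positivity) (by positivity), Real.log_pow] at h1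
    have h2 := Real.log_le_sub_one_of_pos (by positivity : (0 : ℝ) < 2 * ((k : ℝ) + 1))
    have h3 : (k : ℝ) * Real.log A ≤ k * (4 + l / 2) := by gcongr
    nlinarith [mul_nonneg hk0 hl0]
  have hlogN0 : 0 ≤ 1 + Real.log N := by linarith [Real.log_nonneg hNr]
  have hk2 : ((k : ℝ) + 1) ^ 3 ≤ 8 ^ k := by
    have h1 : k + 1 ≤ 2 ^ k := Nat.lt_two_pow_self
    have h2 : (k : ℝ) + 1 ≤ 2 ^ k := by exact_mod_cast h1
    calc ((k : ℝ) + 1) ^ 3 ≤ (2 ^ k) ^ 3 := by gcongr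
      _ = 8 ^ k := by rw [← pow_mul, mul_comm, pow_mul]; norm_num
  have hup : 1024 * N * (1 + Real.log N) ^ 2 ≤ 73728 * ((8 * A) ^ k * (1 + l) ^ 2) :=
    calc 1024 * N * (1 + Real.log N) ^ 2
        ≤ 1024 * (2 * (k + 1) * A ^ k) * (6 * (k + 1) * (1 + l)) ^ 2 := by gcongr
      _ = 73728 * ((k + 1) ^ 3 * A ^ k * (1 + l) ^ 2) := by ring
      _ ≤ 73728 * (8 ^ k * A ^ k * (1 + l) ^ 2) := by gcongr
      _ = _ := by rw [mul_pow]
  have hCe : 0 < (C : ℝ) / e := by positivity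
  have hpow : ((C : ℝ) / e) ^ (((k + 1 : ℕ) + 3 : ℝ) / 2) = √(C / e) ^ k * (C / e) ^ 2 := by
    have : (((k + 1 : ℕ) + 3 : ℝ) / 2) = 1 / 2 * k + (2 : ℕ) := by push_cast; ring
    rw [this, Real.rpow_add hCe, Real.rpow_mul hCe.le, ← Real.sqrt_eq_rpow, Real.rpow_natCast,
      Real.rpow_natCast]
  -- Here `8 * A = 40 / √e`, which is why `C` must be at least `1600 = 40²`.
  have hA8 : 8 * A ≤ √(C / e) := by
    refine Real.le_sqrt_of_sq_le ?_
    rw [hA, mul_pow, div_pow, Real.sq_sqrt he.le, ← mul_div_assoc]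
    gcongr
    linarith
  have hl2 : (1 + l) ^ 2 ≤ (1 + l) ^ C := pow_le_pow_right₀ (by linarith) (by omega)
  have hC2 : (73728 : ℝ) ≤ (C / e) ^ 2 * e ^ 2 := by
    rw [← mul_pow, div_mul_cancel₀ _ he.ne']
    nlinarith
  refine hup.trans ?_
  rw [roundsNeeded, hpow, ← hl]
  calc 73728 * ((8 * A) ^ k * (1 + l) ^ 2)
      ≤ ((C / e) ^ 2 * e ^ 2) * (√(C / e) ^ k * (1 + l) ^ C) := by gcongr
    _ = _ := by ring

open Classical in
/-- The discretization used for the horizon `T`. -/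
noncomputable def onlineNet (C d n T : ℕ) (a : Fin n → EuclideanSpace ℝ (Fin d)) :
    List (EuclideanSpace ℝ (Fin d)) :=
  if h : ∃ e ∈ accuracies C d T, ∀ ε ∈ accuracies C d T, e ≤ 2 * ε then hullNet a h.choose
  else if hn : 1 ≤ n then [a ⟨0, hn⟩] else []

/-- If no accuracy is attainable in `T` rounds, one point suffices for a running program and the
regret claim is vacuous. Otherwise the requirement on rounds itself shows that the net has at most
`T` points. -/
theorem onlineNet_spec {C d n T : ℕ} (hC : 1600 ≤ C) (hd : 1 ≤ d) (hn : 1 ≤ n) (hT : 1 ≤ T)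
    {a : Fin n → EuclideanSpace ℝ (Fin d)} (ha : ∀ i, ‖a i‖ ≤ 1) :
    (∀ x ∈ onlineNet C d n T a, x ∈ convexHull ℝ (Set.range a)) ∧
    (onlineNet C d n T a).length ≤ T ∧ 1 ≤ (onlineNet C d n T a).length ∧
    ∃ δ : ℝ, 0 ≤ δ ∧ ((accuracies C d T).Nonempty → IsHullNet a δ (onlineNet C d n T a)) ∧
      ∀ ε ∈ accuracies C d T, regretRate (onlineNet C d n T a).length T δ ≤ ε := by
  by_cases h : ∃ e ∈ accuracies C d T, ∀ ε ∈ accuracies C d T, e ≤ 2 * ε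
  · have hdef : onlineNet C d n T a = hullNet a h.choose := by rw [onlineNet, dif_pos h]
    obtain ⟨⟨he, he1, heT⟩, hbest⟩ := h.choose_spec
    set e := h.choose
    rw [hdef]
    obtain ⟨hlen, hnet⟩ := hullNet_spec hd hn ha he he1
    have h1 := hnet.length_pos hn
    have hkey := net_rounds_le hC hd h1 he he1 hlen
    have hkey' := hkey.trans (mul_le_mul_of_nonneg_right heT (sq_nonneg e))
    refine ⟨hnet.1, ?_, h1, e / 4, by positivity, fun _ => hnet, fun ε hε => ?_⟩
    · have h1r : (1 : ℝ) ≤ (hullNet a e).length := by exact_mod_cast h1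
      have hl : 1 ≤ (1 + Real.log (hullNet a e).length) ^ 2 :=
        one_le_pow₀ (by linarith [Real.log_nonneg h1r])
      have hTr : (0 : ℝ) ≤ T := Nat.cast_nonneg T
      have he2 : (T : ℝ) * e ^ 2 ≤ T := mul_le_of_le_one_right hTr (pow_le_one₀ he.le he1)
      have : ((hullNet a e).length : ℝ) ≤ T := by nlinarith
      exact_mod_cast this
    · exact (regretRate_le h1 hT he he1 hkey').trans (by linarith [hbest ε hε])
  · have hdef : onlineNet C d n T a = [a ⟨0, hn⟩] := by rw [onlineNet, dif_neg h, dif_pos hn]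
    have hempty : ¬ (accuracies C d T).Nonempty := fun hne =>
      h (exists_best_accuracy (by omega) hT hne)
    rw [hdef]
    refine ⟨?_, by simpa using hT, by simp, 0, le_rfl, fun hne => absurd hne hempty,
      fun ε hε => absurd ⟨ε, hε⟩ hempty⟩
    simpa using subset_convexHull ℝ (Set.range a) ⟨_, rfl⟩

theorem netSize_le {d : ℕ} (hd : 1 ≤ d) {e : ℝ} (he : 0 < e) (he1 : e ≤ 1 / 2) :
    netSize d e ≤ (1 / e) ^ (5 * d) := by
  have hr : 2 ≤ 1 / e := by rw [le_div_iff₀ he]; linarith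
  set r := 1 / e with hrdef
  have hs : 0 < √e := Real.sqrt_pos.2 he
  have h1 : 5 / √e ≤ r ^ 4 := by
    have h2 : e ≤ √e := Real.le_sqrt_of_sq_le (by nlinarith)
    have h3 : 5 / √e ≤ 5 * r := by
      rw [hrdef, mul_one_div]; gcongr
    nlinarith [pow_le_pow_left₀ (by norm_num) hr 3]
  have h2 : (2 * d : ℝ) ≤ r ^ d := by
    have h3 : 2 * d ≤ 2 ^ d := by
      obtain ⟨k, rfl⟩ : ∃ k, d = k + 1 := ⟨d - 1, by omega⟩
      have : k + 1 ≤ 2 ^ k := Nat.lt_two_pow_self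
      rw [pow_succ]; omega
    calc (2 * d : ℝ) ≤ 2 ^ d := by exact_mod_cast h3
      _ ≤ r ^ d := by gcongr
  calc netSize d e ≤ r ^ d * (r ^ 4) ^ (d - 1) := by rw [netSize]; gcongr
    _ = r ^ (d + 4 * (d - 1)) := by rw [← pow_mul, ← pow_add]
    _ ≤ r ^ (5 * d) := pow_le_pow_right₀ (by linarith) (by omega)

/-! ### Final bounds and assembly -/

theorem exists_centralProg_run {d n m k : ℕ} (hd : 1 ≤ d) (hn : 1 ≤ n) (hm : 1 ≤ m)
    (G : StructuredGame d n m) (DL : DecompOracle G.v) (DA : DecompOracle G.w')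
    (hL : DL.time ≤ (d + 1) ^ k) (hA : DA.time ≤ (d + 1) ^ k) {ε : ℝ} (hε : 0 < ε)
    (hε1 : ε ≤ 1 / 2) :
    ∃ (s : RamState) (c : ℕ) (μ : Fin n × Fin m → ℝ),
      RamExec (centralEnv G DL DA) RamProg.centralProg
        (centralInit ε (hullNet G.v ε) (hullNet G.w' ε)) s c ∧
      (c : ℝ) ≤ (1 / ε) ^ (38 * (k + 40) * d) ∧ DisplaysJoint s μ ∧ IsCorrelatedEq G ε μ := by
  have hr : 2 ≤ 1 / ε := by rw [le_div_iff₀ hε]; linarith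
  have hrε : (1 / ε) * ε = 1 := by field_simp
  set r := 1 / ε with hrdef
  have hr1 : 1 ≤ r := by linarith
  obtain ⟨hlen, hnet⟩ := hullNet_spec hd hn G.norm_v hε (by linarith)
  obtain ⟨hlen', hnet'⟩ := hullNet_spec hd hm G.norm_w' hε (by linarith)
  set S := hullNet G.v ε
  set S' := hullNet G.w' ε
  replace hlen := hlen.trans (netSize_le hd hε hε1)
  replace hlen' := hlen'.trans (netSize_le hd hε hε1)
  have hN := hnet.length_pos hn
  have hN' := hnet'.length_pos hm
  have hmono : ∀ {i j : ℕ}, i ≤ j → r ^ i ≤ r ^ j := fun h => pow_le_pow_right₀ hr1 h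
  have h2pow : ∀ i : ℕ, (2 : ℝ) ^ i ≤ r ^ i := fun i => pow_le_pow_left₀ (by norm_num) hr i
  -- One size dominating everything: nets have at most `r ^ (5 * d)` points, an oracle takes at most
  -- `r ^ (k * d)`, and the horizon is at most `r ^ (15 * d + 16)`. Stray constants are paid with
  -- powers of `r ≥ 2`, using `d ≥ 1`.
  set X := ⌊r ^ ((k + 40) * d)⌋₊ with hX
  have hleX : ∀ a : ℕ, (a : ℝ) ≤ r ^ ((k + 40) * d) → a ≤ X := fun a h => Nat.le_floor h
  have hexp : ∀ i : ℕ, i ≤ k + 40 → i * d ≤ (k + 40) * d := fun i h => Nat.mul_le_mul_right d h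
  have hd2 : ((d : ℝ) + 1) ≤ r ^ d := by
    have : d + 1 ≤ 2 ^ d := Nat.lt_two_pow_self
    calc ((d : ℝ) + 1) ≤ 2 ^ d := by exact_mod_cast this
      _ ≤ r ^ d := h2pow d
  have htime : ∀ t : ℕ, t ≤ (d + 1) ^ k → (t : ℝ) ≤ r ^ (k * d) := by
    intro t ht
    calc (t : ℝ) ≤ ((d : ℝ) + 1) ^ k := by exact_mod_cast ht
      _ ≤ (r ^ d) ^ k := by gcongr
      _ = r ^ (k * d) := by rw [← pow_mul, mul_comm]
  have hcostX : ∀ t : ℕ, t ≤ (d + 1) ^ k → d + t + 1 ≤ X := by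
    intro t ht
    refine hleX _ ?_
    push_cast
    have h1 : r ^ d ≤ r ^ ((k + 1) * d) := hmono (by nlinarith)
    have h2 : r ^ (k * d) ≤ r ^ ((k + 1) * d) := hmono (by nlinarith)
    have h3 : 2 * r ^ ((k + 1) * d) ≤ r * r ^ ((k + 1) * d) := by gcongr
    have h4 : r * r ^ ((k + 1) * d) ≤ r ^ ((k + 40) * d) := by
      rw [← pow_succ']; exact hmono (by nlinarith)
    linarith [htime t ht]
  have hlenX : ∀ (N t : ℕ), (N : ℝ) ≤ r ^ (5 * d) → t ≤ (d + 1) ^ k → N * t ≤ X := by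
    intro N t hNr ht
    refine hleX _ ?_
    push_cast
    calc (N : ℝ) * t ≤ r ^ (5 * d) * r ^ (k * d) := by gcongr; exact htime t ht
      _ = r ^ ((5 + k) * d) := by rw [← pow_add]; ring_nf
      _ ≤ _ := hmono (hexp _ (by omega))
  have hX4 : 4 ≤ X := by
    refine hleX _ ?_
    calc ((4 : ℕ) : ℝ) = 2 ^ 2 := by norm_num
      _ ≤ r ^ 2 := h2pow 2
      _ ≤ _ := hmono (by nlinarith)
  set B : ℝ := 1024 * ((S.length : ℝ) + S'.length) ^ 3 with hB
  have hNr : (1 : ℝ) ≤ S.length := by exact_mod_cast hN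
  have hNr' : (1 : ℝ) ≤ S'.length := by exact_mod_cast hN'
  have hBpos : 0 < B := by positivity
  set T₀ := ⌈B * r ^ 2⌉₊ with hT₀
  have hT₀1 : 1 ≤ T₀ := Nat.one_le_iff_ne_zero.2 (Nat.ceil_pos.2 (by positivity)).ne'
  have hT₀X : T₀ ≤ X := by
    refine hleX _ ?_
    have h1 : (T₀ : ℝ) ≤ B * r ^ 2 + 1 := (Nat.ceil_lt_add_one (by positivity)).le
    have h2 : B ≤ r ^ 13 * r ^ (15 * d) := by
      calc B ≤ 1024 * (r ^ (5 * d) + r ^ (5 * d)) ^ 3 := by rw [hB]; gcongr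
        _ = 2 ^ 13 * r ^ (15 * d) := by
          have : r ^ (15 * d) = (r ^ (5 * d)) ^ 3 := by rw [← pow_mul]; ring_nf
          rw [this]; ring
        _ ≤ r ^ 13 * r ^ (15 * d) := by gcongr
    have h3 : B * r ^ 2 ≤ r ^ (15 * d + 15) := by
      calc B * r ^ 2 ≤ r ^ 13 * r ^ (15 * d) * r ^ 2 := by gcongr
        _ = _ := by rw [pow_add r (15 * d) 15]; ring
    have h4 : 1 ≤ r ^ (15 * d + 15) := one_le_pow₀ hr1
    have h5 : 2 * r ^ (15 * d + 15) ≤ r * r ^ (15 * d + 15) := by gcongr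
    have h6 : r * r ^ (15 * d + 15) ≤ r ^ ((k + 40) * d) := by
      rw [← pow_succ']; exact hmono (by nlinarith [Nat.zero_le (k * d)])
    linarith
  have hbig : B ≤ T₀ * ε ^ 2 := by
    have h1 : B * r ^ 2 ≤ T₀ := Nat.le_ceil _
    calc B = B * r ^ 2 * ε ^ 2 := by rw [mul_assoc, ← mul_pow, hrε]; ring
      _ ≤ T₀ * ε ^ 2 := by gcongr
  have hSX : ∀ N : ℕ, (N : ℝ) ≤ r ^ (5 * d) → N ≤ X := fun N h =>
    hleX _ (h.trans (hmono (hexp 5 (by omega))))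
  obtain ⟨s, c, hx, hc, T, L, A, hT1, hTbig, hLp, hAp, hdisp⟩ := runs_centralProg (G := G) (DL := DL)
    (DA := DA) hX4 hε hT₀1 hT₀X hnet.1 hnet'.1 hN hN' (hSX _ hlen) (hSX _ hlen')
    (hcostX _ hL) (hcostX _ hA) (hlenX _ _ hlen hL) (hlenX _ _ hlen' hA) hbig
  have hrate : ∀ {N N' : ℕ}, 1 ≤ N → 1024 * ((N : ℝ) + N') ^ 3 ≤ T * ε ^ 2 →
      regretRate N T (ε / 4) ≤ ε := by
    intro N N' h1 h
    refine (regretRate_le h1 hT1 hε (by linarith) (le_trans ?_ h)).trans (by linarith)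
    have h1r : (1 : ℝ) ≤ N := by exact_mod_cast h1
    have hlog0 := Real.log_nonneg h1r
    have hlog := log_natCast_le_sub_one h1
    -- Since `1 + log N ≤ N`, the cubic requirement tested by the program implies the one with
    -- logarithms.
    calc 1024 * N * (1 + Real.log N) ^ 2 ≤ 1024 * N * (N : ℝ) ^ 2 := by gcongr; linarith
      _ = 1024 * (N : ℝ) ^ 3 := by ring
      _ ≤ 1024 * ((N : ℝ) + N') ^ 3 := by
        have : (0 : ℝ) ≤ N' := Nat.cast_nonneg N'
        gcongr; linarith
  refine ⟨s, c, _, hx, ?_, hdisp, isCorrelatedEq_averagePlay hT1 G (by positivity) (by positivity)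
    hnet hnet' hN hN' hLp hAp (hrate hN hTbig) (hrate hN' (by rw [add_comm]; exact hTbig))⟩
  calc (c : ℝ) ≤ (X : ℝ) ^ 38 := by exact_mod_cast hc
    _ ≤ (r ^ ((k + 40) * d)) ^ 38 := by
      gcongr; exact Nat.floor_le (by positivity)
    _ = _ := by rw [← pow_mul]; ring_nf

theorem runsWithin_onlineNet {C d n m T : ℕ} (hC : 1600 ≤ C) (hd : 1 ≤ d) (hn : 1 ≤ n) (hT : 1 ≤ T)
    {a : Fin n → EuclideanSpace ℝ (Fin d)} (ha : ∀ i, ‖a i‖ ≤ 1)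
    {b : Fin m → EuclideanSpace ℝ (Fin d)} (hb : ∀ j, ‖b j‖ ≤ 1) (D : DecompOracle a)
    {L : LearningAlgorithm n m} (hL : IsPlayer D (onlineNet C d n T a) T b L) :
    RunsWithin RamProg.playerProg (playerEnv D) (playerInit T (onlineNet C d n T a)) b T
      ((d + T + D.time) ^ C) L := by
  obtain ⟨hhull, hlen, hpos, -⟩ := onlineNet_spec hC hd hn hT ha
  set M := d + T + D.time with hM
  have hM2 : 2 ≤ M := by omega
  have hMX : M ≤ M ^ 2 := by nlinarith
  -- `M` itself may be only 2, whereas the cost calculus needs `X ≥ 4`; squaring gives the bound `M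
  -- ^ 62`, within `M ^ C`.
  have h := runsWithin_playerProg (X := M ^ 2) (by nlinarith) ha hb hhull hpos
    (by omega) hT (by omega) (show d + D.time + 1 ≤ M ^ 2 by omega) hL
  intro q
  obtain ⟨σ, h0, hσ⟩ := h q
  refine ⟨σ, h0, fun t ht => ?_⟩
  obtain ⟨c, hc, hx⟩ := hσ t ht
  refine ⟨c, hc.trans ?_, hx⟩
  rw [← pow_mul]
  exact Nat.pow_le_pow_right (by omega) (by omega)

theorem corollary2 :
    -- an absolute constant, and one program that both players run
    ∃ (C : ℕ) (P : RamProg)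
      -- for each player, horizon `T`: the discretization of the hull of that player's embeddings
      (disc : (d n T : ℕ) → (Fin n → EuclideanSpace ℝ (Fin d)) →
        List (EuclideanSpace ℝ (Fin d)))
      -- a centralized program, and the discretizations it uses for accuracy `ε`
      (Q : RamProg)
      (cdisc : (d n : ℕ) → (ε : ℝ) → (Fin n → EuclideanSpace ℝ (Fin d)) →
        List (EuclideanSpace ℝ (Fin d))),
      0 < C ∧
      -- discretizations consist of few points of the hull
      (∀ (d n T : ℕ) (a : Fin n → EuclideanSpace ℝ (Fin d)), 1 ≤ d → 1 ≤ n → 1 ≤ T →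
        (∀ i, ‖a i‖ ≤ 1) →
        (∀ x ∈ disc d n T a, x ∈ convexHull ℝ (Set.range a)) ∧
        (disc d n T a).length ≤ (d + T) ^ C) ∧
      (∀ (d n : ℕ) (ε : ℝ) (a : Fin n → EuclideanSpace ℝ (Fin d)), 1 ≤ d → 1 ≤ n →
        0 < ε → ε ≤ 1 / 2 → (∀ i, ‖a i‖ ≤ 1) →
        (∀ x ∈ cdisc d n ε a, x ∈ convexHull ℝ (Set.range a)) ∧
        ((cdisc d n ε a).length : ℝ) ≤ (1 / ε) ^ (C * d)) ∧
      -- the learning algorithms, their guarantee and their running time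
      (∀ (d n m T : ℕ), 1 ≤ d → 1 ≤ n → 1 ≤ m → 1 ≤ T →
        ∀ (G : StructuredGame d n m) (DL : DecompOracle G.v) (DA : DecompOracle G.w'),
        ∃ (L : LearningAlgorithm n m) (A : LearningAlgorithm m n),
          (∀ ε : ℝ, 0 < ε → ε ≤ 1 →
            ((C : ℝ) / ε) ^ (((d : ℝ) + 3) / 2) * (1 + Real.log (1 / ε)) ^ C ≤ (T : ℝ) →
            IsCorrelatedEq G ε (averagePlay L A T)) ∧
          RunsWithin P (playerEnv DL) (playerInit T (disc d n T G.v)) G.w T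
            ((d + T + DL.time) ^ C) L ∧
          RunsWithin P (playerEnv DA) (playerInit T (disc d m T G.w')) G.v' T
            ((d + T + DA.time) ^ C) A) ∧
      -- computing an `ε`-correlated equilibrium, for oracles running in time polynomial in `d`
      (∀ k : ℕ, ∃ K : ℕ, ∀ (d n m : ℕ), 1 ≤ d → 1 ≤ n → 1 ≤ m →
        ∀ (G : StructuredGame d n m) (DL : DecompOracle G.v) (DA : DecompOracle G.w'),
        DL.time ≤ (d + 1) ^ k → DA.time ≤ (d + 1) ^ k →
        ∀ ε : ℝ, 0 < ε → ε ≤ 1 / 2 →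
        ∃ (s : RamState) (c : ℕ) (μ : Fin n × Fin m → ℝ),
          RamExec (centralEnv G DL DA) Q
            (centralInit ε (cdisc d n ε G.v) (cdisc d m ε G.w')) s c ∧
          (c : ℝ) ≤ (1 / ε) ^ (K * d) ∧
          DisplaysJoint s μ ∧ IsCorrelatedEq G ε μ) := by
  -- Only the inequality is kept, so that the large numeral is not unfolded in exponents; it also
  -- covers the exponents 5 for the nets and 62 for the steps.
  obtain ⟨C, hC⟩ : ∃ C : ℕ, 1600 ≤ C := ⟨1600, le_rfl⟩
  refine ⟨C, RamProg.playerProg, fun d n T a => onlineNet C d n T a, RamProg.centralProg,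
    fun d n ε a => hullNet a ε, by omega, ?_, ?_, ?_, ?_⟩
  · intro d n T a hd hn hT ha
    obtain ⟨h1, h2, -⟩ := onlineNet_spec hC hd hn hT ha
    refine ⟨h1, h2.trans ?_⟩
    calc T ≤ d + T := by omega
      _ ≤ (d + T) ^ C := Nat.le_self_pow (by omega) _
  · intro d n ε a hd hn hε hε1 ha
    obtain ⟨h1, h2⟩ := hullNet_spec hd hn ha hε (by linarith)
    refine ⟨h2.1, (h1.trans (netSize_le hd hε hε1)).trans ?_⟩
    refine pow_le_pow_right₀ ?_ (Nat.mul_le_mul_right d (by omega))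
    rw [le_div_iff₀ hε]; linarith
  · intro d n m T hd hn hm hT G DL DA
    obtain ⟨hS, -, hN, δ, hδ, hnet, hrate⟩ := onlineNet_spec hC hd hn hT G.norm_v
    obtain ⟨hS', -, hN', δ', hδ', hnet', hrate'⟩ := onlineNet_spec hC hd hm hT G.norm_w'
    obtain ⟨L, hL⟩ := exists_isPlayer (T := T) DL G.norm_v G.norm_w hS hN hT
    obtain ⟨A, hA⟩ := exists_isPlayer (T := T) DA G.norm_w' G.norm_v' hS' hN' hT
    refine ⟨L, A, fun ε hε hε1 hεT => ?_, runsWithin_onlineNet hC hd hn hT G.norm_v G.norm_w DL hL,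
      runsWithin_onlineNet hC hd hm hT G.norm_w' G.norm_v' DA hA⟩
    have hmem : ε ∈ accuracies C d T := ⟨hε, hε1, hεT⟩
    exact isCorrelatedEq_averagePlay hT G hδ hδ' (hnet ⟨ε, hmem⟩) (hnet' ⟨ε, hmem⟩) hN hN' hL hA
      (hrate ε hmem) (hrate' ε hmem)
  · intro k
    refine ⟨38 * (k + 40), fun d n m hd hn hm G DL DA hL hA ε hε hε1 => ?_⟩
    exact exists_centralProg_run hd hn hm G DL DA hL hA hε hε1
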